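/- **Setting.** On a probability space let $G\in\{0,1\}$ (group), $X$ (baseline covariates), $Y_0,Y_1\in\mathbb R$ (observed pre- and post-treatment outcomes) and $M$ (mediator) be observed, write $O=(G,X,Y_0,M,Y_1)$, $\Delta Y=Y_1-Y_0$, and let $Y_0(g)$, $M(g)$, $Y_1(g,m)$ be the potential outcomes, $g\in\{0,1\}$. Assume $E(\Delta Y^2)<\infty$, that $Y_1(0,M(g))-Y_0(0)$ is integrable given $G=1$ for $g=0,1$, and that $M$ has conditional densities $f(m\mid g,x)$ given $(G,X)=(g,x)$ and $f(m\mid x)$ given $X=x$ with respect to a $\sigma$-finite measure (e.g. counting or Lebesgue measure). Assume further: 1. (No anticipation) $Y_0(1)=Y_0(0)$. 2. (Parallel trends) $E\{Y_1(0,m)-Y_0(0)\mid M(0)=m,G=1,X\}=E\{Y_1(0,m)-Y_0(0)\mid M(0)=m,G=0,X\}$. 3. (Sequential ignorability) $G\perp M(g)\mid X$ for $g=0,1$, and $E\{Y_1(0,m)-Y_0(0)\mid M(1)=m,G=1,X\}=E\{Y_1(0,m)-Y_0(0)\mid M(0)=m,G=1,X\}$. 4. (Positivity) for some constant $c>0$,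 almost surely, $P(G=1)>c$, $P(G=0\mid X)>c$, $P(G=0\mid M,X)>c$ and $f(M\mid X)/f(M\mid G=0,X)>c$. 5. (Consistency) $M(G)=M$, $Y_0(G)=Y_0$, $Y_1(G,M(G))=Y_1$. Let $\pi(x)=P(G=1\mid X=x)$, $\delta(g,m,x)=E(\Delta Y\mid G=g,M=m,X=x)$, and let $\tau(g,g^*)=E[E\{\delta(g,M,X)\mid G=g^*,X\}\mid G=1]$, viewed as a functional of the law of $O$. Let $$\tau_{IE}=E\{Y_1(0,M(1))-Y_1(0,M(0))\mid G=1\},\quad \tau_{DE}=E\{Y_1(1,M(1))-Y_1(0,M(1))\mid G=1\},\quad \tau=E\{Y_1(1,M(1))-Y_1(0,M(0))\mid G=1\}.$$ A *regular submodel* through the law $P$ of $O$ is a dominated one-parameter family $(P_t)_{t\in\mathbb R}$ of laws of $O$ with $P_0=P$ that is differentiable in quadratic mean at $t=0$ with a score $s\in L^2(P)$ and for which, for all $t$ near $0$ and with constants $c',C>0$ not depending on $t$, $P_t(G=1)>c'$, $P_t(G=0\mid X)>c'$, $P_t(G=0\mid M,X)>c'$ and $E_{P_t}(\Delta Y^2)\le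 C$; the law of $O$ is otherwise unrestricted (nonparametric model). The *tangent space* is the closed linear span in $L^2(P)$ of the scores of all regular submodels. An *influence function* of a functional $\psi$ at $P$ is a mean-zero $\varphi\in L^2(P)$ such that $\frac{d}{dt}\psi(P_t)\big|_{t=0}=E_P(\varphi s)$ for every regular submodel; it is the *efficient influence function* if it lies in the tangent space. **Theorem.** The efficient influence functions of $\tau(1,1)$, $\tau(0,0)$ and $\tau(0,1)$ at $P$ are, respectively, $$\varphi(1,1)=\frac{G}{P(G=1)}\{\Delta Y-\tau(1,1)\},$$ $$\varphi(0,0)=\frac{1-G}{P(G=1)}\frac{\pi(X)}{1-\pi(X)}\big[\Delta Y-E\{\delta(0,M,X)\mid G=0,X\}\big]+\frac{G}{P(G=1)}\big[E\{\delta(0,M,X)\mid G=0,X\}-\tau(0,0)\big],$$ $$\varphi(0,1)=\frac{1-G}{P(G=1)}\frac{\pi(X)}{1-\pi(X)}\frac{f(M\mid G=1,X)}{f(M\mid G=0,X)}\{\Delta Y-\delta(0,M,X)\}+\frac{G}{P(G=1)}\{\delta(0,M,X)-\tau(0,1)\}.$$ Moreover $\tau_{IE}=\tau(0,1)-\tau(0,0)$,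 $\tau_{DE}=\tau(1,1)-\tau(0,1)$ and $\tau=\tau(1,1)-\tau(0,0)$, and the efficient influence functions of these identified functionals are $\varphi_{IE}=\varphi(0,1)-\varphi(0,0)$, $\varphi_{DE}=\varphi(1,1)-\varphi(0,1)$ and $\varphi=\varphi(1,1)-\varphi(0,0)$, respectively. -/

import Mathlib

open MeasureTheory ProbabilityTheory Filter Topology
open scoped ENNReal NNReal

noncomputable section

namespace MedDiD

/-! ### Observed data and its functionals -/

/-- The space of one observation `O = (G, X, Y₀, M, Y₁)`; the group `G = 1` is `true`. -/
abbrev Obs (𝒳 ℳ : Type*) := Bool × 𝒳 × ℝ × ℳ × ℝ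

section Observed

variable {𝒳 ℳ : Type*}

/-- The group of an observation. -/
def oG (o : Obs 𝒳 ℳ) : Bool := o.1
/-- The covariates of an observation. -/
def oX (o : Obs 𝒳 ℳ) : 𝒳 := o.2.1
/-- The mediator of an observation. -/
def oM (o : Obs 𝒳 ℳ) : ℳ := o.2.2.2.1
/-- The pair (mediator, covariates) of an observation. -/
def oMX (o : Obs 𝒳 ℳ) : ℳ × 𝒳 := (oM o, oX o)
/-- The outcome change `ΔY = Y₁ - Y₀`. -/
def oΔ (o : Obs 𝒳 ℳ) : ℝ := o.2.2.2.2 - o.2.2.1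
/-- The group as a real number, `0` or `1`. -/
def gR (o : Obs 𝒳 ℳ) : ℝ := if oG o = true then 1 else 0

variable [MeasurableSpace 𝒳] [MeasurableSpace ℳ]

/-- The conditional law of `O` given `G = g`. -/
def group (Q : ProbabilityMeasure (Obs 𝒳 ℳ)) (g : Bool) : Measure (Obs 𝒳 ℳ) :=
  (Q : Measure (Obs 𝒳 ℳ))[|oG ⁻¹' {g}]

instance (Q : ProbabilityMeasure (Obs 𝒳 ℳ)) (g : Bool) : IsFiniteMeasure (group Q g) := by
  unfold group; infer_instance

/-- `P(G = 1)`. -/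
def probTreated (Q : ProbabilityMeasure (Obs 𝒳 ℳ)) : ℝ :=
  (Q : Measure (Obs 𝒳 ℳ)).real (oG ⁻¹' {true})

/-- `P(G = g | X = x)`. -/
def probGivenX (Q : ProbabilityMeasure (Obs 𝒳 ℳ)) (g : Bool) (x : 𝒳) : ℝ :=
  (condDistrib oG oX (Q : Measure (Obs 𝒳 ℳ)) x).real {g}

/-- `P(G = g | M = m, X = x)`. -/
def probGivenMX (Q : ProbabilityMeasure (Obs 𝒳 ℳ)) (g : Bool) (v : ℳ × 𝒳) : ℝ :=
  (condDistrib oG oMX (Q : Measure (Obs 𝒳 ℳ)) v).real {g}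

/-- The propensity score `π(x) = P(G = 1 | X = x)`. -/
def propensity (Q : ProbabilityMeasure (Obs 𝒳 ℳ)) (x : 𝒳) : ℝ := probGivenX Q true x

/-- `δ(g, m, x) = E(Y₁ - Y₀ | G = g, M = m, X = x)`. -/
def delta (Q : ProbabilityMeasure (Obs 𝒳 ℳ)) (g : Bool) (m : ℳ) (x : 𝒳) : ℝ :=
  ∫ y, y ∂(condDistrib oΔ oMX (group Q g) (m, x))

variable [StandardBorelSpace ℳ] [Nonempty ℳ]

/-- `E{δ(g, M, X) | G = g', X = x}`. -/
def nu (Q : ProbabilityMeasure (Obs 𝒳 ℳ)) (g g' : Bool) (x : 𝒳) : ℝ :=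
  ∫ m, delta Q g m x ∂(condDistrib oM oX (group Q g') x)

/-- `τ(g, g') = E[E{δ(g, M, X) | G = g', X} | G = 1]`, a functional of the observed-data law. -/
def tauObs (g g' : Bool) (Q : ProbabilityMeasure (Obs 𝒳 ℳ)) : ℝ :=
  ∫ o, nu Q g g' (oX o) ∂(group Q true)

/-- `f` is a conditional density of `M` given `X`, with respect to the reference measure `ℓ` on
the mediator space (counting measure, Lebesgue measure, a mixture, …), when `O` has law `μ`. -/
def IsMediatorDensity (ℓ : Measure ℳ) (μ : Measure (Obs 𝒳 ℳ)) [IsFiniteMeasure μ]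
    (f : 𝒳 → ℳ → ℝ≥0) : Prop :=
  Measurable (Function.uncurry f) ∧
    ∀ᵐ x ∂(μ.map oX), condDistrib oM oX μ x = ℓ.withDensity (fun m => (f x m : ℝ≥0∞))

/-- `φ(1,1)`. -/
def phi11 (Q : ProbabilityMeasure (Obs 𝒳 ℳ)) (o : Obs 𝒳 ℳ) : ℝ :=
  gR o / probTreated Q * (oΔ o - tauObs true true Q)

/-- `φ(0,0)`. -/
def phi00 (Q : ProbabilityMeasure (Obs 𝒳 ℳ)) (o : Obs 𝒳 ℳ) : ℝ :=
  (1 - gR o) / probTreated Q * (propensity Q (oX o) / (1 - propensity Q (oX o)))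
      * (oΔ o - nu Q false false (oX o))
    + gR o / probTreated Q * (nu Q false false (oX o) - tauObs false false Q)

/-- `φ(0,1)`, where `f g x m` is the mediator density `f(m | g, x)`. -/
def phi01 (Q : ProbabilityMeasure (Obs 𝒳 ℳ)) (f : Bool → 𝒳 → ℳ → ℝ≥0) (o : Obs 𝒳 ℳ) : ℝ :=
  (1 - gR o) / probTreated Q * (propensity Q (oX o) / (1 - propensity Q (oX o)))
      * ((f true (oX o) (oM o) : ℝ) / (f false (oX o) (oM o) : ℝ))
      * (oΔ o - delta Q false (oM o) (oX o))
    + gR o / probTreated Q * (delta Q false (oM o) (oX o) - tauObs false true Q)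

end Observed

/-! ### Efficient influence functions in the nonparametric model -/

section Efficiency

/-- The path `t ↦ P t` is dominated and differentiable in quadratic mean at `t = 0` with
score `s`. -/
def IsDQM {α : Type*} [MeasurableSpace α] (P : ℝ → ProbabilityMeasure α) (s : α → ℝ) : Prop :=
  MemLp s 2 (P 0 : Measure α) ∧
  ∃ (μ : Measure α) (p : ℝ → α → ℝ≥0), SigmaFinite μ ∧ (∀ t, Measurable (p t)) ∧
    (∀ t, (P t : Measure α) = μ.withDensity (fun a => (p t a : ℝ≥0∞))) ∧
    Tendsto (fun t : ℝ => eLpNorm (fun a =>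
        (Real.sqrt (p t a) - Real.sqrt (p 0 a)) / t - s a / 2 * Real.sqrt (p 0 a)) 2 μ)
      (𝓝[≠] 0) (𝓝 0)

variable {𝒳 ℳ : Type*} [MeasurableSpace 𝒳] [MeasurableSpace ℳ]

/-- The positivity requirements on the probabilities of the groups, with constant `c`. -/
def GroupPositivity (c : ℝ) (Q : ProbabilityMeasure (Obs 𝒳 ℳ)) : Prop :=
  c < probTreated Q ∧
  (∀ᵐ o ∂(Q : Measure (Obs 𝒳 ℳ)), c < probGivenX Q false (oX o)) ∧
  (∀ᵐ o ∂(Q : Measure (Obs 𝒳 ℳ)), c < probGivenMX Q false (oMX o))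

/-- A regular one-dimensional submodel, through `Q` at `t = 0` and with score `s`, of the
nonparametric model of all observed-data laws with positivity and with a square integrable outcome
change; both of these hold locally uniformly along the path. -/
structure IsRegularSubmodel (Q : ProbabilityMeasure (Obs 𝒳 ℳ))
    (P : ℝ → ProbabilityMeasure (Obs 𝒳 ℳ)) (s : Obs 𝒳 ℳ → ℝ) : Prop where
  through : P 0 = Q
  dqm : IsDQM P s
  positivity : ∃ c : ℝ, 0 < c ∧ ∀ᶠ t in 𝓝 (0 : ℝ), GroupPositivity c (P t)
  moment : ∃ C : ℝ≥0, ∀ᶠ t in 𝓝 (0 : ℝ),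
    ∫⁻ o, ENNReal.ofReal (oΔ o ^ 2) ∂(P t : Measure (Obs 𝒳 ℳ)) ≤ C

/-- The tangent space at `Q`: the closed linear span in `L²(Q)` of the scores of all regular
submodels through `Q`. -/
def tangentSpace (Q : ProbabilityMeasure (Obs 𝒳 ℳ)) :
    Submodule ℝ (Lp ℝ 2 (Q : Measure (Obs 𝒳 ℳ))) :=
  (Submodule.span ℝ {S : Lp ℝ 2 (Q : Measure (Obs 𝒳 ℳ)) |
    ∃ P : ℝ → ProbabilityMeasure (Obs 𝒳 ℳ), IsRegularSubmodel Q P S}).topologicalClosure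

/-- `φ` is an influence function (a gradient) at `Q` of the functional `ψ`: a square integrable
mean-zero function that represents the derivative of `ψ` along every regular submodel. -/
structure IsInfluenceFunction (ψ : ProbabilityMeasure (Obs 𝒳 ℳ) → ℝ)
    (Q : ProbabilityMeasure (Obs 𝒳 ℳ)) (φ : Obs 𝒳 ℳ → ℝ) : Prop where
  memLp : MemLp φ 2 (Q : Measure (Obs 𝒳 ℳ))
  mean_zero : ∫ o, φ o ∂(Q : Measure (Obs 𝒳 ℳ)) = 0
  pathwise : ∀ (P : ℝ → ProbabilityMeasure (Obs 𝒳 ℳ)) (s : Obs 𝒳 ℳ → ℝ),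
    IsRegularSubmodel Q P s →
      HasDerivAt (fun t => ψ (P t)) (∫ o, φ o * s o ∂(Q : Measure (Obs 𝒳 ℳ))) 0

/-- `φ` is the efficient influence function of `ψ` at `Q`: the influence function that lies in the
tangent space. -/
def IsEIF (ψ : ProbabilityMeasure (Obs 𝒳 ℳ) → ℝ)
    (Q : ProbabilityMeasure (Obs 𝒳 ℳ)) (φ : Obs 𝒳 ℳ → ℝ) : Prop :=
  IsInfluenceFunction ψ Q φ ∧
    ∃ h : MemLp φ 2 (Q : Measure (Obs 𝒳 ℳ)), h.toLp φ ∈ tangentSpace Q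

end Efficiency

/-! ### Potential outcomes and the causal assumptions -/

/-- The random variables of the mediation difference-in-differences design on a sample space `Ω`:
the observed variables and the potential outcomes. -/
structure Design (Ω 𝒳 ℳ : Type*) [MeasurableSpace Ω] [MeasurableSpace 𝒳]
    [MeasurableSpace ℳ] where
  /-- treatment group -/
  G : Ω → Bool
  /-- baseline covariates -/
  X : Ω → 𝒳
  /-- observed pre-treatment outcome -/
  Y0 : Ω → ℝ
  /-- observed mediator -/
  M : Ω → ℳ
  /-- observed post-treatment outcome -/
  Y1 : Ω → ℝ
  /-- potential pre-treatment outcome `Y₀(g)` -/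
  pY0 : Bool → Ω → ℝ
  /-- potential mediator `M(g)` -/
  pM : Bool → Ω → ℳ
  /-- potential post-treatment outcome `Y₁(g, m)` -/
  pY1 : Bool → ℳ → Ω → ℝ
  measurable_G : Measurable G
  measurable_X : Measurable X
  measurable_Y0 : Measurable Y0
  measurable_M : Measurable M
  measurable_Y1 : Measurable Y1
  measurable_pY0 : ∀ g, Measurable (pY0 g)
  measurable_pM : ∀ g, Measurable (pM g)
  measurable_pY1 : ∀ g, Measurable (Function.uncurry (pY1 g))

namespace Design

variable {Ω 𝒳 ℳ : Type*} [MeasurableSpace Ω] [MeasurableSpace 𝒳] [MeasurableSpace ℳ]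

/-- The observed data `O = (G, X, Y₀, M, Y₁)`. -/
def obs (D : Design Ω 𝒳 ℳ) (ω : Ω) : Obs 𝒳 ℳ := (D.G ω, D.X ω, D.Y0 ω, D.M ω, D.Y1 ω)

theorem measurable_obs (D : Design Ω 𝒳 ℳ) : Measurable D.obs :=
  D.measurable_G.prodMk (D.measurable_X.prodMk (D.measurable_Y0.prodMk
    (D.measurable_M.prodMk D.measurable_Y1)))

/-- The law of the observed data. -/
def law (D : Design Ω 𝒳 ℳ) (Pr : Measure Ω) [IsProbabilityMeasure Pr] :
    ProbabilityMeasure (Obs 𝒳 ℳ) :=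
  ⟨Pr.map D.obs, Measure.isProbabilityMeasure_map D.measurable_obs.aemeasurable⟩

/-- The conditional probability measure given `G = g`. -/
def given (D : Design Ω 𝒳 ℳ) (Pr : Measure Ω) (g : Bool) : Measure Ω := Pr[|D.G ⁻¹' {g}]

instance (D : Design Ω 𝒳 ℳ) (Pr : Measure Ω) [IsProbabilityMeasure Pr] (g : Bool) :
    IsFiniteMeasure (D.given Pr g) := by
  unfold given; infer_instance

/-- The nested potential outcome `Y₁(g, M(g'))`. -/
def nested (D : Design Ω 𝒳 ℳ) (g g' : Bool) (ω : Ω) : ℝ := D.pY1 g (D.pM g' ω) ω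

/-- The function `(m, x) ↦ E{Y₁(0, m) - Y₀(0) | M(a) = m, G = g, X = x}`. On the conditioning event
`Y₁(0, m)` is `Y₁(0, M(a))`, so this is a regression function of `Y₁(0, M(a)) - Y₀(0)` on
`(M(a), X)` within the group `g`. -/
def trend (D : Design Ω 𝒳 ℳ) (Pr : Measure Ω) [IsProbabilityMeasure Pr] (a g : Bool)
    (v : ℳ × 𝒳) : ℝ :=
  ∫ y, y ∂(condDistrib (fun ω => D.nested false a ω - D.pY0 false ω)
    (fun ω => (D.pM a ω, D.X ω)) (D.given Pr g) v)

/-- The conditional independence `G ⊥ M(a) | X`. -/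
def CondIndepMediator (D : Design Ω 𝒳 ℳ) (Pr : Measure Ω) (a : Bool) : Prop :=
  ∀ (A : Set Bool) (B : Set ℳ), MeasurableSet B →
    Pr⟦D.G ⁻¹' A ∩ D.pM a ⁻¹' B | MeasurableSpace.comap D.X inferInstance⟧ =ᵐ[Pr]
      fun ω => (Pr⟦D.G ⁻¹' A | MeasurableSpace.comap D.X inferInstance⟧) ω *
        (Pr⟦D.pM a ⁻¹' B | MeasurableSpace.comap D.X inferInstance⟧) ω

/-- No anticipation: `Y₀(1) = Y₀(0)`. -/
def NoAnticipation (D : Design Ω 𝒳 ℳ) (Pr : Measure Ω) : Prop :=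
  D.pY0 true =ᵐ[Pr] D.pY0 false

/-- Parallel trends:
`E{Y₁(0,m) - Y₀(0) | M(0) = m, G = 1, X} = E{Y₁(0,m) - Y₀(0) | M(0) = m, G = 0, X}`,
for almost all values `(m, x)` of `(M(0), X)` in the treated group. -/
def ParallelTrends (D : Design Ω 𝒳 ℳ) (Pr : Measure Ω) [IsProbabilityMeasure Pr] : Prop :=
  ∀ᵐ ω ∂(D.given Pr true),
    D.trend Pr false true (D.pM false ω, D.X ω) = D.trend Pr false false (D.pM false ω, D.X ω)

/-- Sequential ignorability: `G ⊥ M(g) | X`, and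
`E{Y₁(0,m) - Y₀(0) | M(1), G = 1, X} = E{Y₁(0,m) - Y₀(0) | M(0) = m, G = 1, X}`.
The second part is only required where `M(1) = m`, for almost all values `(m, x)` of `(M(1), X)`
in the treated group; no condition is imposed at values `m ≠ M(1)`. -/
def SequentialIgnorability (D : Design Ω 𝒳 ℳ) (Pr : Measure Ω) [IsProbabilityMeasure Pr] : Prop :=
  (∀ a, D.CondIndepMediator Pr a) ∧
  ∀ᵐ ω ∂(D.given Pr true),
    D.trend Pr true true (D.pM true ω, D.X ω) = D.trend Pr false true (D.pM true ω, D.X ω)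

/-- Positivity, for some constant `c > 0`: `P(G = 1) > c`, `P(G = 0 | X) > c`,
`P(G = 0 | M, X) > c` and `f(M | X) / f(M | G = 0, X) > c`. -/
def Positivity (D : Design Ω 𝒳 ℳ) (Pr : Measure Ω) [IsProbabilityMeasure Pr]
    (f : Bool → 𝒳 → ℳ → ℝ≥0) (fMarg : 𝒳 → ℳ → ℝ≥0) : Prop :=
  ∃ c : ℝ, 0 < c ∧ GroupPositivity c (D.law Pr) ∧
    ∀ᵐ ω ∂Pr, c < (fMarg (D.X ω) (D.M ω) : ℝ) / (f false (D.X ω) (D.M ω) : ℝ)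

/-- Consistency: `M(G) = M`, `Y₀(G) = Y₀` and `Y₁(G, M(G)) = Y₁`. -/
def Consistency (D : Design Ω 𝒳 ℳ) (Pr : Measure Ω) : Prop :=
  ∀ᵐ ω ∂Pr, D.pM (D.G ω) ω = D.M ω ∧ D.pY0 (D.G ω) ω = D.Y0 ω ∧
    D.nested (D.G ω) (D.G ω) ω = D.Y1 ω

/-- The natural indirect effect `E{Y₁(0,M(1)) - Y₁(0,M(0)) | G = 1}`. -/
def tauIE (D : Design Ω 𝒳 ℳ) (Pr : Measure Ω) : ℝ :=
  ∫ ω, (D.nested false true ω - D.nested false false ω) ∂(D.given Pr true)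

/-- The natural direct effect `E{Y₁(1,M(1)) - Y₁(0,M(1)) | G = 1}`. -/
def tauDE (D : Design Ω 𝒳 ℳ) (Pr : Measure Ω) : ℝ :=
  ∫ ω, (D.nested true true ω - D.nested false true ω) ∂(D.given Pr true)

/-- The total effect `E{Y₁(1,M(1)) - Y₁(0,M(0)) | G = 1}`. -/
def tauTotal (D : Design Ω 𝒳 ℳ) (Pr : Measure Ω) : ℝ :=
  ∫ ω, (D.nested true true ω - D.nested false false ω) ∂(D.given Pr true)

end Design

end MedDiD

end

/-! Each of the three functionals has the form N(Q)/Q(G = 1). By the tower property, N is E(1_{G=1}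
ΔY) for τ(1,1), E(1_{G=1} n(X)) for τ(0,0) and E(1_{G=1} n(M,X)) for τ(0,1), where n is the
regression of ΔY on X, respectively on (M,X), within the donor group G = 0. The last two are thus
one functional E(1_{Dᶜ} n), with D the donor group and n measurable for a sigma-algebra m, namely
σ(X) or σ(M,X).

Differentiating E_t(1_{Dᶜ} n_t) is the analytic core (`hasDerivAt_setIntegral_compl_regression`).
Let r be the odds of Dᶜ given m under P_0 and K = 1_{Dᶜ} - r 1_D, so that E_0(K | m) = 0.
Orthogonality of Y - n_t to m on D gives E_t(1_{Dᶜ} n_t) = E_t(K n_t) + E_t(1_D r Y). The second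
term integrates a fixed function. In the first, E_t(K | m) is O(|t|) in L²
(`abs_setIntegral_mul_le`), and n_t tends to n_0 in probability (`eventually_measureReal_le`). Hence
replacing n_t by n_0 costs only o(t), and no differentiability of t ↦ n_t is needed. The resulting
gradient is 1_D r (Y - n_0) + 1_{Dᶜ} n_0. All estimates are expressed through the L² distance of
root densities, localized to sets (`HellingerModulus`).

The quotient rule then gives the influence functions (`isEIF_of_ratio`). For τ(0,1) the weight is
the odds given (M,X), which Bayes' formula writes as the odds given X times the mediator density
ratio (`cutOdds_mul_density_ratio`). Efficiency is automatic: bounded mean-zero scores are realized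
by the paths (1 + t h)Q and are dense among mean-zero L² functions (`toLp_mem_tangentSpace`).

For identification, Y_0(0) is subtracted from every potential outcome. Consistency and no
anticipation give τ(1,1). Parallel trends identify the treated regression on (M(0), X) with
δ(0,·,·), while G ⊥ M(0) | X supplies the law of M(0) among the treated; this gives τ(0,0).
Sequential ignorability passes from M(1) to M(0), with absolute continuity carrying the
almost-everywhere identity over to the values of (M(1), X); this gives τ(0,1). -/

namespace MedDiD

/-! ### Differentiability in quadratic mean and the Hellinger modulus -/

section Hellinger

variable {α : Type*} [mα : MeasurableSpace α]

theorem integrable_mul_of_memLp_two {μ : Measure α} {f g : α → ℝ} (hf : MemLp f 2 μ)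
    (hg : MemLp g 2 μ) : Integrable (fun a => f a * g a) μ :=
  hf.integrable_mul hg

theorem abs_integral_mul_le_sqrt {μ : Measure α} {f g : α → ℝ} (hf : MemLp f 2 μ)
    (hg : MemLp g 2 μ) :
    |∫ a, f a * g a ∂μ| ≤ √(∫ a, f a ^ 2 ∂μ) * √(∫ a, g a ^ 2 ∂μ) := by
  have h := integral_mul_norm_le_Lp_mul_Lq (μ := μ) (f := f) (g := g) Real.HolderConjugate.two_two
    (by simpa using hf) (by simpa using hg)
  refine (abs_integral_le_integral_abs).trans ?_
  simp only [abs_mul]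
  simpa [Real.sqrt_eq_rpow] using h

theorem sqrt_integral_add_sq_le {μ : Measure α} {f g : α → ℝ} (hf : MemLp f 2 μ)
    (hg : MemLp g 2 μ) :
    √(∫ a, (f a + g a) ^ 2 ∂μ) ≤ √(∫ a, f a ^ 2 ∂μ) + √(∫ a, g a ^ 2 ∂μ) := by
  have h1 : ∫ a, (f a + g a) ^ 2 ∂μ
      = ∫ a, f a ^ 2 ∂μ + 2 * ∫ a, f a * g a ∂μ + ∫ a, g a ^ 2 ∂μ := by
    have hfg : Integrable (fun a => 2 * (f a * g a)) μ := (integrable_mul_of_memLp_two hf hg).const_mul 2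
    have h0 : Integrable (fun a => f a ^ 2 + 2 * (f a * g a)) μ := hf.integrable_sq.add hfg
    rw [← integral_const_mul, ← integral_add hf.integrable_sq hfg,
      ← integral_add h0 hg.integrable_sq]
    congr 1 with a
    ring
  have h2 := (le_abs_self _).trans (abs_integral_mul_le_sqrt hf hg)
  have h3 : 0 ≤ ∫ a, f a ^ 2 ∂μ := integral_nonneg fun a => sq_nonneg _
  have h4 : 0 ≤ ∫ a, g a ^ 2 ∂μ := integral_nonneg fun a => sq_nonneg _
  refine Real.sqrt_le_iff.2 ⟨by positivity, ?_⟩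
  rw [h1]
  nlinarith [Real.sq_sqrt h3, Real.sq_sqrt h4]

theorem sqrt_integral_sq_eq_toReal_eLpNorm {μ : Measure α} {f : α → ℝ} (hf : MemLp f 2 μ) :
    √(∫ a, f a ^ 2 ∂μ) = (eLpNorm f 2 μ).toReal := by
  rw [hf.eLpNorm_eq_integral_rpow_norm two_ne_zero ENNReal.ofNat_ne_top,
    ENNReal.toReal_ofReal (by positivity), Real.sqrt_eq_rpow]
  simp

/-- A modulus `R t S` of the Hellinger type for the path `P` at `t = 0`: it behaves like the
`L²`-distance on `S` of the square roots of the densities of `P t` and of `P 0`. -/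
structure HellingerModulus (P : ℝ → ProbabilityMeasure α) (s : α → ℝ) (R : ℝ → Set α → ℝ) :
    Prop where
  nonneg : ∀ t S, 0 ≤ R t S
  mono : ∀ t (S T : Set α), MeasurableSet S → MeasurableSet T → S ⊆ T → R t S ≤ R t T
  abs_sub_le : ∀ t (S : Set α) (T : α → ℝ), MeasurableSet S → Measurable T →
    MemLp T 2 ((P t : Measure α).restrict S) → MemLp T 2 ((P 0 : Measure α).restrict S) →
    |∫ a in S, T a ∂(P t : Measure α) - ∫ a in S, T a ∂(P 0 : Measure α)| ≤
      R t S * (√(∫ a in S, T a ^ 2 ∂(P t : Measure α)) + √(∫ a in S, T a ^ 2 ∂(P 0 : Measure α)))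
  integral_sq_le : ∀ t (S : Set α) (k : α → ℝ) (κ : ℝ), MeasurableSet S → Measurable k →
    (∀ a, |k a| ≤ κ) → ∫ a in S, k a ^ 2 ∂(P 0 : Measure α) ≤
      2 * ∫ a in S, k a ^ 2 ∂(P t : Measure α) + 2 * κ ^ 2 * R t S ^ 2
  linear_bound : ∃ L : ℝ, 0 ≤ L ∧ ∀ᶠ t in 𝓝[≠] (0 : ℝ), R t Set.univ ≤ L * |t|
  small : ∀ ε : ℝ, 0 < ε → ∃ δ : ℝ, 0 < δ ∧ ∀ᶠ t in 𝓝[≠] (0 : ℝ), ∀ S : Set α,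
    MeasurableSet S → (P 0 : Measure α).real S ≤ δ → R t S ≤ ε * |t|
  hasDerivAt_bounded : ∀ (T : α → ℝ) (κ : ℝ), Measurable T → (∀ a, |T a| ≤ κ) →
    HasDerivAt (fun t => ∫ a, T a ∂(P t : Measure α)) (∫ a, T a * s a ∂(P 0 : Measure α)) 0

theorem exists_pos_setIntegral_sq_le {μ : Measure α} [IsFiniteMeasure μ] {s : α → ℝ}
    (hs : MemLp s 2 μ) {ε : ℝ} (hε : 0 < ε) :
    ∃ δ : ℝ, 0 < δ ∧ ∀ S : Set α, μ.real S ≤ δ → ∫ a in S, s a ^ 2 ∂μ ≤ ε := by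
  have hint := hs.integrable_sq
  have hfin : ∫⁻ a, ENNReal.ofReal (s a ^ 2) ∂μ ≠ ∞ := by
    have := hint.2
    rw [hasFiniteIntegral_iff_ofReal (Eventually.of_forall fun a => sq_nonneg _)] at this
    exact this.ne
  obtain ⟨δ, δpos, hδ⟩ := exists_pos_setLIntegral_lt_of_measure_lt hfin
    (ε := ENNReal.ofReal ε) (by simpa using hε)
  obtain ⟨d, hd0, hdδ⟩ : ∃ d : ℝ≥0, 0 < d ∧ (d : ℝ≥0∞) < δ := by
    obtain ⟨d, hd0, hdδ⟩ := ENNReal.lt_iff_exists_nnreal_btwn.1 δpos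
    exact ⟨d, by exact_mod_cast hd0, hdδ⟩
  refine ⟨d, by exact_mod_cast hd0, fun S hS => ?_⟩
  have h1 : μ S < δ := by
    refine lt_of_le_of_lt ?_ hdδ
    rw [← ENNReal.ofReal_coe_nnreal, ← ofReal_measureReal]
    exact ENNReal.ofReal_le_ofReal hS
  rw [integral_eq_lintegral_of_nonneg_ae (Eventually.of_forall fun a => sq_nonneg _)
    hint.1.restrict]
  exact ENNReal.toReal_le_of_le_ofReal hε.le (hδ S h1).le

section Density

variable {μ : Measure α} {p : α → ℝ≥0}

/-- Multiplication by √p embeds L²(p μ) isometrically in L²(μ), so that functions under different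
laws of the path can be compared in one space. -/
theorem memLp_mul_sqrt_density_iff (hp : Measurable p) {T : α → ℝ} (hT : Measurable T) :
    MemLp (fun a => T a * √(p a)) 2 μ ↔
      MemLp T 2 (μ.withDensity fun a => (p a : ℝ≥0∞)) := by
  have hm : Measurable fun a => T a * √(p a) := by fun_prop
  rw [memLp_two_iff_integrable_sq hm.aestronglyMeasurable,
    memLp_two_iff_integrable_sq hT.aestronglyMeasurable,
    integrable_withDensity_iff_integrable_smul hp]
  refine integrable_congr (Eventually.of_forall fun a => ?_)
  simp only [mul_pow, Real.sq_sqrt (NNReal.coe_nonneg _), NNReal.smul_def, smul_eq_mul]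
  ring

theorem integral_sq_mul_sqrt_density (hp : Measurable p) (T : α → ℝ) :
    ∫ a, (T a * √(p a)) ^ 2 ∂μ = ∫ a, T a ^ 2 ∂(μ.withDensity fun a => (p a : ℝ≥0∞)) := by
  rw [integral_withDensity_eq_integral_smul hp]
  refine integral_congr_ae (Eventually.of_forall fun a => ?_)
  simp only [mul_pow, Real.sq_sqrt (NNReal.coe_nonneg _), NNReal.smul_def, smul_eq_mul]
  ring

theorem memLp_sqrt_density (hp : Measurable p)
    [IsFiniteMeasure (μ.withDensity fun a => (p a : ℝ≥0∞))] :
    MemLp (fun a => √(p a)) 2 μ := by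
  have := (memLp_mul_sqrt_density_iff (μ := μ) hp (T := fun _ => 1) measurable_const).2
    (memLp_const 1)
  simpa using this

/-- Cauchy-Schwarz for the difference of two integrals with respect to measures with densities. -/
theorem abs_integral_withDensity_sub_le {q : α → ℝ≥0} (hp : Measurable p) (hq : Measurable q)
    [IsFiniteMeasure (μ.withDensity fun a => (p a : ℝ≥0∞))]
    [IsFiniteMeasure (μ.withDensity fun a => (q a : ℝ≥0∞))]
    {T : α → ℝ} (hT : Measurable T)
    (hTp : MemLp T 2 (μ.withDensity fun a => (p a : ℝ≥0∞)))
    (hTq : MemLp T 2 (μ.withDensity fun a => (q a : ℝ≥0∞))) :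
    |∫ a, T a ∂(μ.withDensity fun a => (p a : ℝ≥0∞))
        - ∫ a, T a ∂(μ.withDensity fun a => (q a : ℝ≥0∞))| ≤
      √(∫ a, (√(p a) - √(q a)) ^ 2 ∂μ) *
        (√(∫ a, T a ^ 2 ∂(μ.withDensity fun a => (p a : ℝ≥0∞)))
          + √(∫ a, T a ^ 2 ∂(μ.withDensity fun a => (q a : ℝ≥0∞)))) := by
  have hd : MemLp (fun a => √(p a) - √(q a)) 2 μ :=
    (memLp_sqrt_density hp).sub (memLp_sqrt_density hq)
  have h1 := (memLp_mul_sqrt_density_iff (μ := μ) hp hT).2 hTp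
  have h2 := (memLp_mul_sqrt_density_iff (μ := μ) hq hT).2 hTq
  -- This is p - q = (√p - √q)(√p + √q); Cauchy-Schwarz then applies to each summand.
  have key : ∫ a, T a ∂(μ.withDensity fun a => (p a : ℝ≥0∞))
        - ∫ a, T a ∂(μ.withDensity fun a => (q a : ℝ≥0∞))
      = ∫ a, (√(p a) - √(q a)) * (T a * √(p a)) ∂μ
        + ∫ a, (√(p a) - √(q a)) * (T a * √(q a)) ∂μ := by
    rw [← integral_add (integrable_mul_of_memLp_two hd h1) (integrable_mul_of_memLp_two hd h2),
      integral_withDensity_eq_integral_smul hp, integral_withDensity_eq_integral_smul hq,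
      ← integral_sub
        ((integrable_withDensity_iff_integrable_smul hp).1 (hTp.integrable one_le_two))
        ((integrable_withDensity_iff_integrable_smul hq).1 (hTq.integrable one_le_two))]
    refine integral_congr_ae (Eventually.of_forall fun a => ?_)
    have e1 := Real.mul_self_sqrt (NNReal.coe_nonneg (p a))
    have e2 := Real.mul_self_sqrt (NNReal.coe_nonneg (q a))
    simp only [NNReal.smul_def, smul_eq_mul]
    calc (p a : ℝ) * T a - q a * T a = (√(p a) * √(p a)) * T a - (√(q a) * √(q a)) * T a := by
          rw [e1, e2]
      _ = _ := by ring
  rw [key, mul_add, ← integral_sq_mul_sqrt_density hp, ← integral_sq_mul_sqrt_density hq]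
  exact (abs_add_le _ _).trans (add_le_add (abs_integral_mul_le_sqrt hd h1)
    (abs_integral_mul_le_sqrt hd h2))

end Density

/-- The modulus is the L²(μ) norm over S of √p_t - √p_0. Its properties no longer mention the
dominating measure μ. -/
theorem IsDQM.exists_hellingerModulus {P : ℝ → ProbabilityMeasure α} {s : α → ℝ}
    (h : IsDQM P s) : ∃ R : ℝ → Set α → ℝ, HellingerModulus P s R := by
  obtain ⟨hs, μ, p, -, hp, hP, hlim⟩ := h
  have hfin : ∀ t, IsFiniteMeasure (μ.withDensity fun a => (p t a : ℝ≥0∞)) := fun t => by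
    rw [← hP t]; infer_instance
  obtain ⟨s', hs'm, hss'⟩ := hs.1
  have hs'm : Measurable s' := hs'm.measurable
  have hs' : MemLp s' 2 (P 0 : Measure α) := hs.ae_eq hss'
  have hρ : ∀ t, MemLp (fun a => √(p t a)) 2 μ := fun t => memLp_sqrt_density (hp t)
  have hsρ : MemLp (fun a => s' a / 2 * √(p 0 a)) 2 μ := by
    rw [memLp_mul_sqrt_density_iff (hp 0) (by fun_prop : Measurable fun a => s' a / 2), ← hP 0]
    simpa [div_eq_inv_mul] using hs'.const_mul (2⁻¹ : ℝ)
  -- E t is the quadratic-mean remainder, formed with a measurable version s' of the score; N t is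
  -- its norm, which tends to 0.
  set E : ℝ → α → ℝ := fun t a => (√(p t a) - √(p 0 a)) / t - s' a / 2 * √(p 0 a) with hE
  have hEm : ∀ t, MemLp (E t) 2 μ := fun t => by
    refine MemLp.sub ?_ hsρ
    simpa [div_eq_inv_mul] using ((hρ t).sub (hρ 0)).const_mul (t⁻¹ : ℝ)
  set N : ℝ → ℝ := fun t => √(∫ a, E t a ^ 2 ∂μ) with hN
  have hNlim : Tendsto N (𝓝[≠] 0) (𝓝 0) := by
    have h1 := (ENNReal.tendsto_toReal ENNReal.zero_ne_top).comp hlim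
    refine h1.congr fun t => ?_
    rw [hN]
    simp only [Function.comp_apply]
    rw [sqrt_integral_sq_eq_toReal_eLpNorm (hEm t)]
    congr 1
    refine eLpNorm_congr_ae ?_
    -- The two versions of the score agree only P_0-a.e.; where p_0 = 0 the score term vanishes, so
    -- the remainders agree μ-a.e.
    have h2 : ∀ᵐ a ∂(μ.withDensity fun a => (p 0 a : ℝ≥0∞)), s a = s' a := by
      rw [← hP 0]; exact hss'
    rw [ae_withDensity_iff (hp 0).coe_nnreal_ennreal] at h2
    filter_upwards [h2] with a ha
    by_cases h0 : p 0 a = 0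
    · simp [hE, h0]
    · rw [hE]
      simp only
      rw [ha (by simpa using h0)]
  set R : ℝ → Set α → ℝ := fun t S => √(∫ a in S, (√(p t a) - √(p 0 a)) ^ 2 ∂μ) with hR
  have hPS : ∀ t (S : Set α), MeasurableSet S → (P t : Measure α).restrict S =
      (μ.restrict S).withDensity fun a => (p t a : ℝ≥0∞) := fun t S hS => by
    rw [hP t, restrict_withDensity hS]
  have hρd : ∀ t, MemLp (fun a => √(p t a) - √(p 0 a)) 2 μ := fun t => (hρ t).sub (hρ 0)
  -- Since √p_t - √p_0 = t (E t + s' √p_0 / 2), the score contributes only its P_0-norm over S. Both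
  -- the linear bound and the smallness on P_0-small sets follow from this.
  have hR_le : ∀ t : ℝ, t ≠ 0 → ∀ S, MeasurableSet S →
      R t S ≤ |t| * (N t + √(∫ a in S, s' a ^ 2 ∂(P 0 : Measure α)) / 2) := by
    intro t ht S hS
    have e1 : ∫ a in S, (√(p t a) - √(p 0 a)) ^ 2 ∂μ
        = t ^ 2 * ∫ a in S, (E t a + s' a / 2 * √(p 0 a)) ^ 2 ∂μ := by
      rw [← integral_const_mul]
      congr 1 with a
      rw [hE]
      field_simp
      ring
    have e2 : √(∫ a in S, (s' a / 2 * √(p 0 a)) ^ 2 ∂μ)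
        = √(∫ a in S, s' a ^ 2 ∂(P 0 : Measure α)) / 2 := by
      rw [integral_sq_mul_sqrt_density (hp 0) fun a => s' a / 2, ← hPS 0 S hS]
      simp only [div_pow]
      rw [integral_div, Real.sqrt_div' _ (by norm_num)]
      congr 1
      rw [show (2 : ℝ) ^ 2 = 2 * 2 by norm_num, Real.sqrt_mul_self (by norm_num)]
    have e3 : √(∫ a in S, E t a ^ 2 ∂μ) ≤ N t :=
      Real.sqrt_le_sqrt (setIntegral_le_integral (hEm t).integrable_sq
        (Eventually.of_forall fun a => sq_nonneg _))
    rw [hR]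
    simp only
    rw [e1, Real.sqrt_mul (sq_nonneg t), Real.sqrt_sq_eq_abs]
    refine mul_le_mul_of_nonneg_left ?_ (abs_nonneg t)
    refine (sqrt_integral_add_sq_le ((hEm t).restrict S) (hsρ.restrict S)).trans ?_
    rw [e2]
    gcongr
  have hlin : ∃ L : ℝ, 0 ≤ L ∧ ∀ᶠ t in 𝓝[≠] (0 : ℝ), R t Set.univ ≤ L * |t| := by
    refine ⟨1 + √(∫ a in Set.univ, s' a ^ 2 ∂(P 0 : Measure α)) / 2, by positivity, ?_⟩
    filter_upwards [hNlim.eventually (gt_mem_nhds zero_lt_one), self_mem_nhdsWithin] with t h1 ht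
    rw [mul_comm]
    refine (hR_le t ht Set.univ MeasurableSet.univ).trans ?_
    gcongr
  refine ⟨R, fun t S => Real.sqrt_nonneg _, ?_, ?_, ?_, hlin, ?_, ?_⟩
  · intro t S T hS hT hST
    exact Real.sqrt_le_sqrt (setIntegral_mono_set (hρd t).integrable_sq.integrableOn
      (Eventually.of_forall fun a => sq_nonneg _) hST.eventuallyLE)
  · intro t S T hS hT h1 h2
    rw [hPS _ S hS] at h1 h2
    have i1 : IsFiniteMeasure ((μ.restrict S).withDensity fun a => (p t a : ℝ≥0∞)) := by
      rw [← hPS t S hS]; infer_instance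
    have i2 : IsFiniteMeasure ((μ.restrict S).withDensity fun a => (p 0 a : ℝ≥0∞)) := by
      rw [← hPS 0 S hS]; infer_instance
    rw [hPS t S hS, hPS 0 S hS]
    exact abs_integral_withDensity_sub_le (hp t) (hp 0) hT h1 h2
  · intro t S k κ hS hk hκ
    have hkt : ∀ t, MemLp k 2 ((P t : Measure α).restrict S) := fun t =>
      MemLp.of_bound hk.aestronglyMeasurable κ (Eventually.of_forall hκ)
    have h1 : ∀ t, Integrable (fun a => (k a * √(p t a)) ^ 2) (μ.restrict S) := fun t => by
      refine MemLp.integrable_sq ?_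
      rw [memLp_mul_sqrt_density_iff (hp t) hk, ← hPS t S hS]
      exact hkt t
    have h2 : Integrable (fun a => (√(p t a) - √(p 0 a)) ^ 2) (μ.restrict S) :=
      (hρd t).integrable_sq.integrableOn
    have hR2 : R t S ^ 2 = ∫ a in S, (√(p t a) - √(p 0 a)) ^ 2 ∂μ :=
      Real.sq_sqrt (integral_nonneg fun a => sq_nonneg _)
    rw [hR2, hPS t S hS, hPS 0 S hS, ← integral_sq_mul_sqrt_density (hp t),
      ← integral_sq_mul_sqrt_density (hp 0), ← integral_const_mul, ← integral_const_mul,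
      ← integral_add ((h1 t).const_mul _) (h2.const_mul _)]
    refine integral_mono (h1 0) (((h1 t).const_mul _).add (h2.const_mul _)) fun a => ?_
    have hk2 : k a ^ 2 ≤ κ ^ 2 := sq_le_sq' (abs_le.1 (hκ a)).1 (abs_le.1 (hκ a)).2
    have := mul_le_mul_of_nonneg_right hk2 (sq_nonneg (√(p t a : ℝ) - √(p 0 a : ℝ)))
    simp only
    -- This is (b + d)² ≤ 2 b² + 2 d² with b = k √p_t and d = k (√p_0 - √p_t).
    nlinarith [sq_nonneg (k a * √(p t a) - k a * (√(p 0 a) - √(p t a)))]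
  · intro ε hε
    obtain ⟨δ, hδ, hδ'⟩ := exists_pos_setIntegral_sq_le hs' (sq_pos_of_pos hε)
    refine ⟨δ, hδ, ?_⟩
    filter_upwards [hNlim.eventually (gt_mem_nhds (half_pos hε)), self_mem_nhdsWithin]
      with t h1 ht S hS hSδ
    refine (hR_le t ht S hS).trans ?_
    rw [mul_comm]
    refine mul_le_mul_of_nonneg_right ?_ (abs_nonneg t)
    have := Real.sqrt_le_sqrt (hδ' S hSδ)
    rw [Real.sqrt_sq hε.le] at this
    linarith
  · intro T κ hT hκ
    have hκ0 : ∀ a, T a ^ 2 ≤ κ ^ 2 := fun a => sq_le_sq' (abs_le.1 (hκ a)).1 (abs_le.1 (hκ a)).2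
    have hTt : ∀ t, MemLp T 2 (P t : Measure α) := fun t =>
      MemLp.of_bound hT.aestronglyMeasurable κ (Eventually.of_forall hκ)
    have hTρ : ∀ t, MemLp (fun a => T a * √(p t a)) 2 μ := fun t => by
      rw [memLp_mul_sqrt_density_iff (hp t) hT, ← hP t]
      exact hTt t
    have hTs : MemLp (fun a => (T a * (s' a / 2)) * √(p 0 a)) 2 μ := by
      rw [memLp_mul_sqrt_density_iff (hp 0) (by fun_prop), ← hP 0]
      refine MemLp.of_le_mul (c := κ) hs' (by fun_prop) (Eventually.of_forall fun a => ?_)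
      simp only [Real.norm_eq_abs, abs_mul, abs_div]
      have := mul_le_mul_of_nonneg_right (hκ a) (abs_nonneg (s' a))
      rw [abs_of_nonneg (by norm_num : (0 : ℝ) ≤ 2)]
      nlinarith [mul_nonneg (abs_nonneg (T a)) (abs_nonneg (s' a))]
    set c0 := √(∫ a, ((T a * (s' a / 2)) * √(p 0 a)) ^ 2 ∂μ) with hc0
    have hTn : ∀ t, √(∫ a, (T a * √(p t a)) ^ 2 ∂μ) ≤ |κ| := fun t => by
      rw [integral_sq_mul_sqrt_density (hp t), ← hP t, ← Real.sqrt_sq_eq_abs]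
      refine Real.sqrt_le_sqrt ((integral_mono (hTt t).integrable_sq (integrable_const (κ ^ 2))
        hκ0).trans ?_)
      simp
    have hsT : ∫ a, T a * s a ∂(P 0 : Measure α) = ∫ a, T a * s' a ∂(P 0 : Measure α) := by
      refine integral_congr_ae ?_
      filter_upwards [hss'] with a ha
      rw [ha]
    rw [hsT, hasDerivAt_iff_tendsto_slope, ← tendsto_sub_nhds_zero_iff]
    obtain ⟨L, hL0, hL⟩ := hlin
    have hbd : ∀ᶠ t in 𝓝[≠] (0 : ℝ),
        ‖slope (fun t => ∫ a, T a ∂(P t : Measure α)) 0 t - ∫ a, T a * s' a ∂(P 0 : Measure α)‖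
          ≤ 2 * |κ| * N t + c0 * (L * |t|) := by
      filter_upwards [hL, self_mem_nhdsWithin] with t hLt ht
      have ht : t ≠ 0 := ht
      -- With ρ_t = √p_t, the integrand is T (ρ_t² - ρ_0²)/t - T s' ρ_0² = E T (ρ_t + ρ_0) + (T
      -- s'/2) ρ_0 (ρ_t - ρ_0): two remainders of order N t and one term of order R t.
      have key : slope (fun t => ∫ a, T a ∂(P t : Measure α)) 0 t
            - ∫ a, T a * s' a ∂(P 0 : Measure α)
          = ∫ a, E t a * (T a * √(p t a)) ∂μ + ∫ a, E t a * (T a * √(p 0 a)) ∂μ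
            + ∫ a, ((T a * (s' a / 2)) * √(p 0 a)) * (√(p t a) - √(p 0 a)) ∂μ := by
        have i1 := integrable_mul_of_memLp_two (hEm t) (hTρ t)
        have i2 := integrable_mul_of_memLp_two (hEm t) (hTρ 0)
        have i3 := integrable_mul_of_memLp_two hTs (hρd t)
        have i12 : Integrable (fun a => E t a * (T a * √(p t a)) + E t a * (T a * √(p 0 a))) μ :=
          i1.add i2
        have j1 := fun t => (integrable_withDensity_iff_integrable_smul (hp t)).1
          (by rw [← hP t]; exact (hTt t).integrable one_le_two)
        have j2 : Integrable (fun a => p 0 a • (T a * s' a)) μ := by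
          rw [← integrable_withDensity_iff_integrable_smul (hp 0), ← hP 0]
          exact integrable_mul_of_memLp_two (hTt 0) hs'
        have j3 : Integrable (fun a => t⁻¹ * (p t a • T a - p 0 a • T a)) μ :=
          ((j1 t).sub (j1 0)).const_mul _
        rw [slope_def_field, sub_zero, div_eq_inv_mul, hP t, hP 0,
          integral_withDensity_eq_integral_smul (hp t),
          integral_withDensity_eq_integral_smul (hp 0),
          integral_withDensity_eq_integral_smul (hp 0), ← integral_sub (j1 t) (j1 0),
          ← integral_const_mul, ← integral_sub j3 j2,
          ← integral_add i1 i2, ← integral_add i12 i3]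
        refine integral_congr_ae (Eventually.of_forall fun a => ?_)
        have e1 := Real.mul_self_sqrt (NNReal.coe_nonneg (p t a))
        have e2 := Real.mul_self_sqrt (NNReal.coe_nonneg (p 0 a))
        simp only [NNReal.smul_def, smul_eq_mul, hE]
        calc _ = t⁻¹ * ((√(p t a) * √(p t a)) * T a - (√(p 0 a) * √(p 0 a)) * T a)
              - (√(p 0 a) * √(p 0 a)) * (T a * s' a) := by rw [e1, e2]
          _ = _ := by field_simp; ring
      rw [key]
      have b1 := abs_integral_mul_le_sqrt (hEm t) (hTρ t)
      have b2 := abs_integral_mul_le_sqrt (hEm t) (hTρ 0)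
      have b3 := abs_integral_mul_le_sqrt hTs (hρd t)
      have hN0 : 0 ≤ N t := Real.sqrt_nonneg _
      have hc00 : 0 ≤ c0 := Real.sqrt_nonneg _
      have b1' := mul_le_mul_of_nonneg_left (hTn t) hN0
      have b2' := mul_le_mul_of_nonneg_left (hTn 0) hN0
      have hRt : √(∫ a, (√(p t a) - √(p 0 a)) ^ 2 ∂μ) ≤ L * |t| := by
        simpa [hR] using hLt
      have b3' := mul_le_mul_of_nonneg_left hRt hc00
      refine (norm_add_le _ _).trans ?_
      have := norm_add_le (∫ a, E t a * (T a * √(p t a)) ∂μ) (∫ a, E t a * (T a * √(p 0 a)) ∂μ)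
      simp only [Real.norm_eq_abs] at *
      linarith
    refine squeeze_zero_norm' hbd ?_
    have ht0 : Tendsto (fun t : ℝ => |t|) (𝓝[≠] 0) (𝓝 0) := by
      have := (continuous_abs (G := ℝ)).tendsto 0
      rw [abs_zero] at this
      exact this.mono_left nhdsWithin_le_nhds
    simpa using (hNlim.const_mul (2 * |κ|)).add ((ht0.const_mul L).const_mul c0)

end Hellinger

end MedDiD

namespace MedDiD

/-! ### Derivatives of integrals along a path, and drift of conditional means -/

section Regression

theorem hasDerivAt_zero_of_forall_le {f : ℝ → ℝ} {f' : ℝ}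
    (h : ∀ ε : ℝ, 0 < ε → ∀ᶠ t in 𝓝[≠] (0 : ℝ), |f t - f 0 - t * f'| ≤ ε * |t|) :
    HasDerivAt f f' 0 := by
  rw [hasDerivAt_iff_isLittleO, Asymptotics.isLittleO_iff]
  intro ε hε
  have h1 := eventually_nhdsWithin_iff.1 (h ε hε)
  filter_upwards [h1] with t ht
  by_cases h0 : t = 0
  · simp [h0]
  · simpa using ht h0

theorem HasDerivAt.eventually_abs_sub_le {f : ℝ → ℝ} {f' : ℝ} (h : HasDerivAt f f' 0) {ε : ℝ}
    (hε : 0 < ε) : ∀ᶠ t in 𝓝[≠] (0 : ℝ), |f t - f 0 - t * f'| ≤ ε * |t| := by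
  rw [hasDerivAt_iff_isLittleO, Asymptotics.isLittleO_iff] at h
  filter_upwards [(h hε).filter_mono nhdsWithin_le_nhds] with t ht
  simpa using ht

variable {α : Type*} {m mα : MeasurableSpace α}

theorem exists_measureReal_lt_abs_le {μ : Measure α} [IsFiniteMeasure μ] {f : α → ℝ}
    (hf : Measurable f) {δ : ℝ} (hδ : 0 < δ) :
    ∃ A : ℝ, 0 ≤ A ∧ μ.real {a | A < |f a|} ≤ δ := by
  have h1 : Tendsto (fun n : ℕ => μ {a | (n : ℝ) < |f a|}) atTop
      (𝓝 (μ (⋂ n : ℕ, {a | (n : ℝ) < |f a|}))) := by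
    refine tendsto_measure_iInter_atTop
      (fun n => (measurableSet_lt measurable_const hf.abs).nullMeasurableSet) ?_
      ⟨0, measure_ne_top _ _⟩
    intro i j hij a ha
    have : (i : ℝ) ≤ j := by exact_mod_cast hij
    exact lt_of_le_of_lt this ha
  have h2 : (⋂ n : ℕ, {a | (n : ℝ) < |f a|}) = ∅ := by
    ext a
    simp only [Set.mem_iInter, Set.mem_ofPred_eq, Set.mem_empty_iff_false, iff_false, not_forall,
      not_lt]
    exact exists_nat_ge _
  rw [h2, measure_empty] at h1
  obtain ⟨n, hn⟩ := (h1.eventually (gt_mem_nhds (ENNReal.ofReal_pos.2 hδ))).exists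
  exact ⟨n, Nat.cast_nonneg n, ENNReal.toReal_le_of_le_ofReal hδ.le hn.le⟩

/-- The hypothesis says E(f | m) = 0, and h pulls out of the conditional expectation. Only
integrability of the product is required, so h may be an unbounded regression. -/
theorem integral_mul_eq_zero_of_forall_setIntegral_eq_zero (hm : m ≤ mα) {μ : Measure α}
    [IsFiniteMeasure μ] {f h : α → ℝ} (hf : Integrable f μ)
    (hf0 : ∀ B, MeasurableSet[m] B → ∫ a in B, f a ∂μ = 0) (hh : Measurable[m] h)
    (hhf : Integrable (fun a => h a * f a) μ) : ∫ a, h a * f a ∂μ = 0 := by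
  have h1 : (fun _ => (0 : ℝ)) =ᵐ[μ] μ[f|m] := by
    refine ae_eq_condExp_of_forall_setIntegral_eq hm hf (fun _ _ _ => integrableOn_zero) ?_
      aestronglyMeasurable_const
    intro B hB _
    rw [hf0 B hB, integral_zero]
  have h2 := condExp_mul_of_stronglyMeasurable_left (μ := μ) hh.stronglyMeasurable hhf hf
  rw [← integral_condExp hm]
  refine (integral_congr_ae (h2.trans (h1.mono fun a ha => ?_))).trans (integral_zero α ℝ)
  simp [← ha]

theorem abs_setIntegral_mul_le_sqrt {μ : Measure α} {f g : α → ℝ} {S : Set α}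
    (hf : MemLp f 2 (μ.restrict S)) (hg : MemLp g 2 (μ.restrict S)) :
    |∫ a in S, f a * g a ∂μ| ≤ √(∫ a in S, f a ^ 2 ∂μ) * √(∫ a in S, g a ^ 2 ∂μ) :=
  abs_integral_mul_le_sqrt hf hg

theorem sqrt_setIntegral_mul_sq_le {μ : Measure α} {f g : α → ℝ} {S : Set α} {κ : ℝ}
    (hκ0 : 0 ≤ κ) (hκ : ∀ a, |f a| ≤ κ) (hg : MemLp g 2 (μ.restrict S)) :
    √(∫ a in S, (f a * g a) ^ 2 ∂μ) ≤ κ * √(∫ a in S, g a ^ 2 ∂μ) := by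
  rw [← Real.sqrt_sq hκ0, ← Real.sqrt_mul (sq_nonneg κ), ← integral_const_mul]
  refine Real.sqrt_le_sqrt (integral_mono_of_nonneg (Eventually.of_forall fun a => sq_nonneg _)
    (hg.integrable_sq.const_mul _) (Eventually.of_forall fun a => ?_))
  have := sq_le_sq' (abs_le.1 (hκ a)).1 (abs_le.1 (hκ a)).2
  simp only [mul_pow]
  exact mul_le_mul_of_nonneg_right this (sq_nonneg _)

namespace HellingerModulus

variable {P : ℝ → ProbabilityMeasure α} {s : α → ℝ} {R : ℝ → Set α → ℝ}

/-- Integrals of a function with locally bounded second moment are differentiable. -/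
theorem hasDerivAt_integral (hR : HellingerModulus P s R) (hs : MemLp s 2 (P 0 : Measure α))
    {Y : α → ℝ} (hY : Measurable Y) {C : ℝ}
    (hC : ∀ᶠ t in 𝓝 (0 : ℝ), MemLp Y 2 (P t : Measure α) ∧ ∫ a, Y a ^ 2 ∂(P t : Measure α) ≤ C) :
    HasDerivAt (fun t => ∫ a, Y a ∂(P t : Measure α)) (∫ a, Y a * s a ∂(P 0 : Measure α)) 0 := by
  refine hasDerivAt_zero_of_forall_le fun ε hε => ?_
  obtain ⟨hY0, hC0⟩ := hC.self_of_nhds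
  have hCnn : 0 ≤ C := (integral_nonneg fun a => sq_nonneg _).trans hC0
  -- The added 1 makes M positive, so that it can be divided by even when C = 0.
  set M := √C + 1 with hM
  have hMpos : 0 < M := by positivity
  have hCM : √C ≤ M := by simp [hM]
  obtain ⟨δ, hδ, hsmall⟩ := hR.small (ε / (4 * M)) (by positivity)
  obtain ⟨δ', hδ', hs'⟩ := exists_pos_setIntegral_sq_le hs
    (sq_pos_of_pos (show 0 < ε / (4 * M) by positivity))
  obtain ⟨A, hA0, hA⟩ := exists_measureReal_lt_abs_le (μ := (P 0 : Measure α)) hY (lt_min hδ hδ')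
  set S : Set α := {a | A < |Y a|} with hS
  have hSm : MeasurableSet S := measurableSet_lt measurable_const hY.abs
  -- The bounded part T is differentiated directly, with error ε/4. The tail over the P_0-small set
  -- S adds at most ε/2 |t| to the increment, by the smallness of R t S, and ε/4 to the derivative.
  set T : α → ℝ := Sᶜ.indicator Y with hT
  have hTm : Measurable T := hY.indicator hSm.compl
  have hTA : ∀ a, |T a| ≤ A := fun a => by
    by_cases ha : a ∈ S
    · simpa [hT, ha] using hA0
    · rw [hT, Set.indicator_of_mem (by exact ha)]
      simpa [hS] using ha
  have hder := hR.hasDerivAt_bounded T A hTm hTA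
  have hsqle : ∀ t, MemLp Y 2 (P t : Measure α) → ∫ a, Y a ^ 2 ∂(P t : Measure α) ≤ C →
      √(∫ a in S, Y a ^ 2 ∂(P t : Measure α)) ≤ M := fun t h1 h2 =>
    (Real.sqrt_le_sqrt ((setIntegral_le_integral h1.integrable_sq
      (Eventually.of_forall fun a => sq_nonneg _)).trans h2)).trans hCM
  have hsplit : ∀ t, MemLp Y 2 (P t : Measure α) → ∫ a, Y a ∂(P t : Measure α)
      = ∫ a, T a ∂(P t : Measure α) + ∫ a in S, Y a ∂(P t : Measure α) := fun t h1 => by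
    rw [hT, integral_indicator hSm.compl, add_comm,
      integral_add_compl hSm (h1.integrable one_le_two)]
  have hYs := integrable_mul_of_memLp_two hY0 hs
  have hsplit' : ∫ a, Y a * s a ∂(P 0 : Measure α)
      = ∫ a, T a * s a ∂(P 0 : Measure α) + ∫ a in S, Y a * s a ∂(P 0 : Measure α) := by
    rw [← integral_add_compl hSm hYs, add_comm, ← integral_indicator hSm.compl]
    congr 2 with a
    by_cases ha : a ∈ S <;> simp [hT, ha]
  have htail : |∫ a in S, Y a * s a ∂(P 0 : Measure α)| ≤ ε / 4 := by
    refine (abs_setIntegral_mul_le_sqrt (hY0.restrict S) (hs.restrict S)).trans ?_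
    have h1 := hsqle 0 hY0 hC0
    have h2 := Real.sqrt_le_sqrt (hs' S (hA.trans (min_le_right _ _)))
    rw [Real.sqrt_sq (by positivity)] at h2
    calc _ ≤ M * (ε / (4 * M)) := mul_le_mul h1 h2 (Real.sqrt_nonneg _) hMpos.le
      _ = ε / 4 := by field_simp
  filter_upwards [HasDerivAt.eventually_abs_sub_le hder (show 0 < ε / 4 by positivity),
    hC.filter_mono nhdsWithin_le_nhds, hsmall] with t h1 h2 h3
  have h4 := hR.abs_sub_le t S Y hSm hY (h2.1.restrict S) (hY0.restrict S)
  have h5 := h3 S hSm (hA.trans (min_le_left _ _))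
  have h6 : R t S * (√(∫ a in S, Y a ^ 2 ∂(P t : Measure α))
      + √(∫ a in S, Y a ^ 2 ∂(P 0 : Measure α))) ≤ ε / 2 * |t| := by
    calc _ ≤ (ε / (4 * M) * |t|) * (M + M) := mul_le_mul h5
          (add_le_add (hsqle t h2.1 h2.2) (hsqle 0 hY0 hC0)) (by positivity) (by positivity)
      _ = ε / 2 * |t| := by field_simp; ring
  rw [hsplit t h2.1, hsplit 0 hY0, hsplit']
  have h7 : |t * ∫ a in S, Y a * s a ∂(P 0 : Measure α)| ≤ ε / 4 * |t| := by
    rw [abs_mul, mul_comm]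
    exact mul_le_mul_of_nonneg_right htail (abs_nonneg t)
  have h8 := abs_le.1 h1
  have h9 := abs_le.1 (h4.trans h6)
  have h10 := abs_le.1 h7
  rw [abs_le]
  constructor <;> nlinarith

/-- If `K` has conditional mean zero given `m` under `P 0`, then under `P t` its conditional mean
given `m` is controlled by the Hellinger modulus. -/
theorem abs_setIntegral_mul_le (hR : HellingerModulus P s R) (hm : m ≤ mα) {K : α → ℝ} {κ : ℝ}
    (hKm : Measurable K) (hκ0 : 0 ≤ κ) (hκ : ∀ a, |K a| ≤ κ)
    (hK0 : ∀ B, MeasurableSet[m] B → ∫ a in B, K a ∂(P 0 : Measure α) = 0)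
    {t : ℝ} {S : Set α} (hS : MeasurableSet[m] S) {h : α → ℝ} (hh : Measurable[m] h)
    (hh2 : MemLp h 2 (P t : Measure α)) :
    |∫ a in S, K a * h a ∂(P t : Measure α)| ≤
      4 * κ * √(∫ a in S, h a ^ 2 ∂(P t : Measure α)) * R t S := by
  -- A version of E_t(K | m), clamped so that the bound κ holds everywhere: k is also integrated
  -- under P_0, where a P_t-a.e. bound need not hold.
  set k : α → ℝ := fun a => max (-κ) (min κ (((P t : Measure α)[K|m]) a)) with hk
  have hkm : Measurable[m] k :=
    measurable_const.max (measurable_const.min stronglyMeasurable_condExp.measurable)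
  have hkm' : Measurable k := hkm.mono hm le_rfl
  have hkκ : ∀ a, |k a| ≤ κ := fun a => by
    rw [abs_le]
    exact ⟨le_max_left _ _, max_le (by linarith) (min_le_left _ _)⟩
  have hbK : ∀ t, Integrable K (P t : Measure α) := fun t =>
    Integrable.of_bound hKm.aestronglyMeasurable κ (Eventually.of_forall hκ)
  have hbk : ∀ t, MemLp k 2 (P t : Measure α) := fun t =>
    MemLp.of_bound hkm'.aestronglyMeasurable κ (Eventually.of_forall hkκ)
  have hbK2 : ∀ t, MemLp K 2 (P t : Measure α) := fun t =>
    MemLp.of_bound hKm.aestronglyMeasurable κ (Eventually.of_forall hκ)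
  have hkce : k =ᵐ[(P t : Measure α)] (P t : Measure α)[K|m] := by
    have h1 := ae_bdd_abs_condExp_of_ae_bdd_abs (m := m) (μ := (P t : Measure α)) (R := κ) (f := K)
      (Eventually.of_forall hκ)
    filter_upwards [h1] with a ha
    have ha' : |((P t : Measure α)[K|m]) a| ≤ κ := ha
    rw [abs_le] at ha'
    simp [hk, ha'.1, ha'.2]
  have hS' := hm S hS
  have hproj : ∀ g : α → ℝ, Measurable[m] g → MemLp g 2 (P t : Measure α) →
      ∫ a in S, K a * g a ∂(P t : Measure α) = ∫ a in S, k a * g a ∂(P t : Measure α) := by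
    intro g hg hg2
    have i1 := integrable_mul_of_memLp_two (hbK2 t) hg2
    have i2 := integrable_mul_of_memLp_two (hbk t) hg2
    have hz := integral_mul_eq_zero_of_forall_setIntegral_eq_zero hm (μ := (P t : Measure α))
      (f := fun a => K a - k a) (h := S.indicator g) ((hbK t).sub ((hbk t).integrable one_le_two))
      (fun B hB => by
        rw [integral_sub (hbK t).integrableOn ((hbk t).integrable one_le_two).integrableOn,
          ← setIntegral_condExp hm (hbK t) hB, sub_eq_zero]
        exact integral_congr_ae (ae_restrict_of_ae hkce.symm))
      (hg.indicator hS)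
      (((i1.sub i2).indicator hS').congr (Eventually.of_forall fun a => by
        by_cases ha : a ∈ S <;> simp [ha]; ring))
    rw [← sub_eq_zero, ← integral_sub i1.integrableOn i2.integrableOn, ← integral_indicator hS',
      ← hz]
    refine integral_congr_ae (Eventually.of_forall fun a => ?_)
    by_cases ha : a ∈ S <;> simp [ha]
    ring
  set u := √(∫ a in S, k a ^ 2 ∂(P t : Measure α)) with hu
  set v := √(∫ a in S, k a ^ 2 ∂(P 0 : Measure α)) with hv
  have hu0 : 0 ≤ u := Real.sqrt_nonneg _
  have hv0 : 0 ≤ v := Real.sqrt_nonneg _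
  have hRn := hR.nonneg t S
  have hu2 : u ^ 2 = ∫ a in S, k a ^ 2 ∂(P t : Measure α) :=
    Real.sq_sqrt (integral_nonneg fun a => sq_nonneg _)
  have hv2 : v ^ 2 = ∫ a in S, k a ^ 2 ∂(P 0 : Measure α) :=
    Real.sq_sqrt (integral_nonneg fun a => sq_nonneg _)
  have hKk0 : ∫ a in S, K a * k a ∂(P 0 : Measure α) = 0 := by
    have i1 := integrable_mul_of_memLp_two (hbk 0) (hbK2 0)
    have := integral_mul_eq_zero_of_forall_setIntegral_eq_zero hm (μ := (P 0 : Measure α))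
      (f := K) (h := S.indicator k) (hbK 0) hK0 (hkm.indicator hS)
      ((i1.indicator hS').congr (Eventually.of_forall fun a => by
        by_cases ha : a ∈ S <;> simp [ha]))
    rw [← integral_indicator hS']
    refine Eq.trans ?_ this
    refine integral_congr_ae (Eventually.of_forall fun a => ?_)
    by_cases ha : a ∈ S <;> simp [ha]
    ring
  have hKk : ∀ t, MemLp (fun a => K a * k a) 2 (P t : Measure α) := fun t =>
    MemLp.of_bound (hKm.mul hkm').aestronglyMeasurable (κ * κ) (Eventually.of_forall fun a => by
      rw [Real.norm_eq_abs, abs_mul]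
      exact mul_le_mul (hκ a) (hkκ a) (abs_nonneg _) hκ0)
  -- Under P_t the integral of K k over S is u², and under P_0 it is 0; their difference is
  -- controlled by the modulus.
  have hue : u ^ 2 ≤ R t S * (κ * u + κ * v) := by
    have h1 := hR.abs_sub_le t S (fun a => K a * k a) hS' (hKm.mul hkm')
      ((hKk t).restrict S) ((hKk 0).restrict S)
    rw [hKk0, sub_zero, hproj k hkm (hbk t)] at h1
    have h2 := sqrt_setIntegral_mul_sq_le hκ0 hκ ((hbk t).restrict S)
    have h3 := sqrt_setIntegral_mul_sq_le hκ0 hκ ((hbk 0).restrict S)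
    rw [hu2]
    refine le_trans ?_ ((le_abs_self _).trans (h1.trans
      (mul_le_mul_of_nonneg_left (add_le_add h2 h3) hRn)))
    exact le_of_eq (integral_congr_ae (Eventually.of_forall fun a => sq _))
  have hve : v ^ 2 ≤ 2 * u ^ 2 + 2 * κ ^ 2 * R t S ^ 2 := by
    rw [hu2, hv2]
    exact hR.integral_sq_le t S k κ hS' hkm' hkκ
  -- A self-bounding argument: if u > 4κR then `hve` gives v ≤ 2u, so `hue` gives u² ≤ 3κR u < u², a
  -- contradiction.
  have hfin : u ≤ 4 * κ * R t S := by
    by_contra! hlt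
    have hκR : 0 ≤ κ * R t S := mul_nonneg hκ0 hRn
    have hv' : v ≤ 2 * u := by
      refine abs_le_of_sq_le_sq' ?_ (by positivity) |>.2
      nlinarith
    have : 0 < u := lt_of_le_of_lt (by positivity) hlt
    nlinarith
  rw [hproj h hh hh2]
  refine (abs_setIntegral_mul_le_sqrt ((hbk t).restrict S) (hh2.restrict S)).trans ?_
  calc u * √(∫ a in S, h a ^ 2 ∂(P t : Measure α))
      ≤ (4 * κ * R t S) * √(∫ a in S, h a ^ 2 ∂(P t : Measure α)) :=
        mul_le_mul_of_nonneg_right hfin (Real.sqrt_nonneg _)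
    _ = _ := by ring

end HellingerModulus

end Regression

end MedDiD

namespace MedDiD

/-! ### Differentiating integrals of a regression that varies with the law -/

section DonorRegression

variable {α : Type*} {m mα : MeasurableSpace α}

/-- `n` is a version of the regression `E(Y | m)` within the donor group `D`, whose conditional
probability given `m` is at least `c`; second moments are bounded by `C`. -/
structure IsDonorRegression (m : MeasurableSpace α) {mα : MeasurableSpace α} (Q : Measure α)
    (D : Set α) (Y n : α → ℝ) (c C : ℝ) : Prop where
  memLp_outcome : MemLp Y 2 Q
  integral_outcome_sq_le : ∫ a, Y a ^ 2 ∂Q ≤ C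
  memLp : MemLp n 2 Q
  integral_sq_le : ∫ a, n a ^ 2 ∂Q ≤ C
  setIntegral_eq : ∀ B, MeasurableSet[m] B → ∫ a in B ∩ D, n a ∂Q = ∫ a in B ∩ D, Y a ∂Q
  overlap : ∀ B, MeasurableSet[m] B → c * Q.real B ≤ Q.real (B ∩ D)

namespace IsDonorRegression

variable {Q : Measure α} [IsFiniteMeasure Q] {D : Set α} {Y n : α → ℝ} {c C : ℝ}

/-- Orthogonality of the residual `Y - n` to functions measurable with respect to `m`. -/
theorem setIntegral_mul_sub_eq_zero (h : IsDonorRegression m Q D Y n c C) (hm : m ≤ mα)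
    {g : α → ℝ} (hg : Measurable[m] g)
    (hgi : Integrable (fun a => g a * (Y a - n a)) Q) :
    ∫ a in D, g a * (Y a - n a) ∂Q = 0 := by
  have hYn : Integrable (fun a => Y a - n a) Q :=
    (h.memLp_outcome.sub h.memLp).integrable one_le_two
  have h1 := integral_mul_eq_zero_of_forall_setIntegral_eq_zero hm (μ := Q.restrict D)
    (f := fun a => Y a - n a) (h := g) hYn.restrict (fun B hB => by
      rw [Measure.restrict_restrict (hm B hB), integral_sub
        (h.memLp_outcome.integrable one_le_two).integrableOn
        (h.memLp.integrable one_le_two).integrableOn, h.setIntegral_eq B hB, sub_self])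
    hg hgi.restrict
  exact h1

end IsDonorRegression

namespace HellingerModulus

variable {P : ℝ → ProbabilityMeasure α} {s : α → ℝ} {R : ℝ → Set α → ℝ}

theorem tendsto_univ (hR : HellingerModulus P s R) :
    Tendsto (fun t => R t Set.univ) (𝓝[≠] 0) (𝓝 0) := by
  obtain ⟨L, hL0, hL⟩ := hR.linear_bound
  refine squeeze_zero' (Eventually.of_forall fun t => hR.nonneg t _) hL ?_
  have := ((continuous_abs (G := ℝ)).tendsto 0).const_mul L
  simpa using this.mono_left (nhdsWithin_le_nhds (s := {0}ᶜ))

theorem measureReal_le (hR : HellingerModulus P s R) (t : ℝ) {S : Set α} (hS : MeasurableSet S) :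
    (P 0 : Measure α).real S ≤ (P t : Measure α).real S + 2 * R t Set.univ := by
  have h1 := hR.abs_sub_le t S (fun _ => 1) hS measurable_const (memLp_const 1) (memLp_const 1)
  have h2 : ∀ t, √(∫ _ in S, (1 : ℝ) ^ 2 ∂(P t : Measure α)) ≤ 1 := fun t => by
    rw [Real.sqrt_le_iff]
    simp
  have h3 : R t S * (√(∫ _ in S, (1 : ℝ) ^ 2 ∂(P t : Measure α))
      + √(∫ _ in S, (1 : ℝ) ^ 2 ∂(P 0 : Measure α))) ≤ R t Set.univ * (1 + 1) :=
    mul_le_mul (hR.mono t _ _ hS MeasurableSet.univ (Set.subset_univ S)) (add_le_add (h2 t) (h2 0))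
      (by positivity) (hR.nonneg t _)
  have h4 := abs_le.1 (h1.trans h3)
  simp only [integral_const, smul_eq_mul, mul_one, measureReal_restrict_apply_univ] at h4
  linarith

/-- The regressions within the donor group converge in probability, on the sets where the limit is
bounded. -/
theorem eventually_measureReal_le (hR : HellingerModulus P s R) (hm : m ≤ mα) {D : Set α}
    (hD : MeasurableSet D) {Y : α → ℝ} (hY : Measurable Y) {n : ℝ → α → ℝ}
    (hn : ∀ t, Measurable[m] (n t)) {c C : ℝ} (hc : 0 < c)
    (h : ∀ᶠ t in 𝓝 (0 : ℝ), IsDonorRegression m (P t : Measure α) D Y (n t) c C)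
    (A : ℝ) {η δ : ℝ} (hη : 0 < η) (hδ : 0 < δ) :
    ∀ᶠ t in 𝓝[≠] (0 : ℝ),
      (P 0 : Measure α).real {a | |n 0 a| ≤ A ∧ η < |n t a - n 0 a|} ≤ δ := by
  have h0 := h.self_of_nhds
  set B : Set α := {a | |n 0 a| ≤ A} with hB
  have hBm : MeasurableSet[m] B := 
    (continuous_abs.measurable.comp (hn 0)) measurableSet_Iic
  -- This bounds the norm of Y - n_0 where |n_0| ≤ A. The cutoff is needed because n_0 has no
  -- controlled second moment under P_t.
  set M : ℝ := √(2 * C + 2 * A ^ 2) with hM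
  -- The first constant bounds P_t(S) through the overlap condition; the 2 pays for passing from
  -- P_t(S) to P_0(S).
  have hlim : Tendsto (fun t => (2 * M / (η * c) + 2) * R t Set.univ) (𝓝[≠] 0) (𝓝 0) := by
    simpa using hR.tendsto_univ.const_mul (2 * M / (η * c) + 2)
  filter_upwards [h.filter_mono nhdsWithin_le_nhds, hlim.eventually (gt_mem_nhds hδ)] with t ht hδt
  refine le_trans ?_ hδt.le
  set S : Set α := {a | |n 0 a| ≤ A ∧ η < |n t a - n 0 a|} with hS
  have hSm : MeasurableSet[m] S :=
    MeasurableSet.inter (m := m) hBm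
      ((continuous_abs.measurable.comp ((hn t).sub (hn 0))) measurableSet_Ioi)
  have hSm' := hm S hSm
  -- With g the sign of n_t - n_0 on S, the integral of g (Y - n_0) over D is 0 under P_0. Under P_t
  -- it equals that of g (n_t - n_0), which is at least η P_t(S ∩ D).
  set g : α → ℝ := S.indicator fun a => if 0 ≤ n t a - n 0 a then 1 else -1 with hg
  have hgm : Measurable[m] g :=
    (Measurable.ite (m := m) (((hn t).sub (hn 0)) measurableSet_Ici)
      measurable_const measurable_const).indicator hSm
  have hgm' : Measurable g := hgm.mono hm le_rfl
  have hg1 : ∀ a, |g a| ≤ 1 := fun a => by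
    by_cases ha : a ∈ S
    · rw [hg, Set.indicator_of_mem ha]; split_ifs <;> simp
    · simp [hg, ha]
  have hn' : ∀ t, Measurable (n t) := fun t => (hn t).mono hm le_rfl
  set T : α → ℝ := fun a => g a * (Y a - n 0 a) with hT
  have hTm : Measurable T := hgm'.mul (hY.sub (hn' 0))
  have hTsq : ∀ a, T a ^ 2 ≤ 2 * Y a ^ 2 + 2 * A ^ 2 := fun a => by
    by_cases ha : a ∈ S
    · have h1 := ha.1
      have h2 : n 0 a ^ 2 ≤ A ^ 2 := sq_le_sq' (abs_le.1 h1).1 (abs_le.1 h1).2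
      have h3 : g a ^ 2 ≤ 1 := by
        rw [sq_le_one_iff_abs_le_one]; exact hg1 a
      have h4 := mul_le_mul_of_nonneg_right h3 (sq_nonneg (Y a - n 0 a))
      simp only [hT, mul_pow]
      nlinarith [sq_nonneg (Y a + n 0 a)]
    · simp only [hT, hg, Set.indicator_of_notMem ha, zero_mul, zero_pow two_ne_zero]
      positivity
  have hdom : ∀ t, IsDonorRegression m (P t : Measure α) D Y (n t) c C →
      Integrable (fun a => 2 * Y a ^ 2 + 2 * A ^ 2) (P t : Measure α) := fun t ht =>
    (ht.memLp_outcome.integrable_sq.const_mul 2).add (integrable_const _)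
  have hT2 : ∀ t, IsDonorRegression m (P t : Measure α) D Y (n t) c C →
      MemLp T 2 (P t : Measure α) := fun t ht => by
    rw [memLp_two_iff_integrable_sq hTm.aestronglyMeasurable]
    refine Integrable.mono' (hdom t ht) (hTm.pow_const 2).aestronglyMeasurable
      (Eventually.of_forall fun a => ?_)
    rw [Real.norm_eq_abs, abs_of_nonneg (sq_nonneg _)]
    exact hTsq a
  have hTM : ∀ t, IsDonorRegression m (P t : Measure α) D Y (n t) c C →
      √(∫ a in D, T a ^ 2 ∂(P t : Measure α)) ≤ M := fun t ht => by
    refine Real.sqrt_le_sqrt ((setIntegral_le_integral (hT2 t ht).integrable_sq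
      (Eventually.of_forall fun a => sq_nonneg _)).trans ?_)
    refine (integral_mono (hT2 t ht).integrable_sq (hdom t ht) hTsq).trans ?_
    rw [integral_add (ht.memLp_outcome.integrable_sq.const_mul 2) (integrable_const _),
      integral_const_mul]
    have := ht.integral_outcome_sq_le
    simp only [integral_const, probReal_univ, one_smul]
    linarith
  have hT0 : ∫ a in D, T a ∂(P 0 : Measure α) = 0 :=
    h0.setIntegral_mul_sub_eq_zero hm hgm ((hT2 0 h0).integrable one_le_two)
  have hgi : Integrable (fun a => g a * (Y a - n t a)) (P t : Measure α) := by
    have hg2 : MemLp g 2 (P t : Measure α) :=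
      MemLp.of_bound hgm'.aestronglyMeasurable 1 (Eventually.of_forall hg1)
    exact integrable_mul_of_memLp_two hg2 (ht.memLp_outcome.sub ht.memLp)
  have hTi := (hT2 t ht).integrable one_le_two
  have hTt : ∫ a in D, T a ∂(P t : Measure α)
      = ∫ a in D, g a * (n t a - n 0 a) ∂(P t : Measure α) := by
    rw [← sub_eq_zero, ← integral_sub hTi.integrableOn]
    · refine Eq.trans ?_ (ht.setIntegral_mul_sub_eq_zero hm hgm hgi)
      refine integral_congr_ae (Eventually.of_forall fun a => ?_)
      simp only [hT]
      ring
    · refine ((hTi.sub hgi).congr (Eventually.of_forall fun a => ?_)).integrableOn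
      simp only [hT, Pi.sub_apply]
      ring
  have hlow : η * (P t : Measure α).real (S ∩ D) ≤
      ∫ a in D, g a * (n t a - n 0 a) ∂(P t : Measure α) := by
    have e1 : η * (P t : Measure α).real (S ∩ D)
        = ∫ a in D, S.indicator (fun _ => η) a ∂(P t : Measure α) := by
      rw [integral_indicator_const _ hSm', measureReal_restrict_apply hSm', smul_eq_mul, mul_comm]
    rw [e1]
    refine integral_mono ((integrable_const _).indicator hSm') ?_ fun a => ?_
    · refine ((hTi.sub hgi).congr (Eventually.of_forall fun a => ?_)).integrableOn
      simp only [hT, Pi.sub_apply]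
      ring
    · by_cases ha : a ∈ S
      · have h1 := ha.2
        simp only [hg, Set.indicator_of_mem ha]
        split_ifs with hle
        · rw [abs_of_nonneg (by linarith)] at h1
          linarith
        · rw [abs_of_neg (by linarith)] at h1
          linarith
      · simp [hg, ha]
  have hup : ∫ a in D, g a * (n t a - n 0 a) ∂(P t : Measure α) ≤ R t Set.univ * (2 * M) := by
    have h1 := hR.abs_sub_le t D T hD hTm ((hT2 t ht).restrict D) ((hT2 0 h0).restrict D)
    rw [hT0, sub_zero, hTt] at h1
    refine (le_abs_self _).trans (h1.trans ?_)
    rw [two_mul]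
    exact mul_le_mul (hR.mono t _ _ hD MeasurableSet.univ (Set.subset_univ D))
      (add_le_add (hTM t ht) (hTM 0 h0)) (by positivity) (hR.nonneg t _)
  have h5 := hR.measureReal_le t hSm'
  have h6 := ht.overlap S hSm
  have h7 : (P t : Measure α).real S ≤ 2 * M / (η * c) * R t Set.univ := by
    rw [div_mul_eq_mul_div, le_div_iff₀ (by positivity)]
    have := mul_le_mul_of_nonneg_left h6 hη.le
    linarith
  linarith

/-- The derivative at `t = 0` of `E_t(K n_t)`, where `K` has conditional mean zero given `m` under
`P 0`. -/
theorem hasDerivAt_integral_mul_regression (hR : HellingerModulus P s R)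
    (hs : MemLp s 2 (P 0 : Measure α)) (hm : m ≤ mα) {D : Set α}
    (hD : MeasurableSet D) {Y : α → ℝ} (hY : Measurable Y) {n : ℝ → α → ℝ}
    (hn : ∀ t, Measurable[m] (n t)) {c C : ℝ} (hc : 0 < c)
    (h : ∀ᶠ t in 𝓝 (0 : ℝ), IsDonorRegression m (P t : Measure α) D Y (n t) c C)
    {K : α → ℝ} {κ : ℝ} (hKm : Measurable K) (hκ0 : 0 < κ) (hκ : ∀ a, |K a| ≤ κ)
    (hK0 : ∀ B, MeasurableSet[m] B → ∫ a in B, K a ∂(P 0 : Measure α) = 0) :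
    HasDerivAt (fun t => ∫ a, K a * n t a ∂(P t : Measure α))
      (∫ a, K a * n 0 a * s a ∂(P 0 : Measure α)) 0 := by
  refine hasDerivAt_zero_of_forall_le fun ε hε => ?_
  have h0 := h.self_of_nhds
  have hn' : ∀ t, Measurable (n t) := fun t => (hn t).mono hm le_rfl
  have hK2 : ∀ t, MemLp K 2 (P t : Measure α) := fun t =>
    MemLp.of_bound hKm.aestronglyMeasurable κ (Eventually.of_forall hκ)
  have hCnn : 0 ≤ C := (integral_nonneg fun a => sq_nonneg _).trans h0.integral_sq_le
  obtain ⟨L, hL0, hL⟩ := hR.linear_bound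
  -- H bounds the P_t-norm of n_t - T for the truncation T of n_0: 2 ∫ n_t² + 2 ∫ T² ≤ 2C + 2(C +
  -- 1).
  set H : ℝ := √(4 * C + 2) with hH
  have hHpos : 0 < H := Real.sqrt_pos.2 (by positivity)
  have hCH : √C ≤ H := Real.sqrt_le_sqrt (by linarith)
  obtain ⟨δ, hδ, hsmall⟩ := hR.small (ε / (16 * κ * H)) (by positivity)
  obtain ⟨δ', hδ', hs'⟩ := exists_pos_setIntegral_sq_le hs
    (sq_pos_of_pos (show 0 < ε / (4 * κ * H) by positivity))
  obtain ⟨A, hA0, hA⟩ := exists_measureReal_lt_abs_le (μ := (P 0 : Measure α)) (hn' 0)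
    (lt_min (half_pos hδ) hδ')
  -- Chosen so that 4κη · L|t| ≤ ε/4 |t|; using L + 1 covers L = 0.
  set η : ℝ := ε / (16 * κ * (L + 1)) with hη
  have hηpos : 0 < η := by positivity
  set B : Set α := {a | A < |n 0 a|} with hB
  have hBm : MeasurableSet[m] B := (continuous_abs.measurable.comp (hn 0)) measurableSet_Ioi
  have hBm' := hm B hBm
  set T : α → ℝ := Bᶜ.indicator (n 0) with hT
  have hTm : Measurable[m] T := (hn 0).indicator hBm.compl
  have hTm' : Measurable T := hTm.mono hm le_rfl
  have hTA : ∀ a, |T a| ≤ A := fun a => by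
    by_cases ha : a ∈ B
    · simpa [hT, ha] using hA0
    · rw [hT, Set.indicator_of_mem (by exact ha)]
      simpa [hB] using ha
  have hT2 : ∀ t, MemLp T 2 (P t : Measure α) := fun t =>
    MemLp.of_bound hTm'.aestronglyMeasurable A (Eventually.of_forall hTA)
  -- T² is bounded, so its integral is continuous at t = 0, where it is at most C; the 1 is slack.
  have hTsq : ∀ᶠ t in 𝓝[≠] (0 : ℝ), ∫ a, T a ^ 2 ∂(P t : Measure α) ≤ C + 1 := by
    have hcont := (hR.hasDerivAt_bounded (fun a => T a ^ 2) (A ^ 2) (hTm'.pow_const 2) fun a => by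
      rw [abs_of_nonneg (sq_nonneg _)]
      exact sq_le_sq' (abs_le.1 (hTA a)).1 (abs_le.1 (hTA a)).2).continuousAt
    have hT0 : ∫ a, T a ^ 2 ∂(P 0 : Measure α) < C + 1 := by
      refine lt_of_le_of_lt ((integral_mono (hT2 0).integrable_sq h0.memLp.integrable_sq
        fun a => ?_).trans h0.integral_sq_le) (lt_add_one C)
      by_cases ha : a ∈ B <;> simp [hT, ha, sq_nonneg]
    exact ((hcont.eventually (gt_mem_nhds hT0)).mono fun t ht => le_of_lt ht).filter_mono
      nhdsWithin_le_nhds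
  have hder := hR.hasDerivAt_bounded (fun a => K a * T a) (κ * A) (hKm.mul hTm') fun a => by
    rw [abs_mul]
    exact mul_le_mul (hκ a) (hTA a) (abs_nonneg _) hκ0.le
  have hzero : ∀ g : α → ℝ, Measurable[m] g → MemLp g 2 (P 0 : Measure α) →
      ∫ a, K a * g a ∂(P 0 : Measure α) = 0 := fun g hg hg2 => by
    refine Eq.trans ?_ (integral_mul_eq_zero_of_forall_setIntegral_eq_zero hm
      ((hK2 0).integrable one_le_two) hK0 hg (integrable_mul_of_memLp_two hg2 (hK2 0)))
    exact integral_congr_ae (Eventually.of_forall fun a => mul_comm _ _)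
  have hKn : MemLp (fun a => K a * n 0 a) 2 (P 0 : Measure α) :=
    h0.memLp.of_le_mul (c := κ) (hKm.mul (hn' 0)).aestronglyMeasurable
      (Eventually.of_forall fun a => by
        rw [Real.norm_eq_abs, abs_mul]
        exact mul_le_mul_of_nonneg_right (hκ a) (abs_nonneg _))
  have hsplit' : ∫ a, K a * n 0 a * s a ∂(P 0 : Measure α)
      = ∫ a, K a * T a * s a ∂(P 0 : Measure α)
        + ∫ a in B, K a * n 0 a * s a ∂(P 0 : Measure α) := by
    rw [← integral_add_compl hBm' (integrable_mul_of_memLp_two hKn hs), add_comm,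
      ← integral_indicator hBm'.compl]
    congr 2 with a
    by_cases ha : a ∈ B <;> simp [hT, ha]
  have htail : |∫ a in B, K a * n 0 a * s a ∂(P 0 : Measure α)| ≤ ε / 4 := by
    refine (abs_setIntegral_mul_le_sqrt (hKn.restrict B) (hs.restrict B)).trans ?_
    have h1 : √(∫ a in B, (K a * n 0 a) ^ 2 ∂(P 0 : Measure α)) ≤ κ * H := by
      refine (sqrt_setIntegral_mul_sq_le hκ0.le hκ (h0.memLp.restrict B)).trans ?_
      refine mul_le_mul_of_nonneg_left (le_trans (Real.sqrt_le_sqrt ?_) hCH) hκ0.le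
      exact (setIntegral_le_integral h0.memLp.integrable_sq
        (Eventually.of_forall fun a => sq_nonneg _)).trans h0.integral_sq_le
    have h2 := Real.sqrt_le_sqrt (hs' B (hA.trans (min_le_right _ _)))
    rw [Real.sqrt_sq (by positivity)] at h2
    calc _ ≤ (κ * H) * (ε / (4 * κ * H)) := mul_le_mul h1 h2 (Real.sqrt_nonneg _) (by positivity)
      _ = ε / 4 := by field_simp
  filter_upwards [HasDerivAt.eventually_abs_sub_le hder (show 0 < ε / 4 by positivity),
    h.filter_mono nhdsWithin_le_nhds, hsmall, hL, hTsq,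
    hR.eventually_measureReal_le hm hD hY hn hc h A hηpos (half_pos hδ)] with t h1 ht h3 h4 h5 h6
  -- The replacement error E_t(K g) is split according to whether |g| exceeds η. Where it does, g is
  -- merely bounded in L² but the set is P_0-small, so R is at most a small multiple of |t|;
  -- elsewhere g is small and R ≤ L|t|.
  set g : α → ℝ := fun a => n t a - T a with hg
  have hgm : Measurable[m] g := (hn t).sub hTm
  have hg2 : MemLp g 2 (P t : Measure α) := ht.memLp.sub (hT2 t)
  have hgH : ∀ S : Set α, √(∫ a in S, g a ^ 2 ∂(P t : Measure α)) ≤ H := fun S => by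
    refine Real.sqrt_le_sqrt ((setIntegral_le_integral hg2.integrable_sq
      (Eventually.of_forall fun a => sq_nonneg _)).trans ?_)
    have i1 : Integrable (fun a => 2 * n t a ^ 2) (P t : Measure α) :=
      ht.memLp.integrable_sq.const_mul 2
    have i2 : Integrable (fun a => 2 * T a ^ 2) (P t : Measure α) :=
      (hT2 t).integrable_sq.const_mul 2
    have : ∫ a, g a ^ 2 ∂(P t : Measure α) ≤ ∫ a, (2 * n t a ^ 2 + 2 * T a ^ 2) ∂(P t : Measure α) :=
      integral_mono hg2.integrable_sq (i1.add i2) fun a => by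
        simp only [hg]
        nlinarith [sq_nonneg (n t a + T a)]
    rw [integral_add i1 i2, integral_const_mul, integral_const_mul] at this
    have := ht.integral_sq_le
    linarith
  set S : Set α := {a | η < |g a|} with hS
  have hSm : MeasurableSet[m] S := (continuous_abs.measurable.comp hgm) measurableSet_Ioi
  have hSm' := hm S hSm
  have hSδ : (P 0 : Measure α).real S ≤ δ := by
    -- Off B the truncation is n_0 itself, so convergence in probability controls that part; each of
    -- the two sets has P_0-mass at most δ/2.
    have hsub : S ⊆ B ∪ {a | |n 0 a| ≤ A ∧ η < |n t a - n 0 a|} := fun a ha => by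
      by_cases haB : a ∈ B
      · exact Or.inl haB
      · refine Or.inr ⟨by simpa [hB] using haB, ?_⟩
        have ha' : η < |n t a - T a| := ha
        rwa [hT, Set.indicator_of_mem (by exact haB)] at ha'
    have := measureReal_mono (μ := (P 0 : Measure α)) hsub
    have h8 := measureReal_union_le (μ := (P 0 : Measure α)) B
      {a | |n 0 a| ≤ A ∧ η < |n t a - n 0 a|}
    have h9 := hA.trans (min_le_left _ _)
    linarith
  have hgS : √(∫ a in Sᶜ, g a ^ 2 ∂(P t : Measure α)) ≤ η := by
    rw [Real.sqrt_le_iff]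
    refine ⟨hηpos.le, ?_⟩
    have h8 : ∫ a in Sᶜ, g a ^ 2 ∂(P t : Measure α) ≤ ∫ _ in Sᶜ, η ^ 2 ∂(P t : Measure α) :=
      setIntegral_mono_on hg2.integrable_sq.integrableOn (integrable_const _).integrableOn
        hSm'.compl fun a ha => by
          have ha' : |g a| ≤ η := by simpa [hS] using ha
          exact sq_le_sq' (abs_le.1 ha').1 (abs_le.1 ha').2
    refine h8.trans ?_
    simp only [integral_const, smul_eq_mul, measureReal_restrict_apply_univ]
    exact mul_le_of_le_one_left (sq_nonneg _) measureReal_le_one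
  have b1 := hR.abs_setIntegral_mul_le hm hKm hκ0.le hκ hK0 hSm hgm hg2
  have b2 := hR.abs_setIntegral_mul_le hm hKm hκ0.le hκ hK0 hSm.compl hgm hg2
  have b1' : 4 * κ * √(∫ a in S, g a ^ 2 ∂(P t : Measure α)) * R t S ≤ ε / 4 * |t| := by
    calc _ ≤ (4 * κ * H) * (ε / (16 * κ * H) * |t|) :=
          mul_le_mul (mul_le_mul_of_nonneg_left (hgH S) (by positivity)) (h3 S hSm' hSδ)
            (hR.nonneg t S) (by positivity)
      _ = ε / 4 * |t| := by field_simp; norm_num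
  have b2' : 4 * κ * √(∫ a in Sᶜ, g a ^ 2 ∂(P t : Measure α)) * R t Sᶜ ≤ ε / 4 * |t| := by
    have h10 := (hR.mono t Sᶜ Set.univ hSm'.compl MeasurableSet.univ (Set.subset_univ _)).trans h4
    calc _ ≤ (4 * κ * η) * (L * |t|) :=
          mul_le_mul (mul_le_mul_of_nonneg_left hgS (by positivity)) h10
            (hR.nonneg t _) (by positivity)
      _ ≤ (4 * κ * η) * ((L + 1) * |t|) := by gcongr; linarith
      _ = ε / 4 * |t| := by rw [hη]; field_simp; norm_num
  have hKg := integrable_mul_of_memLp_two (hK2 t) hg2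
  have hsum : ∫ a, K a * n t a ∂(P t : Measure α) = ∫ a, K a * T a ∂(P t : Measure α)
      + (∫ a in S, K a * g a ∂(P t : Measure α) + ∫ a in Sᶜ, K a * g a ∂(P t : Measure α)) := by
    rw [integral_add_compl hSm' hKg,
      ← integral_add (integrable_mul_of_memLp_two (hK2 t) (hT2 t)) hKg]
    refine integral_congr_ae (Eventually.of_forall fun a => ?_)
    simp only [hg]
    ring
  rw [hzero T hTm (hT2 0)] at h1
  rw [hzero (n 0) (hn 0) h0.memLp, hsum, hsplit']
  have h7 : |t * ∫ a in B, K a * n 0 a * s a ∂(P 0 : Measure α)| ≤ ε / 4 * |t| := by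
    rw [abs_mul, mul_comm]
    exact mul_le_mul_of_nonneg_right htail (abs_nonneg t)
  have h8 := abs_le.1 h1
  have h9 := abs_le.1 (b1.trans b1')
  have h10 := abs_le.1 (b2.trans b2')
  have h11 := abs_le.1 h7
  rw [abs_le]
  constructor <;> nlinarith

/-- The derivative at `t = 0` of `E_t(1_{Dᶜ} n_t)`, where `r` is the odds of `Dᶜ` given `m` under
`P 0`. -/
theorem hasDerivAt_setIntegral_compl_regression (hR : HellingerModulus P s R)
    (hs : MemLp s 2 (P 0 : Measure α)) (hm : m ≤ mα) {D : Set α}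
    (hD : MeasurableSet D) {Y : α → ℝ} (hY : Measurable Y) {n : ℝ → α → ℝ}
    (hn : ∀ t, Measurable[m] (n t)) {c C : ℝ} (hc : 0 < c)
    (h : ∀ᶠ t in 𝓝 (0 : ℝ), IsDonorRegression m (P t : Measure α) D Y (n t) c C)
    {r : α → ℝ} {κ : ℝ} (hr : Measurable[m] r) (hκ0 : 0 < κ) (hκ : ∀ a, |r a| ≤ κ)
    (hr0 : ∀ B, MeasurableSet[m] B →
      (P 0 : Measure α).real (B ∩ Dᶜ) = ∫ a in B ∩ D, r a ∂(P 0 : Measure α)) :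
    HasDerivAt (fun t => ∫ a in Dᶜ, n t a ∂(P t : Measure α))
      (∫ a, (D.indicator (fun a => r a * (Y a - n 0 a)) a + Dᶜ.indicator (n 0) a) * s a
        ∂(P 0 : Measure α)) 0 := by
  have h0 := h.self_of_nhds
  have hn' : ∀ t, Measurable (n t) := fun t => (hn t).mono hm le_rfl
  have hr' : Measurable r := hr.mono hm le_rfl
  have hr2 : ∀ t, MemLp r 2 (P t : Measure α) := fun t =>
    MemLp.of_bound hr'.aestronglyMeasurable κ (Eventually.of_forall hκ)
  -- By the definition of the odds r, this function has conditional mean zero given m under P_0.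
  set K : α → ℝ := fun a => Dᶜ.indicator (fun _ => (1 : ℝ)) a - D.indicator r a with hK
  have hKm : Measurable K := (measurable_const.indicator hD.compl).sub (hr'.indicator hD)
  have hKκ : ∀ a, |K a| ≤ κ + 1 := fun a => by
    by_cases ha : a ∈ D
    · simpa [hK, ha] using (hκ a).trans (by linarith)
    · simpa [hK, ha] using hκ0.le
  have hK0 : ∀ B, MeasurableSet[m] B → ∫ a in B, K a ∂(P 0 : Measure α) = 0 := fun B hB => by
    have hrint : Integrable r (P 0 : Measure α) := (hr2 0).integrable one_le_two
    have hone : Integrable (Dᶜ.indicator fun _ => (1 : ℝ)) (P 0 : Measure α) :=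
      (integrable_const _).indicator hD.compl
    rw [hK, integral_sub hone.restrict (hrint.indicator hD).restrict, setIntegral_indicator hD,
      ← hr0 B hB, setIntegral_indicator hD.compl]
    simp
  have d1 := hR.hasDerivAt_integral_mul_regression hs hm hD hY hn hc h hKm
    (by linarith : 0 < κ + 1) hKκ hK0
  set Z : α → ℝ := D.indicator fun a => r a * Y a with hZ
  have hZm : Measurable Z := (hr'.mul hY).indicator hD
  have hZle : ∀ a, |Z a| ≤ κ * |Y a| := fun a => by
    by_cases ha : a ∈ D
    · simp only [hZ, Set.indicator_of_mem ha, abs_mul]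
      exact mul_le_mul_of_nonneg_right (hκ a) (abs_nonneg _)
    · simp only [hZ, Set.indicator_of_notMem ha, abs_zero]
      positivity
  have hZ2 : ∀ t, MemLp Y 2 (P t : Measure α) → MemLp Z 2 (P t : Measure α) := fun t ht =>
    ht.of_le_mul (c := κ) hZm.aestronglyMeasurable (Eventually.of_forall hZle)
  have d2 := hR.hasDerivAt_integral hs hZm (C := κ ^ 2 * C) (h.mono fun t ht => by
    refine ⟨hZ2 t ht.memLp_outcome, ?_⟩
    refine (integral_mono (hZ2 t ht.memLp_outcome).integrable_sq
      (ht.memLp_outcome.integrable_sq.const_mul (κ ^ 2)) fun a => ?_).trans ?_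
    · have := hZle a
      simp only
      rw [← sq_abs, ← sq_abs (Y a), ← mul_pow]
      exact pow_le_pow_left₀ (abs_nonneg _) this 2
    · rw [integral_const_mul]
      exact mul_le_mul_of_nonneg_left ht.integral_outcome_sq_le (sq_nonneg κ))
  have hKn2 : ∀ t, MemLp (n t) 2 (P t : Measure α) →
      MemLp (fun a => K a * n t a) 2 (P t : Measure α) := fun t ht =>
    ht.of_le_mul (c := κ + 1) (hKm.mul (hn' t)).aestronglyMeasurable
      (Eventually.of_forall fun a => by
        rw [Real.norm_eq_abs, abs_mul]
        exact mul_le_mul_of_nonneg_right (hKκ a) (abs_nonneg _))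
  -- The difference of the two sides is the integral of r (Y - n_t) over D, which vanishes under
  -- each P_t near 0 although r belongs to P_0.
  have hEq : (fun t => ∫ a in Dᶜ, n t a ∂(P t : Measure α)) =ᶠ[𝓝 0]
      fun t => ∫ a, K a * n t a ∂(P t : Measure α) + ∫ a, Z a ∂(P t : Measure α) := by
    filter_upwards [h] with t ht
    have hz := ht.setIntegral_mul_sub_eq_zero hm hr
      (integrable_mul_of_memLp_two (hr2 t) (ht.memLp_outcome.sub ht.memLp))
    have i1 := ((hKn2 t ht.memLp).integrable one_le_two)
    have i2 := ((hZ2 t ht.memLp_outcome).integrable one_le_two)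
    have i3 := (ht.memLp.integrable one_le_two).indicator hD.compl
    have i12 : Integrable (fun a => K a * n t a + Z a) (P t : Measure α) := i1.add i2
    rw [← integral_indicator hD.compl, ← integral_add i1 i2, ← sub_eq_zero, ← neg_eq_zero,
      neg_sub, ← integral_sub i12 i3]
    refine Eq.trans ?_ hz
    rw [← integral_indicator hD]
    refine integral_congr_ae (Eventually.of_forall fun a => ?_)
    by_cases ha : a ∈ D
    · simp [hK, hZ, ha]
      ring
    · simp [hK, hZ, ha]
  refine ((d1.add d2).congr_of_eventuallyEq hEq).congr_deriv ?_
  rw [← integral_add (integrable_mul_of_memLp_two (hKn2 0 h0.memLp) hs)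
    (integrable_mul_of_memLp_two (hZ2 0 h0.memLp_outcome) hs)]
  refine integral_congr_ae (Eventually.of_forall fun a => ?_)
  by_cases ha : a ∈ D
  · simp [hK, hZ, ha]
    ring
  · simp [hK, hZ, ha]

end HellingerModulus

end DonorRegression

end MedDiD

namespace MedDiD

/-! ### Positivity as an inequality between events -/

section CondDistrib

variable {α β γ : Type*} [MeasurableSpace α] [MeasurableSpace β] [MeasurableSpace γ]
  [StandardBorelSpace γ] [Nonempty γ] {Q : Measure α} [IsFiniteMeasure Q] {V : α → γ} {Z : α → β}

theorem setIntegral_real_condDistrib (hZ : Measurable Z) (hV : Measurable V) {A : Set γ}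
    (hA : MeasurableSet A) {B : Set β} (hB : MeasurableSet B) :
    ∫ a in Z ⁻¹' B, (condDistrib V Z Q (Z a)).real A ∂Q = Q.real (Z ⁻¹' B ∩ V ⁻¹' A) := by
  have h1 : AEMeasurable (fun a => condDistrib V Z Q (Z a) A) (Q.restrict (Z ⁻¹' B)) :=
    ((Kernel.measurable_coe _ hA).comp hZ).aemeasurable
  rw [measureReal_def, ← setLIntegral_preimage_condDistrib hZ hV.aemeasurable hA hB]
  exact integral_toReal h1 (Eventually.of_forall fun a => measure_lt_top _ _)

/-- The integrated form of positivity avoids conditional kernels, so it can be compared between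
different laws. -/
theorem mul_measureReal_le_of_lt_condDistrib (hZ : Measurable Z) (hV : Measurable V) {A : Set γ}
    (hA : MeasurableSet A) {c : ℝ} (h : ∀ᵐ a ∂Q, c < (condDistrib V Z Q (Z a)).real A)
    {B : Set β} (hB : MeasurableSet B) :
    c * Q.real (Z ⁻¹' B) ≤ Q.real (Z ⁻¹' B ∩ V ⁻¹' A) := by
  rw [← setIntegral_real_condDistrib hZ hV hA hB]
  have h1 : ∫ _ in Z ⁻¹' B, c ∂Q ≤ ∫ a in Z ⁻¹' B, (condDistrib V Z Q (Z a)).real A ∂Q :=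
    integral_mono_ae (integrable_const _) (integrable_toReal_condDistrib hZ.aemeasurable hA).restrict
      (ae_restrict_of_ae (h.mono fun a ha => ha.le))
  simpa [mul_comm] using h1

theorem lt_condDistrib_of_mul_measureReal_le (hZ : Measurable Z) (hV : Measurable V) {A : Set γ}
    (hA : MeasurableSet A) {c c' : ℝ} (hc : c' < c)
    (h : ∀ B : Set β, MeasurableSet B → c * Q.real (Z ⁻¹' B) ≤ Q.real (Z ⁻¹' B ∩ V ⁻¹' A)) :
    ∀ᵐ a ∂Q, c' < (condDistrib V Z Q (Z a)).real A := by
  have hm : Measurable fun b => (condDistrib V Z Q b).real A :=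
    (Kernel.measurable_coe _ hA).ennreal_toReal
  have hB : MeasurableSet {b | (condDistrib V Z Q b).real A ≤ c'} :=
    measurableSet_le hm measurable_const
  have h1 := h _ hB
  rw [← setIntegral_real_condDistrib hZ hV hA hB] at h1
  have h2 : ∫ a in Z ⁻¹' {b | (condDistrib V Z Q b).real A ≤ c'}, (condDistrib V Z Q (Z a)).real A ∂Q
      ≤ ∫ _ in Z ⁻¹' {b | (condDistrib V Z Q b).real A ≤ c'}, c' ∂Q :=
    setIntegral_mono_on (integrable_toReal_condDistrib hZ.aemeasurable hA).integrableOn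
      (integrable_const _).integrableOn (hZ hB) fun a ha => ha
  simp only [integral_const, smul_eq_mul, measureReal_restrict_apply_univ] at h2
  have h3 : Q.real (Z ⁻¹' {b | (condDistrib V Z Q b).real A ≤ c'}) = 0 := by
    refine le_antisymm ?_ measureReal_nonneg
    by_contra! hlt
    nlinarith
  rw [measureReal_eq_zero_iff] at h3
  rw [ae_iff]
  convert h3 using 2
  ext a
  simp

theorem lt_condDistrib_of_measureReal_le {Q' : Measure α} [IsFiniteMeasure Q']
    (hup : ∀ B, Q'.real B ≤ 2 * Q.real B) (hlow : ∀ B, Q.real B ≤ 2 * Q'.real B)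
    (hZ : Measurable Z) (hV : Measurable V) {A : Set γ} (hA : MeasurableSet A) {c : ℝ} (hc : 0 < c)
    (h : ∀ᵐ a ∂Q, c < (condDistrib V Z Q (Z a)).real A) :
    ∀ᵐ a ∂Q', c / 8 < (condDistrib V Z Q' (Z a)).real A := by
  -- Each of the two comparisons loses a factor 2, leaving c/4; recovering a strict pointwise bound
  -- requires a smaller constant, here c/8.
  refine lt_condDistrib_of_mul_measureReal_le hZ hV hA (by linarith : c / 8 < c / 4) fun B hB => ?_
  have h1 := mul_measureReal_le_of_lt_condDistrib hZ hV hA h hB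
  have h2 := hup (Z ⁻¹' B)
  have h3 := hlow (Z ⁻¹' B ∩ V ⁻¹' A)
  nlinarith

end CondDistrib

/-! ### Bounded tilts and the tangent space -/

section Observations

variable {𝒳 ℳ : Type*} [MeasurableSpace 𝒳] [MeasurableSpace ℳ]

theorem measurable_oG : Measurable (oG : Obs 𝒳 ℳ → Bool) := measurable_fst

theorem measurable_oX : Measurable (oX : Obs 𝒳 ℳ → 𝒳) := measurable_snd.fst

theorem measurable_oM : Measurable (oM : Obs 𝒳 ℳ → ℳ) := measurable_snd.snd.snd.fst

theorem measurable_oMX : Measurable (oMX : Obs 𝒳 ℳ → ℳ × 𝒳) := measurable_oM.prodMk measurable_oX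

theorem measurable_oΔ : Measurable (oΔ : Obs 𝒳 ℳ → ℝ) :=
  measurable_snd.snd.snd.snd.sub measurable_snd.snd.fst

theorem measurableSet_oG (g : Bool) : MeasurableSet (oG ⁻¹' {g} : Set (Obs 𝒳 ℳ)) :=
  measurable_oG (measurableSet_singleton g)

theorem measurable_gR : Measurable (gR : Obs 𝒳 ℳ → ℝ) :=
  Measurable.ite (measurableSet_oG true) measurable_const measurable_const

/-- With y = √(1 + x), the left side is (y - 1)²/2, and x² = (y - 1)²(y + 1)² ≥ (y - 1)². -/
theorem abs_sqrt_one_add_sub_le {x : ℝ} (hx : -1 ≤ x) : |√(1 + x) - 1 - x / 2| ≤ x ^ 2 / 2 := by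
  have h0 : 0 ≤ 1 + x := by linarith
  have h1 := Real.sq_sqrt h0
  have h2 := Real.sqrt_nonneg (1 + x)
  set y := √(1 + x)
  have hx' : x = y ^ 2 - 1 := by linarith
  rw [hx', abs_le]
  constructor <;> nlinarith [sq_nonneg (y - 1), mul_nonneg h2 (sq_nonneg (y - 1)),
    mul_nonneg (sq_nonneg y) (sq_nonneg (y - 1))]

/-- The density of the path `(1 + t h) Q`, extended by `1` to large `t`. -/
noncomputable def tiltDensity {α : Type*} (h : α → ℝ) (κ : ℝ) (t : ℝ) (a : α) : ℝ≥0 :=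
  if |t| * κ ≤ 1 / 2 then Real.toNNReal (1 + t * h a) else 1

theorem measurable_tiltDensity {α : Type*} [MeasurableSpace α] {h : α → ℝ} (hh : Measurable h)
    (κ t : ℝ) : Measurable (tiltDensity h κ t) := by
  unfold tiltDensity
  split_ifs
  · exact ((hh.const_mul t).const_add 1).real_toNNReal
  · exact measurable_const

theorem abs_mul_le_half {α : Type*} {h : α → ℝ} {κ : ℝ} (hκ : ∀ a, |h a| ≤ κ) {t : ℝ}
    (ht : |t| * κ ≤ 1 / 2) (a : α) : |t * h a| ≤ 1 / 2 := by
  rw [abs_mul]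
  exact (mul_le_mul_of_nonneg_left (hκ a) (abs_nonneg t)).trans ht

theorem isProbabilityMeasure_tilt {α : Type*} [MeasurableSpace α] {Q : Measure α}
    [IsProbabilityMeasure Q] {h : α → ℝ} (hh : Measurable h) {κ : ℝ} (hκ : ∀ a, |h a| ≤ κ)
    (h0 : ∫ a, h a ∂Q = 0) (t : ℝ) :
    IsProbabilityMeasure (Q.withDensity fun a => (tiltDensity h κ t a : ℝ≥0∞)) := by
  constructor
  rw [withDensity_apply _ MeasurableSet.univ, Measure.restrict_univ]
  by_cases ht : |t| * κ ≤ 1 / 2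
  · have hi : Integrable h Q := Integrable.of_bound hh.aestronglyMeasurable κ
      (Eventually.of_forall hκ)
    have hi' : Integrable (fun a => 1 + t * h a) Q := (integrable_const 1).add (hi.const_mul t)
    have h1 := ofReal_integral_eq_lintegral_ofReal hi' (Eventually.of_forall fun a => by
      have := abs_le.1 (abs_mul_le_half hκ ht a)
      simp only [Pi.zero_apply]
      linarith)
    rw [integral_add (integrable_const 1) (hi.const_mul t), integral_const_mul, h0] at h1
    simp only [tiltDensity, if_pos ht]
    simpa [ENNReal.ofReal] using h1.symm
  · simp only [tiltDensity, if_neg ht]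
    simp

/-- The path `(1 + t h) Q`. -/
noncomputable def tiltPath {α : Type*} [MeasurableSpace α] (Q : ProbabilityMeasure α) {h : α → ℝ}
    (hh : Measurable h) {κ : ℝ} (hκ : ∀ a, |h a| ≤ κ) (h0 : ∫ a, h a ∂(Q : Measure α) = 0)
    (t : ℝ) : ProbabilityMeasure α :=
  ⟨(Q : Measure α).withDensity fun a => (tiltDensity h κ t a : ℝ≥0∞),
    isProbabilityMeasure_tilt hh hκ h0 t⟩

/-- Every bounded mean-zero h is a score. The score may be any version S of h, because the tangent
space is spanned by classes in L². -/
theorem isRegularSubmodel_tiltPath {Q : ProbabilityMeasure (Obs 𝒳 ℳ)} {c : ℝ} (hc : 0 < c)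
    (hpos : GroupPositivity c Q) (hΔ : MemLp oΔ 2 (Q : Measure (Obs 𝒳 ℳ))) {h : Obs 𝒳 ℳ → ℝ}
    (hh : Measurable h) {κ : ℝ} (hκ : ∀ a, |h a| ≤ κ)
    (h0 : ∫ a, h a ∂(Q : Measure (Obs 𝒳 ℳ)) = 0) {S : Obs 𝒳 ℳ → ℝ}
    (hS : S =ᵐ[(Q : Measure (Obs 𝒳 ℳ))] h) :
    IsRegularSubmodel Q (tiltPath Q hh hκ h0) S := by
  have hthrough : tiltPath Q hh hκ h0 0 = Q := by
    refine Subtype.ext ?_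
    change (Q : Measure (Obs 𝒳 ℳ)).withDensity (fun a => (tiltDensity h κ 0 a : ℝ≥0∞)) = Q
    have : (fun a => (tiltDensity h κ 0 a : ℝ≥0∞)) = 1 := by
      ext a; simp [tiltDensity]
    rw [this, withDensity_one]
  have hev : ∀ᶠ t in 𝓝 (0 : ℝ), |t| * κ ≤ 1 / 2 := by
    have : Tendsto (fun t : ℝ => |t| * κ) (𝓝 0) (𝓝 0) := by
      simpa using ((continuous_abs (G := ℝ)).tendsto 0).mul_const κ
    exact (this.eventually (gt_mem_nhds (by norm_num : (0 : ℝ) < 1 / 2))).mono fun t ht => ht.le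
  -- When |t| κ ≤ 1/2 the tilt density lies in [1/2, 3/2], so the tilted law and Q are comparable up
  -- to a factor 2; positivity and the moment bound carry over.
  have hup : ∀ t, |t| * κ ≤ 1 / 2 → (tiltPath Q hh hκ h0 t : Measure (Obs 𝒳 ℳ))
      ≤ (2 : ℝ≥0∞) • (Q : Measure (Obs 𝒳 ℳ)) := fun t ht => by
    rw [← withDensity_const]
    refine withDensity_mono (Eventually.of_forall fun a => ?_)
    have := abs_le.1 (abs_mul_le_half hκ ht a)
    have h2 : tiltDensity h κ t a ≤ 2 := by
      rw [tiltDensity, if_pos ht, Real.toNNReal_le_iff_le_coe]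
      norm_num
      linarith
    change (tiltDensity h κ t a : ℝ≥0∞) ≤ 2
    exact_mod_cast h2
  have hlow : ∀ t, |t| * κ ≤ 1 / 2 → ((2 : ℝ≥0∞)⁻¹ • (Q : Measure (Obs 𝒳 ℳ)))
      ≤ (tiltPath Q hh hκ h0 t : Measure (Obs 𝒳 ℳ)) := fun t ht => by
    rw [← withDensity_const]
    refine withDensity_mono (Eventually.of_forall fun a => ?_)
    have := abs_le.1 (abs_mul_le_half hκ ht a)
    have h2 : (2 : ℝ≥0)⁻¹ ≤ tiltDensity h κ t a := by
      rw [tiltDensity, if_pos ht, Real.le_toNNReal_iff_coe_le (by linarith)]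
      norm_num
      linarith
    have h3 : (((2 : ℝ≥0)⁻¹ : ℝ≥0) : ℝ≥0∞) ≤ tiltDensity h κ t a := by exact_mod_cast h2
    simpa using h3
  have hupR : ∀ t, |t| * κ ≤ 1 / 2 → ∀ B, (tiltPath Q hh hκ h0 t : Measure (Obs 𝒳 ℳ)).real B
      ≤ 2 * (Q : Measure (Obs 𝒳 ℳ)).real B := fun t ht B => by
    have := ENNReal.toReal_mono (ENNReal.mul_ne_top ENNReal.ofNat_ne_top (measure_ne_top _ _))
      (hup t ht B)
    simpa [Measure.real] using this
  have hlowR : ∀ t, |t| * κ ≤ 1 / 2 → ∀ B, (Q : Measure (Obs 𝒳 ℳ)).real B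
      ≤ 2 * (tiltPath Q hh hκ h0 t : Measure (Obs 𝒳 ℳ)).real B := fun t ht B => by
    have := ENNReal.toReal_mono (measure_ne_top _ _) (hlow t ht B)
    simp only [Measure.smul_apply, smul_eq_mul, ENNReal.toReal_mul, ENNReal.toReal_inv,
      ENNReal.toReal_ofNat] at this
    simp only [Measure.real]
    linarith
  refine ⟨hthrough, ⟨?_, ?_⟩, ⟨c / 8, by positivity, ?_⟩, ?_⟩
  · rw [hthrough]
    exact (MemLp.of_bound hh.aestronglyMeasurable κ (Eventually.of_forall hκ)).ae_eq hS.symm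
  · refine ⟨Q, tiltDensity h κ, inferInstance, measurable_tiltDensity hh κ, fun t => rfl, ?_⟩
    have hb : ∀ᶠ t in 𝓝[≠] (0 : ℝ), eLpNorm (fun a => (√(tiltDensity h κ t a : ℝ)
        - √(tiltDensity h κ 0 a : ℝ)) / t - S a / 2 * √(tiltDensity h κ 0 a : ℝ)) 2
        (Q : Measure (Obs 𝒳 ℳ)) ≤ ENNReal.ofReal (|t| * κ ^ 2) := by
      filter_upwards [hev.filter_mono nhdsWithin_le_nhds, self_mem_nhdsWithin] with t ht htne
      have htne : t ≠ 0 := htne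
      have hbd : ∀ᵐ a ∂(Q : Measure (Obs 𝒳 ℳ)), ‖(√(tiltDensity h κ t a : ℝ)
        - √(tiltDensity h κ 0 a : ℝ)) / t - S a / 2 * √(tiltDensity h κ 0 a : ℝ)‖
          ≤ |t| * κ ^ 2 := by
        filter_upwards [hS] with a ha
        have hta := abs_le.1 (abs_mul_le_half hκ ht a)
        have e0 : (tiltDensity h κ 0 a : ℝ) = 1 := by simp [tiltDensity]
        have e1 : (tiltDensity h κ t a : ℝ) = 1 + t * h a := by
          rw [tiltDensity, if_pos ht, Real.coe_toNNReal _ (by linarith)]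
        rw [ha, e0, e1, Real.sqrt_one, Real.norm_eq_abs]
        have h1 := abs_sqrt_one_add_sub_le (show -1 ≤ t * h a by linarith)
        have h2 : (√(1 + t * h a) - 1) / t - h a / 2 * 1
            = (√(1 + t * h a) - 1 - t * h a / 2) / t := by
          field_simp
        rw [h2, abs_div, div_le_iff₀ (abs_pos.2 htne)]
        refine h1.trans ?_
        have h3 : h a ^ 2 ≤ κ ^ 2 := sq_le_sq' (abs_le.1 (hκ a)).1 (abs_le.1 (hκ a)).2
        rw [mul_pow, ← sq_abs t]
        nlinarith [mul_le_mul_of_nonneg_left h3 (sq_nonneg |t|),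
          mul_nonneg (sq_nonneg |t|) (sq_nonneg (h a))]
      refine (eLpNorm_le_of_ae_bound hbd).trans ?_
      simp
    refine tendsto_of_tendsto_of_tendsto_of_le_of_le' tendsto_const_nhds ?_
      (Eventually.of_forall fun t => zero_le) hb
    have : Tendsto (fun t : ℝ => |t| * κ ^ 2) (𝓝[≠] 0) (𝓝 0) := by
      have := ((continuous_abs (G := ℝ)).tendsto 0).mul_const (κ ^ 2)
      rw [abs_zero, zero_mul] at this
      exact this.mono_left nhdsWithin_le_nhds
    simpa using ENNReal.tendsto_ofReal this
  · filter_upwards [hev] with t ht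
    refine ⟨?_, lt_condDistrib_of_measureReal_le (hupR t ht) (hlowR t ht) measurable_oX
      measurable_oG (measurableSet_singleton _) hc hpos.2.1,
      lt_condDistrib_of_measureReal_le (hupR t ht) (hlowR t ht) measurable_oMX
      measurable_oG (measurableSet_singleton _) hc hpos.2.2⟩
    have h1 := hlowR t ht (oG ⁻¹' {true})
    have h2 : c < (Q : Measure (Obs 𝒳 ℳ)).real (oG ⁻¹' {true}) := hpos.1
    change c / 8 < (tiltPath Q hh hκ h0 t : Measure (Obs 𝒳 ℳ)).real (oG ⁻¹' {true})
    linarith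
  · have hfin : ∫⁻ o, ENNReal.ofReal (oΔ o ^ 2) ∂(Q : Measure (Obs 𝒳 ℳ)) ≠ ∞ := by
      have := hΔ.integrable_sq.2
      rw [hasFiniteIntegral_iff_ofReal (Eventually.of_forall fun a => sq_nonneg _)] at this
      exact this.ne
    refine ⟨2 * (∫⁻ o, ENNReal.ofReal (oΔ o ^ 2) ∂(Q : Measure (Obs 𝒳 ℳ))).toNNReal, ?_⟩
    filter_upwards [hev] with t ht
    refine (lintegral_mono' (hup t ht) le_rfl).trans ?_
    rw [lintegral_smul_measure, ENNReal.coe_mul, ENNReal.coe_toNNReal hfin]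
    simp

/-- In the nonparametric model every square integrable mean-zero function is in the tangent
space. -/
theorem toLp_mem_tangentSpace {Q : ProbabilityMeasure (Obs 𝒳 ℳ)} {c : ℝ} (hc : 0 < c)
    (hpos : GroupPositivity c Q) (hΔ : MemLp oΔ 2 (Q : Measure (Obs 𝒳 ℳ))) {φ : Obs 𝒳 ℳ → ℝ}
    (hφ : MemLp φ 2 (Q : Measure (Obs 𝒳 ℳ))) (hφ0 : ∫ o, φ o ∂(Q : Measure (Obs 𝒳 ℳ)) = 0) :
    hφ.toLp φ ∈ tangentSpace Q := by
  rw [tangentSpace, ← SetLike.mem_coe, Submodule.topologicalClosure_coe, Metric.mem_closure_iff]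
  intro ε hε
  obtain ⟨g, hg, hg2⟩ := hφ.exists_simpleFunc_eLpNorm_sub_lt ENNReal.ofNat_ne_top
    (ENNReal.ofReal_pos.2 (half_pos hε)).ne'
  -- Recentring the simple function g costs no more than the approximation itself: φ has mean 0, so
  -- |e| is at most the L² distance from φ to g.
  set e : ℝ := ∫ o, g o ∂(Q : Measure (Obs 𝒳 ℳ)) with he
  have hgi : Integrable g (Q : Measure (Obs 𝒳 ℳ)) := hg2.integrable one_le_two
  obtain ⟨κ, hκ⟩ : ∃ κ : ℝ, ∀ o, |g o - e| ≤ κ := by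
    obtain ⟨κ, hκ⟩ := (g.map fun y => |y - e|).exists_forall_le
    exact ⟨κ, fun o => hκ o⟩
  have hm : Measurable fun o => g o - e := g.measurable.sub_const e
  have h0 : ∫ o, (g o - e) ∂(Q : Measure (Obs 𝒳 ℳ)) = 0 := by
    rw [integral_sub hgi (integrable_const e)]
    simp [he]
  have hh2 : MemLp (fun o => g o - e) 2 (Q : Measure (Obs 𝒳 ℳ)) := hg2.sub (memLp_const e)
  refine ⟨hh2.toLp _, Submodule.subset_span ⟨tiltPath Q hm hκ h0,
    isRegularSubmodel_tiltPath hc hpos hΔ hm hκ h0 hh2.coeFn_toLp⟩, ?_⟩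
  rw [dist_edist, Lp.edist_toLp_toLp]
  have h1 : eLpNorm (φ - fun o => g o - e) 2 (Q : Measure (Obs 𝒳 ℳ)) < ENNReal.ofReal ε := by
    have h2 : (φ - fun o => g o - e) = (φ - ⇑g) + fun _ => e := by
      ext o
      simp
      ring
    have h3 : ‖e‖ₑ ≤ eLpNorm (φ - ⇑g) 2 (Q : Measure (Obs 𝒳 ℳ)) := by
      have h4 : e = - ∫ o, (φ - ⇑g) o ∂(Q : Measure (Obs 𝒳 ℳ)) := by
        have := integral_sub (hφ.integrable one_le_two) hgi
        simp only [Pi.sub_apply]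
        rw [this, hφ0, he]
        ring
      rw [h4, enorm_neg]
      refine (enorm_integral_le_lintegral_enorm _).trans ?_
      rw [← eLpNorm_one_eq_lintegral_enorm]
      exact eLpNorm_le_eLpNorm_of_exponent_le one_le_two (hφ.1.sub hg2.1)
    rw [h2]
    refine (eLpNorm_add_le (hφ.1.sub hg2.1) aestronglyMeasurable_const one_le_two).trans_lt ?_
    rw [← add_halves ε, ENNReal.ofReal_add (by positivity) (by positivity)]
    refine ENNReal.add_lt_add hg (lt_of_le_of_lt ?_ hg)
    rw [eLpNorm_const _ two_ne_zero (IsProbabilityMeasure.ne_zero _)]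
    simpa using h3
  exact ENNReal.toReal_lt_of_lt_ofReal h1

end Observations

end MedDiD

namespace MedDiD

/-! ### Regressions within a group as donor regressions -/

section ConditionedMeasure

variable {α : Type*} {m mα : MeasurableSpace α} {Q : Measure α} {D : Set α}

theorem integral_cond_eq (f : α → ℝ) : ∫ a, f a ∂Q[|D] = (Q.real D)⁻¹ * ∫ a in D, f a ∂Q := by
  rw [ProbabilityTheory.cond, integral_smul_measure, ENNReal.toReal_inv, smul_eq_mul,
    measureReal_def]

theorem memLp_cond_of_memLp {f : α → ℝ} (hD0 : Q D ≠ 0) (hf : MemLp f 2 Q) : MemLp f 2 Q[|D] :=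
  (hf.restrict D).smul_measure (ENNReal.inv_ne_top.2 hD0)

variable [IsFiniteMeasure Q]

theorem setIntegral_eq_mul_integral_cond (hD0 : Q D ≠ 0) (f : α → ℝ) :
    ∫ a in D, f a ∂Q = Q.real D * ∫ a, f a ∂Q[|D] := by
  have : Q.real D ≠ 0 := (ENNReal.toReal_pos hD0 (measure_ne_top _ _)).ne'
  rw [integral_cond_eq, mul_inv_cancel_left₀ this]

theorem restrict_eq_smul_cond (hD0 : Q D ≠ 0) : Q.restrict D = Q D • Q[|D] := by
  rw [ProbabilityTheory.cond, smul_smul, ENNReal.mul_inv_cancel hD0 (measure_ne_top _ _), one_smul]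

/-- The hypothesis is a domination of measures on m, which extends from events to nonnegative
m-measurable functions. -/
theorem mul_lintegral_le_setLIntegral (hm : m ≤ mα) {c : ℝ}
    (h : ∀ B, MeasurableSet[m] B → c * Q.real B ≤ Q.real (B ∩ D)) {f : α → ℝ≥0∞}
    (hf : Measurable[m] f) :
    ENNReal.ofReal c * ∫⁻ a, f a ∂Q ≤ ∫⁻ a in D, f a ∂Q := by
  have hle : ENNReal.ofReal c • Q.trim hm ≤ (Q.restrict D).trim hm := by
    refine Measure.le_iff.2 fun B hB => ?_
    rw [Measure.smul_apply, trim_measurableSet_eq hm hB, trim_measurableSet_eq hm hB,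
      Measure.restrict_apply (hm B hB), smul_eq_mul, ← ofReal_measureReal, ← ofReal_measureReal,
      ← ENNReal.ofReal_mul' measureReal_nonneg]
    exact ENNReal.ofReal_le_ofReal (h B hB)
  rw [← lintegral_trim hm hf, ← lintegral_trim hm hf, ← smul_eq_mul, ← lintegral_smul_measure]
  exact lintegral_mono' hle le_rfl

theorem integral_sq_le_of_ae_eq_condExp {μ : Measure α} {Y n : α → ℝ}
    (hY : MemLp Y 2 μ) (hn : n =ᵐ[μ] μ[Y|m]) : ∫ a, n a ^ 2 ∂μ ≤ ∫ a, Y a ^ 2 ∂μ := by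
  have hn2 : MemLp n 2 μ := (hY.condExp (m := m) one_le_two).ae_eq hn.symm
  have h1 : √(∫ a, n a ^ 2 ∂μ) ≤ √(∫ a, Y a ^ 2 ∂μ) := by
    rw [sqrt_integral_sq_eq_toReal_eLpNorm hn2, sqrt_integral_sq_eq_toReal_eLpNorm hY,
      eLpNorm_congr_ae hn]
    exact ENNReal.toReal_mono hY.2.ne (eLpNorm_condExp_le_eLpNorm Y one_le_two)
  exact (Real.sqrt_le_sqrt_iff (integral_nonneg fun a => sq_nonneg _)).1 h1

/-- The conditional expectation is controlled only on D; overlap extends the control, since c E(n²)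
≤ E(1_D n²) ≤ E(1_D Y²) ≤ C. The constant C + C/c serves for both Y and n. -/
theorem isDonorRegression_of_condExp (hm : m ≤ mα) (hD0 : Q D ≠ 0)
    {Y n : α → ℝ} {c C : ℝ} (hc : 0 < c) (hY : MemLp Y 2 Q) (hYC : ∫ a, Y a ^ 2 ∂Q ≤ C)
    (h : ∀ B, MeasurableSet[m] B → c * Q.real B ≤ Q.real (B ∩ D)) (hn : Measurable[m] n)
    (hnY : n =ᵐ[Q[|D]] (Q[|D])[Y|m]) : IsDonorRegression m Q D Y n c (C + C / c) := by
  have hC0 : 0 ≤ C := (integral_nonneg fun a => sq_nonneg _).trans hYC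
  have hYD : MemLp Y 2 Q[|D] := memLp_cond_of_memLp hD0 hY
  have hnD : MemLp n 2 Q[|D] := (hYD.condExp (m := m) one_le_two).ae_eq hnY.symm
  have hnD' : MemLp n 2 (Q.restrict D) := by
    rw [restrict_eq_smul_cond hD0]
    exact hnD.smul_measure (measure_ne_top _ _)
  have hsqD : ∫ a in D, n a ^ 2 ∂Q ≤ C := by
    refine le_trans ?_ ((setIntegral_le_integral (s := D) hY.integrable_sq
      (Eventually.of_forall fun a => sq_nonneg _)).trans hYC)
    rw [setIntegral_eq_mul_integral_cond hD0, setIntegral_eq_mul_integral_cond (D := D) hD0]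
    exact mul_le_mul_of_nonneg_left (integral_sq_le_of_ae_eq_condExp hYD hnY) measureReal_nonneg
  have hlin := mul_lintegral_le_setLIntegral hm h (f := fun a => ENNReal.ofReal (n a ^ 2))
    (hn.pow_const 2).ennreal_ofReal
  rw [← ofReal_integral_eq_lintegral_ofReal hnD'.integrable_sq
    (Eventually.of_forall fun a => sq_nonneg _)] at hlin
  have hlin' : ∫⁻ a, ENNReal.ofReal (n a ^ 2) ∂Q ≤ ENNReal.ofReal (C / c) := by
    have h1 := hlin.trans (ENNReal.ofReal_le_ofReal hsqD)
    rw [ENNReal.ofReal_div_of_pos hc, ENNReal.le_div_iff_mul_le (Or.inl (by simpa using hc))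
      (Or.inl ENNReal.ofReal_ne_top), mul_comm]
    exact h1
  have hn' : Measurable n := hn.mono hm le_rfl
  have hint : Integrable (fun a => n a ^ 2) Q := by
    refine ⟨(hn'.pow_const 2).aestronglyMeasurable, ?_⟩
    rw [hasFiniteIntegral_iff_ofReal (Eventually.of_forall fun a => sq_nonneg _)]
    exact hlin'.trans_lt ENNReal.ofReal_lt_top
  have hYi : Integrable Y Q[|D] := hYD.integrable one_le_two
  refine ⟨hY, hYC.trans (le_add_of_nonneg_right (by positivity)),
    (memLp_two_iff_integrable_sq hn'.aestronglyMeasurable).2 hint, ?_, fun B hB => ?_, h⟩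
  · rw [integral_eq_lintegral_of_nonneg_ae (Eventually.of_forall fun a => sq_nonneg _) hint.1]
    refine (ENNReal.toReal_le_of_le_ofReal (by positivity) hlin').trans
      (le_add_of_nonneg_left hC0)
  · have h2 : ∀ f : α → ℝ, ∫ a in B ∩ D, f a ∂Q = Q.real D * ∫ a in B, f a ∂Q[|D] := fun f => by
      rw [← Measure.restrict_restrict (hm B hB), restrict_eq_smul_cond hD0, Measure.restrict_smul,
        integral_smul_measure, smul_eq_mul, measureReal_def]
    rw [h2, h2, ← setIntegral_condExp hm hYi hB, integral_congr_ae (ae_restrict_of_ae hnY)]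

end ConditionedMeasure

/-! ### Conditional odds of treatment -/

section Odds

variable {α β : Type*} [MeasurableSpace α] [MeasurableSpace β]
  {Q : Measure α} [IsFiniteMeasure Q] {G : α → Bool} {Z : α → β}

theorem real_bool_add (μ : Measure Bool) [IsProbabilityMeasure μ] :
    μ.real {true} + μ.real {false} = 1 := by
  rw [← measureReal_union (by simp) (measurableSet_singleton _)]
  have : ({true} ∪ {false} : Set Bool) = Set.univ := by
    ext b; cases b <;> simp
  rw [this, probReal_univ]

/-- The odds of `G = 1` given `Z = z`, cut off where `P(G = 0 | Z = z) ≤ c`. -/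
noncomputable def cutOdds (Q : Measure α) [IsFiniteMeasure Q] (G : α → Bool) (Z : α → β) (c : ℝ)
    (z : β) : ℝ :=
  if c < (condDistrib G Z Q z).real {false} then
    (condDistrib G Z Q z).real {true} / (condDistrib G Z Q z).real {false} else 0

theorem measurable_cutOdds (c : ℝ) : Measurable (cutOdds Q G Z c) := by
  have h : ∀ b, Measurable fun z => (condDistrib G Z Q z).real {b} := fun b =>
    (Kernel.measurable_coe _ (measurableSet_singleton b)).ennreal_toReal
  exact Measurable.ite (measurableSet_lt measurable_const (h false)) ((h true).div (h false))
    measurable_const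

theorem abs_cutOdds_le {c : ℝ} (hc : 0 < c) (z : β) : |cutOdds Q G Z c z| ≤ 1 / c := by
  unfold cutOdds
  split_ifs with h
  · rw [abs_of_nonneg (by positivity)]
    exact div_le_div₀ zero_le_one measureReal_le_one hc h.le
  · simpa using hc.le

/-- Conditioning on Z replaces the indicator of G = 0 by its conditional probability, which cancels
the denominator of the odds. Positivity makes the cutoff inactive almost surely; its role is to make
the weight bounded everywhere. -/
theorem setIntegral_cutOdds (hZ : Measurable Z) (hG : Measurable G) {c : ℝ} (hc : 0 < c)
    (h : ∀ᵐ a ∂Q, c < (condDistrib G Z Q (Z a)).real {false}) {B : Set β} (hB : MeasurableSet B) :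
    ∫ a in Z ⁻¹' B ∩ G ⁻¹' {false}, cutOdds Q G Z c (Z a) ∂Q
      = Q.real (Z ⁻¹' B ∩ G ⁻¹' {true}) := by
  have hD : MeasurableSet (G ⁻¹' {false}) := hG (measurableSet_singleton _)
  set q : α → ℝ := fun a => (condDistrib G Z Q (Z a)).real {false} with hq
  have hqi : Integrable q Q := integrable_toReal_condDistrib hZ.aemeasurable
    (measurableSet_singleton _)
  have hDi : Integrable ((G ⁻¹' {false}).indicator fun _ => (1 : ℝ)) Q :=
    (integrable_const _).indicator hD
  set w : α → ℝ := fun a => (Z ⁻¹' B).indicator (fun a => cutOdds Q G Z c (Z a)) a with hw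
  have hwm : Measurable[MeasurableSpace.comap Z inferInstance] w :=
    ((measurable_cutOdds c).comp (comap_measurable Z)).indicator ⟨B, hB, rfl⟩
  have hwm' : Measurable w := hwm.mono hZ.comap_le le_rfl
  have hwb : ∀ a, ‖w a‖ ≤ 1 / c := fun a => by
    by_cases ha : a ∈ Z ⁻¹' B
    · simp only [hw, Set.indicator_of_mem ha]
      exact abs_cutOdds_le hc _
    · simp only [hw, Set.indicator_of_notMem ha, norm_zero]
      positivity
  have hfi : Integrable (fun a => (G ⁻¹' {false}).indicator (fun _ => (1 : ℝ)) a - q a) Q :=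
    hDi.sub hqi
  have i1 : Integrable (fun a => w a * (G ⁻¹' {false}).indicator (fun _ => (1 : ℝ)) a) Q :=
    hDi.bdd_mul (c := 1 / c) hwm'.aestronglyMeasurable (Eventually.of_forall hwb)
  have i2 : Integrable (fun a => w a * q a) Q :=
    hqi.bdd_mul (c := 1 / c) hwm'.aestronglyMeasurable (Eventually.of_forall hwb)
  have hz := integral_mul_eq_zero_of_forall_setIntegral_eq_zero hZ.comap_le hfi
    (by
      rintro _ ⟨A, hA, rfl⟩
      rw [integral_sub hDi.integrableOn hqi.integrableOn,
        setIntegral_real_condDistrib hZ hG (measurableSet_singleton _) hA,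
        setIntegral_indicator hD]
      simp) hwm
    (hfi.bdd_mul (c := 1 / c) hwm'.aestronglyMeasurable (Eventually.of_forall hwb))
  simp only [mul_sub] at hz
  rw [integral_sub i1 i2, sub_eq_zero] at hz
  have e1 : ∫ a in Z ⁻¹' B ∩ G ⁻¹' {false}, cutOdds Q G Z c (Z a) ∂Q
      = ∫ a, w a * (G ⁻¹' {false}).indicator (fun _ => (1 : ℝ)) a ∂Q := by
    rw [← integral_indicator ((hZ hB).inter hD)]
    refine integral_congr_ae (Eventually.of_forall fun a => ?_)
    by_cases h1 : a ∈ Z ⁻¹' B <;> by_cases h2 : a ∈ G ⁻¹' {false} <;> simp [hw, h1, h2]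
  rw [e1, hz, ← setIntegral_real_condDistrib hZ hG (measurableSet_singleton _) hB,
    ← integral_indicator (hZ hB)]
  refine integral_congr_ae ?_
  filter_upwards [h] with a ha
  by_cases h1 : a ∈ Z ⁻¹' B
  · have : (condDistrib G Z Q (Z a)).real {false} ≠ 0 := (hc.trans ha).ne'
    simp only [hw, Set.indicator_of_mem h1, cutOdds, if_pos ha, hq]
    field_simp
  · simp [hw, h1]

end Odds

/-! ### The observed-data functionals as integrals of regressions -/

section Groups

theorem compl_preimage_oG_false {𝒳 ℳ : Type*} :
    (oG ⁻¹' {false} : Set (Obs 𝒳 ℳ))ᶜ = oG ⁻¹' {true} := by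
  ext o
  simp

variable {𝒳 ℳ : Type*} [MeasurableSpace 𝒳] [MeasurableSpace ℳ] {Q : ProbabilityMeasure (Obs 𝒳 ℳ)}

theorem GroupPositivity.measureReal_group_false_pos {c : ℝ} (hc : 0 < c)
    (h : GroupPositivity c Q) : 0 < (Q : Measure (Obs 𝒳 ℳ)).real (oG ⁻¹' {false}) := by
  have := mul_measureReal_le_of_lt_condDistrib measurable_oX measurable_oG
    (measurableSet_singleton false) h.2.1 MeasurableSet.univ
  simp only [Set.preimage_univ, probReal_univ, Set.univ_inter, mul_one] at this
  linarith

theorem GroupPositivity.group_false_ne_zero {c : ℝ} (hc : 0 < c)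
    (h : GroupPositivity c Q) : (Q : Measure (Obs 𝒳 ℳ)) (oG ⁻¹' {false}) ≠ 0 := fun h0 => by
  have := h.measureReal_group_false_pos hc
  simp [Measure.real, h0] at this

theorem GroupPositivity.group_true_ne_zero {c : ℝ} (hc : 0 < c)
    (h : GroupPositivity c Q) : (Q : Measure (Obs 𝒳 ℳ)) (oG ⁻¹' {true}) ≠ 0 := fun h0 => by
  have := hc.trans h.1
  simp [probTreated, Measure.real, h0] at this

theorem integral_group_eq (g : Bool) (f : Obs 𝒳 ℳ → ℝ) : ∫ o, f o ∂(group Q g) =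
    ((Q : Measure (Obs 𝒳 ℳ)).real (oG ⁻¹' {g}))⁻¹ *
      ∫ o in oG ⁻¹' {g}, f o ∂(Q : Measure (Obs 𝒳 ℳ)) :=
  integral_cond_eq f

theorem GroupPositivity.overlap_oX {c : ℝ} (h : GroupPositivity c Q) :
    ∀ B : Set (Obs 𝒳 ℳ), MeasurableSet[MeasurableSpace.comap oX inferInstance] B →
      c * (Q : Measure (Obs 𝒳 ℳ)).real B
        ≤ (Q : Measure (Obs 𝒳 ℳ)).real (B ∩ oG ⁻¹' {false}) := by
  rintro _ ⟨B, hB, rfl⟩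
  exact mul_measureReal_le_of_lt_condDistrib measurable_oX measurable_oG
    (measurableSet_singleton false) h.2.1 hB

theorem GroupPositivity.overlap_oMX {c : ℝ} (h : GroupPositivity c Q) :
    ∀ B : Set (Obs 𝒳 ℳ), MeasurableSet[MeasurableSpace.comap oMX inferInstance] B →
      c * (Q : Measure (Obs 𝒳 ℳ)).real B
        ≤ (Q : Measure (Obs 𝒳 ℳ)).real (B ∩ oG ⁻¹' {false}) := by
  rintro _ ⟨B, hB, rfl⟩
  exact mul_measureReal_le_of_lt_condDistrib measurable_oMX measurable_oG
    (measurableSet_singleton false) h.2.2 hB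

theorem measurable_delta (Q : ProbabilityMeasure (Obs 𝒳 ℳ)) (g : Bool) :
    Measurable fun v : ℳ × 𝒳 => delta Q g v.1 v.2 :=
  (StronglyMeasurable.integral_condDistrib (X := oMX) (Y := oΔ) (μ := group Q g)
    (f := fun p : (ℳ × 𝒳) × ℝ => p.2) measurable_snd.stronglyMeasurable).measurable

theorem delta_ae_eq_condExp {g : Bool} (h : Integrable oΔ (group Q g)) :
    (fun o => delta Q g (oM o) (oX o)) =ᵐ[group Q g]
      (group Q g)[oΔ|MeasurableSpace.comap oMX inferInstance] :=
  (condExp_ae_eq_integral_condDistrib' measurable_oMX h).symm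

theorem isDonorRegression_delta {c C : ℝ} (hc : 0 < c) (hpos : GroupPositivity c Q)
    (hΔ : MemLp oΔ 2 (Q : Measure (Obs 𝒳 ℳ)))
    (hC : ∫ o, oΔ o ^ 2 ∂(Q : Measure (Obs 𝒳 ℳ)) ≤ C) :
    IsDonorRegression (MeasurableSpace.comap oMX inferInstance) (Q : Measure (Obs 𝒳 ℳ))
      (oG ⁻¹' {false}) oΔ (fun o => delta Q false (oM o) (oX o)) c (C + C / c) :=
  isDonorRegression_of_condExp measurable_oMX.comap_le
    (hpos.group_false_ne_zero hc) hc hΔ hC hpos.overlap_oMX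
    ((measurable_delta Q false).comp (comap_measurable oMX))
    (delta_ae_eq_condExp
      ((memLp_cond_of_memLp (hpos.group_false_ne_zero hc) hΔ).integrable one_le_two))

theorem memLp_delta_false {c : ℝ} (hc : 0 < c) (hpos : GroupPositivity c Q)
    (hΔ : MemLp oΔ 2 (Q : Measure (Obs 𝒳 ℳ))) :
    MemLp (fun o => delta Q false (oM o) (oX o)) 2 (Q : Measure (Obs 𝒳 ℳ)) :=
  (isDonorRegression_delta hc hpos hΔ le_rfl).memLp

variable [StandardBorelSpace ℳ] [Nonempty ℳ]

theorem measurable_nu (Q : ProbabilityMeasure (Obs 𝒳 ℳ)) (g g' : Bool) :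
    Measurable (nu Q g g') :=
  (StronglyMeasurable.integral_condDistrib (X := oX) (Y := oM) (μ := group Q g')
    (f := fun p : 𝒳 × ℳ => delta Q g p.2 p.1)
    ((measurable_delta Q g).comp measurable_swap).stronglyMeasurable).measurable

theorem nu_ae_eq_condExp {g g' : Bool}
    (h : Integrable (fun o => delta Q g (oM o) (oX o)) (group Q g')) :
    (fun o => nu Q g g' (oX o)) =ᵐ[group Q g']
      (group Q g')[fun o => delta Q g (oM o) (oX o)|MeasurableSpace.comap oX inferInstance] :=
  (condExp_prod_ae_eq_integral_condDistrib (f := fun p : 𝒳 × ℳ => delta Q g p.2 p.1)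
    measurable_oX measurable_oM.aemeasurable
    ((measurable_delta Q g).comp measurable_swap).stronglyMeasurable h).symm

/-- When both regressions are taken in the same group, the tower property from σ(M,X) to σ(X)
removes the mediator. -/
theorem nu_ae_eq_condExp_outcome {g : Bool} (h : Integrable oΔ (group Q g)) :
    (fun o => nu Q g g (oX o)) =ᵐ[group Q g]
      (group Q g)[oΔ|MeasurableSpace.comap oX inferInstance] := by
  have h1 := delta_ae_eq_condExp h
  refine (nu_ae_eq_condExp (integrable_condExp.congr h1.symm)).trans
    ((condExp_congr_ae h1).trans ?_)
  refine condExp_condExp_of_le ?_ measurable_oMX.comap_le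
  rintro _ ⟨B, hB, rfl⟩
  exact ⟨Prod.snd ⁻¹' B, measurable_snd hB, rfl⟩

theorem isDonorRegression_nu {c C : ℝ} (hc : 0 < c) (hpos : GroupPositivity c Q)
    (hΔ : MemLp oΔ 2 (Q : Measure (Obs 𝒳 ℳ)))
    (hC : ∫ o, oΔ o ^ 2 ∂(Q : Measure (Obs 𝒳 ℳ)) ≤ C) :
    IsDonorRegression (MeasurableSpace.comap oX inferInstance) (Q : Measure (Obs 𝒳 ℳ))
      (oG ⁻¹' {false}) oΔ (fun o => nu Q false false (oX o)) c (C + C / c) :=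
  isDonorRegression_of_condExp measurable_oX.comap_le
    (hpos.group_false_ne_zero hc) hc hΔ hC hpos.overlap_oX
    ((measurable_nu Q false false).comp (comap_measurable oX))
    (nu_ae_eq_condExp_outcome
      ((memLp_cond_of_memLp (hpos.group_false_ne_zero hc) hΔ).integrable one_le_two))

theorem tauObs_true_true {c : ℝ} (hc : 0 < c) (hpos : GroupPositivity c Q)
    (hΔ : MemLp oΔ 2 (Q : Measure (Obs 𝒳 ℳ))) :
    tauObs true true Q
      = (probTreated Q)⁻¹ * ∫ o in oG ⁻¹' {true}, oΔ o ∂(Q : Measure (Obs 𝒳 ℳ)) := by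
  have hi : Integrable oΔ (group Q true) :=
    (memLp_cond_of_memLp (hpos.group_true_ne_zero hc) hΔ).integrable one_le_two
  rw [tauObs, integral_congr_ae (nu_ae_eq_condExp_outcome hi),
    integral_condExp measurable_oX.comap_le, integral_group_eq, probTreated]

theorem tauObs_false_false (Q : ProbabilityMeasure (Obs 𝒳 ℳ)) :
    tauObs false false Q = (probTreated Q)⁻¹ *
      ∫ o in (oG ⁻¹' {false})ᶜ, nu Q false false (oX o) ∂(Q : Measure (Obs 𝒳 ℳ)) := by
  rw [tauObs, integral_group_eq, probTreated, compl_preimage_oG_false]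

/-- The mediator law and the outer mean both belong to the treated group, so the iterated mean
collapses. Overlap given (M,X) makes the donor regression integrable there. -/
theorem tauObs_false_true_eq_integral {c : ℝ} (hc : 0 < c) (hpos : GroupPositivity c Q)
    (hΔ : MemLp oΔ 2 (Q : Measure (Obs 𝒳 ℳ))) :
    tauObs false true Q = ∫ o, delta Q false (oM o) (oX o) ∂(group Q true) := by
  have hi : Integrable (fun o => delta Q false (oM o) (oX o)) (group Q true) :=
    (memLp_cond_of_memLp (hpos.group_true_ne_zero hc)
      (memLp_delta_false hc hpos hΔ)).integrable one_le_two
  rw [tauObs, integral_congr_ae (nu_ae_eq_condExp hi), integral_condExp measurable_oX.comap_le]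

theorem tauObs_false_true {c : ℝ} (hc : 0 < c) (hpos : GroupPositivity c Q)
    (hΔ : MemLp oΔ 2 (Q : Measure (Obs 𝒳 ℳ))) :
    tauObs false true Q = (probTreated Q)⁻¹ *
      ∫ o in (oG ⁻¹' {false})ᶜ, delta Q false (oM o) (oX o) ∂(Q : Measure (Obs 𝒳 ℳ)) := by
  rw [tauObs_false_true_eq_integral hc hpos hΔ, integral_group_eq, probTreated,
    compl_preimage_oG_false]

end Groups

end MedDiD

namespace MedDiD

section OddsDensity

variable {α β : Type*} [MeasurableSpace α] [MeasurableSpace β]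
  {Q : Measure α} [IsFiniteMeasure Q] {G : α → Bool} {Z : α → β}

theorem cutOdds_nonneg (c : ℝ) (z : β) : 0 ≤ cutOdds Q G Z c z := by
  unfold cutOdds
  split_ifs
  · positivity
  · exact le_rfl

/-- The odds are the density of the law of `Z` on `G = 1` with respect to its law on `G = 0`. -/
theorem map_restrict_withDensity_cutOdds (hZ : Measurable Z) (hG : Measurable G) {c : ℝ}
    (hc : 0 < c) (h : ∀ᵐ a ∂Q, c < (condDistrib G Z Q (Z a)).real {false}) :
    ((Q.restrict (G ⁻¹' {false})).map Z).withDensity (fun z => ENNReal.ofReal (cutOdds Q G Z c z))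
      = (Q.restrict (G ⁻¹' {true})).map Z := by
  ext B hB
  have hw : Measurable fun z => ENNReal.ofReal (cutOdds Q G Z c z) :=
    (measurable_cutOdds c).ennreal_ofReal
  have hi : Integrable (fun a => cutOdds Q G Z c (Z a))
      (Q.restrict (Z ⁻¹' B ∩ G ⁻¹' {false})) :=
    Integrable.of_bound ((measurable_cutOdds c).comp hZ).aestronglyMeasurable (1 / c)
      (Eventually.of_forall fun a => abs_cutOdds_le hc _)
  rw [withDensity_apply _ hB, setLIntegral_map hB hw hZ, Measure.restrict_restrict (hZ hB),
    ← ofReal_integral_eq_lintegral_ofReal hi (Eventually.of_forall fun a => cutOdds_nonneg c _),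
    setIntegral_cutOdds hZ hG hc h hB, ofReal_measureReal, Measure.map_apply hZ hB,
    Measure.restrict_apply (hZ hB)]

end OddsDensity

/-! ### Bayes' formula for the mediator density ratio -/

section Bayes

variable {𝒳 ℳ : Type*} [MeasurableSpace 𝒳] [MeasurableSpace ℳ] [StandardBorelSpace ℳ] [Nonempty ℳ]
  {Q : ProbabilityMeasure (Obs 𝒳 ℳ)}

/-- The joint law of `(X, M)` in a group, in terms of the conditional density of `M`. -/
theorem map_restrict_group_apply {ℓ : Measure ℳ} [SigmaFinite ℓ] {f : 𝒳 → ℳ → ℝ≥0} {g : Bool}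
    (hg : (Q : Measure (Obs 𝒳 ℳ)) (oG ⁻¹' {g}) ≠ 0) (hf : IsMediatorDensity ℓ (group Q g) f)
    {w : 𝒳 × ℳ → ℝ≥0∞} (hw : Measurable w) :
    ∫⁻ o in oG ⁻¹' {g}, w (oX o, oM o) ∂(Q : Measure (Obs 𝒳 ℳ))
      = ∫⁻ x, ∫⁻ m, f x m * w (x, m) ∂ℓ
          ∂(((Q : Measure (Obs 𝒳 ℳ)).restrict (oG ⁻¹' {g})).map oX) := by
  have hr : (Q : Measure (Obs 𝒳 ℳ)).restrict (oG ⁻¹' {g})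
      = (Q : Measure (Obs 𝒳 ℳ)) (oG ⁻¹' {g}) • group Q g := restrict_eq_smul_cond hg
  have hXM : Measurable fun o : Obs 𝒳 ℳ => (oX o, oM o) := measurable_oX.prodMk measurable_oM
  rw [hr, lintegral_smul_measure, Measure.map_smul, lintegral_smul_measure]
  congr 1
  rw [← lintegral_map hw hXM, ← compProd_map_condDistrib measurable_oM.aemeasurable,
    Measure.lintegral_compProd hw]
  refine lintegral_congr_ae ?_
  filter_upwards [hf.2] with x hx
  rw [hx, lintegral_withDensity_eq_lintegral_mul]
  · rfl
  · exact (hf.1.comp measurable_prodMk_left).coe_nnreal_ennreal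
  · exact hw.comp measurable_prodMk_left

/-- Bayes' formula: within the group `G = 0`, the odds of `G = 1` given `(M, X)` are the odds given
`X` times the likelihood ratio of the mediator. -/
theorem cutOdds_mul_density_ratio {ℓ : Measure ℳ} [SigmaFinite ℓ] {f : Bool → 𝒳 → ℳ → ℝ≥0} {c : ℝ}
    (hc : 0 < c) (hpos : GroupPositivity c Q) (hf : ∀ g, IsMediatorDensity ℓ (group Q g) (f g)) :
    ∀ᵐ o ∂((Q : Measure (Obs 𝒳 ℳ)).restrict (oG ⁻¹' {false})),
      cutOdds (Q : Measure (Obs 𝒳 ℳ)) oG oX c (oX o)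
          * ((f true (oX o) (oM o) : ℝ) / (f false (oX o) (oM o) : ℝ))
        = cutOdds (Q : Measure (Obs 𝒳 ℳ)) oG oMX c (oMX o) := by
  have hXM : Measurable fun o : Obs 𝒳 ℳ => (oX o, oM o) := measurable_oX.prodMk measurable_oM
  have hfm : ∀ g, Measurable fun p : 𝒳 × ℳ => f g p.1 p.2 := fun g => (hf g).1
  set Z0 : Set (𝒳 × ℳ) := {p | f false p.1 p.2 = 0} with hZ0
  have hZ0m : MeasurableSet Z0 := hfm false (measurableSet_singleton 0)
  -- A zero of f(M | 0, X) has probability 0 in the donor group, hence overall by overlap given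
  -- (M,X); the division by zero is thereby harmless.
  have hnull : (Q : Measure (Obs 𝒳 ℳ)) ((fun o => (oX o, oM o)) ⁻¹' Z0) = 0 := by
    have h1 : (Q : Measure (Obs 𝒳 ℳ)) ((fun o => (oX o, oM o)) ⁻¹' Z0 ∩ oG ⁻¹' {false}) = 0 := by
      have h2 := map_restrict_group_apply (hpos.group_false_ne_zero hc) (hf false)
        (w := Z0.indicator 1) (measurable_one.indicator hZ0m)
      have h3 : ∀ x m, (f false x m : ℝ≥0∞) * Z0.indicator 1 (x, m) = 0 := fun x m => by
        by_cases hp : (x, m) ∈ Z0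
        · have : f false x m = 0 := hp
          simp [this]
        · simp [hp]
      simp only [h3, lintegral_zero] at h2
      have h4 : ∀ o : Obs 𝒳 ℳ, Z0.indicator (1 : 𝒳 × ℳ → ℝ≥0∞) (oX o, oM o)
          = ((fun o => (oX o, oM o)) ⁻¹' Z0).indicator 1 o := fun o => rfl
      simp only [h4] at h2
      rwa [lintegral_indicator_one (hXM hZ0m), Measure.restrict_apply (hXM hZ0m)] at h2
    have h5 := hpos.overlap_oMX ((fun o => (oX o, oM o)) ⁻¹' Z0)
      ⟨Prod.swap ⁻¹' Z0, measurable_swap hZ0m, rfl⟩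
    rw [Measure.real, Measure.real, h1, ENNReal.toReal_zero] at h5
    have h6 : (Q : Measure (Obs 𝒳 ℳ)).real ((fun o => (oX o, oM o)) ⁻¹' Z0) ≤ 0 := by
      by_contra! hlt
      have := mul_pos hc hlt
      rw [Measure.real] at this
      linarith
    exact (measureReal_eq_zero_iff).1 (le_antisymm h6 measureReal_nonneg)
  -- Both `w1` and `w2` turn out to be densities of the law of (X,M) on G = 1 with respect to its
  -- law on G = 0, so they agree almost everywhere.
  set w1 : 𝒳 × ℳ → ℝ≥0∞ := fun p => ENNReal.ofReal (cutOdds (Q : Measure (Obs 𝒳 ℳ)) oG oX c p.1)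
    * ((f true p.1 p.2 / f false p.1 p.2 : ℝ≥0) : ℝ≥0∞) with hw1
  set w2 : 𝒳 × ℳ → ℝ≥0∞ := fun p =>
    ENNReal.ofReal (cutOdds (Q : Measure (Obs 𝒳 ℳ)) oG oMX c p.swap) with hw2
  have hw1m : Measurable w1 :=
    ((measurable_cutOdds c).comp measurable_fst).ennreal_ofReal.mul
      ((hfm true).div (hfm false)).coe_nnreal_ennreal
  have hw2m : Measurable w2 := ((measurable_cutOdds c).comp measurable_swap).ennreal_ofReal
  set μ0 : Measure (𝒳 × ℳ) := ((Q : Measure (Obs 𝒳 ℳ)).restrict (oG ⁻¹' {false})).map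
    fun o => (oX o, oM o) with hμ0
  have e1 : ∀ B, MeasurableSet B → (μ0.withDensity w1) B
      = (Q : Measure (Obs 𝒳 ℳ)) ((fun o => (oX o, oM o)) ⁻¹' B ∩ oG ⁻¹' {true}) := by
    intro B hB
    have hdens := map_restrict_withDensity_cutOdds measurable_oX measurable_oG hc hpos.2.1
    have hF : Measurable fun x => ∫⁻ m, f true x m * (B \ Z0).indicator 1 (x, m) ∂ℓ :=
      Measurable.lintegral_prod_right' (f := fun p : 𝒳 × ℳ =>
        (f true p.1 p.2 : ℝ≥0∞) * (B \ Z0).indicator 1 p)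
        ((hfm true).coe_nnreal_ennreal.mul (measurable_one.indicator (hB.diff hZ0m)))
    have h1 := map_restrict_group_apply (hpos.group_false_ne_zero hc) (hf false)
      (w := B.indicator w1) (hw1m.indicator hB)
    have h2 := map_restrict_group_apply (hpos.group_true_ne_zero hc) (hf true)
      (w := (B \ Z0).indicator 1) (measurable_one.indicator (hB.diff hZ0m))
    have h4 : ∀ o : Obs 𝒳 ℳ, (B \ Z0).indicator (1 : 𝒳 × ℳ → ℝ≥0∞) (oX o, oM o)
        = ((fun o => (oX o, oM o)) ⁻¹' (B \ Z0)).indicator 1 o := fun o => rfl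
    simp only [h4] at h2
    rw [lintegral_indicator_one (hXM (hB.diff hZ0m)),
      Measure.restrict_apply (hXM (hB.diff hZ0m)), ← hdens,
      lintegral_withDensity_eq_lintegral_mul _ (measurable_cutOdds c).ennreal_ofReal hF] at h2
    rw [withDensity_apply _ hB, ← lintegral_indicator hB, hμ0,
      lintegral_map (hw1m.indicator hB) hXM, h1]
    have h5 : (Q : Measure (Obs 𝒳 ℳ)) ((fun o => (oX o, oM o)) ⁻¹' B ∩ oG ⁻¹' {true})
        = (Q : Measure (Obs 𝒳 ℳ)) ((fun o => (oX o, oM o)) ⁻¹' (B \ Z0) ∩ oG ⁻¹' {true}) := by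
      refine measure_congr ?_
      have : ∀ᵐ o ∂(Q : Measure (Obs 𝒳 ℳ)), (oX o, oM o) ∉ Z0 := by
        rw [ae_iff]
        simp only [not_not]
        exact hnull
      filter_upwards [this] with o ho
      refine propext ?_
      change ((oX o, oM o) ∈ B ∧ _) ↔ (((oX o, oM o) ∈ B ∧ (oX o, oM o) ∉ Z0) ∧ _)
      tauto
    rw [h5, h2]
    refine lintegral_congr fun x => ?_
    rw [Pi.mul_apply, ← lintegral_const_mul]
    · refine lintegral_congr fun m => ?_
      by_cases hB' : (x, m) ∈ B
      · by_cases hZ' : (x, m) ∈ Z0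
        · have : f false x m = 0 := hZ'
          simp [this, hZ']
        · have hne : f false x m ≠ 0 := hZ'
          have : (x, m) ∈ B \ Z0 := ⟨hB', hZ'⟩
          rw [Set.indicator_of_mem hB', Set.indicator_of_mem this, hw1]
          simp only [Pi.one_apply, mul_one]
          rw [mul_left_comm, ← ENNReal.coe_mul, mul_div_cancel₀ _ hne]
      · simp [hB']
    · exact ((hfm true).coe_nnreal_ennreal.mul (measurable_one.indicator (hB.diff hZ0m))).comp
        measurable_prodMk_left
  have e2 : ∀ B, MeasurableSet B → (μ0.withDensity w2) B
      = (Q : Measure (Obs 𝒳 ℳ)) ((fun o => (oX o, oM o)) ⁻¹' B ∩ oG ⁻¹' {true}) := by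
    intro B hB
    have hdens := map_restrict_withDensity_cutOdds measurable_oMX measurable_oG hc hpos.2.2
    have h1 := congrArg (fun μ => μ (Prod.swap ⁻¹' B)) hdens
    rw [withDensity_apply _ (measurable_swap hB), setLIntegral_map (measurable_swap hB)
      (measurable_cutOdds c).ennreal_ofReal measurable_oMX,
      Measure.map_apply measurable_oMX (measurable_swap hB),
      Measure.restrict_apply (measurable_oMX (measurable_swap hB))] at h1
    rw [withDensity_apply _ hB, hμ0, setLIntegral_map hB hw2m hXM]
    exact h1
  have hae : w1 =ᵐ[μ0] w2 :=
    (withDensity_eq_iff_of_sigmaFinite hw1m.aemeasurable hw2m.aemeasurable).1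
      (Measure.ext fun B hB => (e1 B hB).trans (e2 B hB).symm)
  have := ae_of_ae_map hXM.aemeasurable hae
  filter_upwards [this] with o ho
  have h1 := congrArg ENNReal.toReal ho
  simp only [hw1, hw2, ENNReal.toReal_mul, ENNReal.toReal_ofReal (cutOdds_nonneg c _),
    ENNReal.coe_toReal, NNReal.coe_div] at h1
  exact h1

end Bayes

end MedDiD

namespace MedDiD

/-! ### Gradients of regression functionals -/

section Gradient

variable {α : Type*} {m mα : MeasurableSpace α} {Q : Measure α} {D : Set α}
  {Y n r : α → ℝ} {c C κ : ℝ}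

/-- The uncentred gradient of `Q ↦ E(1_{Dᶜ} n)`. -/
noncomputable def regressionGradient (D : Set α) (Y n r : α → ℝ) (a : α) : ℝ :=
  D.indicator (fun a => r a * (Y a - n a)) a + Dᶜ.indicator n a

theorem IsDonorRegression.memLp_mul_residual (h : IsDonorRegression m Q D Y n c C)
    (hr : Measurable r) (hκ : ∀ a, |r a| ≤ κ) : MemLp (fun a => r a * (Y a - n a)) 2 Q := by
  have h1 : MemLp (fun a => Y a - n a) 2 Q := h.memLp_outcome.sub h.memLp
  refine h1.of_le_mul (c := κ) (hr.aestronglyMeasurable.mul h1.1)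
    (Eventually.of_forall fun a => ?_)
  rw [norm_mul]
  exact mul_le_mul_of_nonneg_right (hκ a) (norm_nonneg _)

theorem IsDonorRegression.memLp_regressionGradient (h : IsDonorRegression m Q D Y n c C)
    (hD : MeasurableSet D) (hr : Measurable r) (hκ : ∀ a, |r a| ≤ κ) :
    MemLp (regressionGradient D Y n r) 2 Q :=
  ((h.memLp_mul_residual hr hκ).indicator hD).add (h.memLp.indicator hD.compl)

theorem IsDonorRegression.integral_regressionGradient [IsFiniteMeasure Q]
    (h : IsDonorRegression m Q D Y n c C)
    (hm : m ≤ mα) (hD : MeasurableSet D) (hr : Measurable[m] r) (hκ : ∀ a, |r a| ≤ κ) :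
    ∫ a, regressionGradient D Y n r a ∂Q = ∫ a in Dᶜ, n a ∂Q := by
  have i1 : Integrable (fun a => r a * (Y a - n a)) Q :=
    (h.memLp_mul_residual (hr.mono hm le_rfl) hκ).integrable one_le_two
  unfold regressionGradient
  rw [integral_add (i1.indicator hD) ((h.memLp.integrable one_le_two).indicator hD.compl),
    integral_indicator hD, integral_indicator hD.compl, h.setIntegral_mul_sub_eq_zero hm hr i1,
    zero_add]

end Gradient

/-! ### Efficient influence functions -/

section Efficiency

theorem abs_gR_le_one {𝒳 ℳ : Type*} (o : Obs 𝒳 ℳ) : |gR o| ≤ 1 := by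
  unfold gR
  split_ifs <;> simp

theorem gR_eq_indicator {𝒳 ℳ : Type*} : (gR : Obs 𝒳 ℳ → ℝ) = (oG ⁻¹' {true}).indicator fun _ => 1 := by
  ext o
  by_cases h : oG o = true <;> simp [gR, h]

variable {𝒳 ℳ : Type*} [MeasurableSpace 𝒳] [MeasurableSpace ℳ] {Q : ProbabilityMeasure (Obs 𝒳 ℳ)}

theorem IsRegularSubmodel.eventually_memLp {P : ℝ → ProbabilityMeasure (Obs 𝒳 ℳ)}
    {s : Obs 𝒳 ℳ → ℝ} (h : IsRegularSubmodel Q P s) :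
    ∃ c C : ℝ, 0 < c ∧ ∀ᶠ t in 𝓝 (0 : ℝ), GroupPositivity c (P t) ∧
      MemLp oΔ 2 (P t : Measure (Obs 𝒳 ℳ)) ∧
      ∫ o, oΔ o ^ 2 ∂(P t : Measure (Obs 𝒳 ℳ)) ≤ C := by
  obtain ⟨c, hc, hpos⟩ := h.positivity
  obtain ⟨C, hC⟩ := h.moment
  refine ⟨c, C, hc, ?_⟩
  filter_upwards [hpos, hC] with t h1 h2
  have hint : Integrable (fun o => oΔ o ^ 2) (P t : Measure (Obs 𝒳 ℳ)) := by
    refine ⟨(measurable_oΔ.pow_const 2).aestronglyMeasurable, ?_⟩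
    rw [hasFiniteIntegral_iff_ofReal (Eventually.of_forall fun a => sq_nonneg _)]
    exact h2.trans_lt ENNReal.coe_lt_top
  refine ⟨h1, (memLp_two_iff_integrable_sq measurable_oΔ.aestronglyMeasurable).2 hint, ?_⟩
  rw [integral_eq_lintegral_of_nonneg_ae (Eventually.of_forall fun a => sq_nonneg _) hint.1]
  exact ENNReal.toReal_le_of_le_ofReal C.2 (h2.trans (by simp))

theorem IsRegularSubmodel.exists_hellingerModulus {P : ℝ → ProbabilityMeasure (Obs 𝒳 ℳ)}
    {s : Obs 𝒳 ℳ → ℝ} (h : IsRegularSubmodel Q P s) :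
    ∃ R : ℝ → Set (Obs 𝒳 ℳ) → ℝ, HellingerModulus P s R :=
  h.dqm.exists_hellingerModulus

theorem probTreated_eq_integral (Q : ProbabilityMeasure (Obs 𝒳 ℳ)) :
    probTreated Q = ∫ o, gR o ∂(Q : Measure (Obs 𝒳 ℳ)) := by
  rw [gR_eq_indicator, integral_indicator_const _ (measurableSet_oG true), probTreated, smul_eq_mul,
    mul_one]

/-- The efficient influence function of a functional of the form `N(Q) / Q(G = 1)`, from a
gradient of `N`. -/
theorem isEIF_of_ratio {ψ N : ProbabilityMeasure (Obs 𝒳 ℳ) → ℝ} {γ φ : Obs 𝒳 ℳ → ℝ} {c : ℝ}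
    (hc : 0 < c) (hpos : GroupPositivity c Q) (hΔ : MemLp oΔ 2 (Q : Measure (Obs 𝒳 ℳ)))
    (hψ : ∀ (Q' : ProbabilityMeasure (Obs 𝒳 ℳ)) (c' : ℝ), 0 < c' → GroupPositivity c' Q' →
      MemLp oΔ 2 (Q' : Measure (Obs 𝒳 ℳ)) → ψ Q' = (probTreated Q')⁻¹ * N Q')
    (hγ : MemLp γ 2 (Q : Measure (Obs 𝒳 ℳ)))
    (hmean : ∫ o, γ o ∂(Q : Measure (Obs 𝒳 ℳ)) = N Q)
    (hder : ∀ (P : ℝ → ProbabilityMeasure (Obs 𝒳 ℳ)) (s : Obs 𝒳 ℳ → ℝ),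
      IsRegularSubmodel Q P s →
        HasDerivAt (fun t => N (P t)) (∫ o, γ o * s o ∂(Q : Measure (Obs 𝒳 ℳ))) 0)
    (hφ : φ =ᵐ[(Q : Measure (Obs 𝒳 ℳ))] fun o => (probTreated Q)⁻¹ * (γ o - ψ Q * gR o)) :
    IsEIF ψ Q φ := by
  have hp : 0 < probTreated Q := hc.trans hpos.1
  have hgR : MemLp gR 2 (Q : Measure (Obs 𝒳 ℳ)) :=
    MemLp.of_bound measurable_gR.aestronglyMeasurable 1 (Eventually.of_forall abs_gR_le_one)
  have hψQ := hψ Q c hc hpos hΔ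
  have hφ2' : MemLp (fun o => (probTreated Q)⁻¹ * (γ o - ψ Q * gR o)) 2
      (Q : Measure (Obs 𝒳 ℳ)) := (hγ.sub (hgR.const_mul (ψ Q))).const_mul _
  have hφ2 : MemLp φ 2 (Q : Measure (Obs 𝒳 ℳ)) := hφ2'.ae_eq hφ.symm
  have hφ0 : ∫ o, φ o ∂(Q : Measure (Obs 𝒳 ℳ)) = 0 := by
    rw [integral_congr_ae hφ, integral_const_mul, integral_sub (hγ.integrable one_le_two)
      ((hgR.integrable one_le_two).const_mul _), integral_const_mul, ← probTreated_eq_integral,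
      hmean, hψQ]
    field_simp
    ring
  refine ⟨⟨hφ2, hφ0, fun P s hPs => ?_⟩, hφ2, toLp_mem_tangentSpace hc hpos hΔ hφ2 hφ0⟩
  obtain ⟨R, hR⟩ := hPs.exists_hellingerModulus
  obtain ⟨c', C, hc', hev⟩ := hPs.eventually_memLp
  have hthrough := hPs.through
  have hs : MemLp s 2 (Q : Measure (Obs 𝒳 ℳ)) := hthrough ▸ hPs.dqm.1
  have d1 := hR.hasDerivAt_bounded gR 1 measurable_gR abs_gR_le_one
  simp only [← probTreated_eq_integral] at d1
  rw [hthrough] at d1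
  have d2 := hder P s hPs
  have hp0 : probTreated (P 0) ≠ 0 := by rw [hthrough]; exact hp.ne'
  have hEq : (fun t => ψ (P t)) =ᶠ[𝓝 0] fun t => N (P t) / probTreated (P t) := by
    filter_upwards [hev] with t ht
    rw [hψ (P t) c' hc' ht.1 ht.2.1, div_eq_inv_mul]
  -- With p = Q(G = 1) and ψ = N/p, the quotient rule reads ψ' = (N' - ψ p')/p, and p' is
  -- represented by `gR`.
  refine ((d2.div d1 hp0).congr_of_eventuallyEq hEq).congr_deriv ?_
  have e1 : ∫ o, φ o * s o ∂(Q : Measure (Obs 𝒳 ℳ)) = (probTreated Q)⁻¹ *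
      (∫ o, γ o * s o ∂(Q : Measure (Obs 𝒳 ℳ))
        - ψ Q * ∫ o, gR o * s o ∂(Q : Measure (Obs 𝒳 ℳ))) := by
    rw [← integral_const_mul, ← integral_sub (integrable_mul_of_memLp_two hγ hs)
      ((integrable_mul_of_memLp_two hgR hs).const_mul _), ← integral_const_mul]
    refine integral_congr_ae ?_
    filter_upwards [hφ] with o ho
    rw [ho]
    ring
  rw [e1, hψQ, hthrough]
  field_simp

theorem IsEIF.sub {ψ₁ ψ₂ : ProbabilityMeasure (Obs 𝒳 ℳ) → ℝ} {φ₁ φ₂ : Obs 𝒳 ℳ → ℝ}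
    (h₁ : IsEIF ψ₁ Q φ₁) (h₂ : IsEIF ψ₂ Q φ₂) :
    IsEIF (fun Q => ψ₁ Q - ψ₂ Q) Q (fun o => φ₁ o - φ₂ o) := by
  obtain ⟨⟨hm₁, hz₁, hp₁⟩, hm₁', ht₁⟩ := h₁
  obtain ⟨⟨hm₂, hz₂, hp₂⟩, hm₂', ht₂⟩ := h₂
  refine ⟨⟨hm₁.sub hm₂, ?_, fun P s hPs => ?_⟩, hm₁.sub hm₂, Submodule.sub_mem _ ht₁ ht₂⟩
  · rw [integral_sub (hm₁.integrable one_le_two) (hm₂.integrable one_le_two), hz₁, hz₂, sub_zero]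
  · have hs : MemLp s 2 (Q : Measure (Obs 𝒳 ℳ)) := hPs.through ▸ hPs.dqm.1
    refine ((hp₁ P s hPs).sub (hp₂ P s hPs)).congr_deriv ?_
    rw [← integral_sub (integrable_mul_of_memLp_two hm₁ hs) (integrable_mul_of_memLp_two hm₂ hs)]
    simp only [sub_mul]

theorem propensity_odds_eq {c : ℝ} (hpos : GroupPositivity c Q) :
    ∀ᵐ o ∂(Q : Measure (Obs 𝒳 ℳ)), propensity Q (oX o) / (1 - propensity Q (oX o))
      = cutOdds (Q : Measure (Obs 𝒳 ℳ)) oG oX c (oX o) := by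
  filter_upwards [hpos.2.1] with o ho
  rw [probGivenX] at ho
  have h1 := real_bool_add (condDistrib oG oX (Q : Measure (Obs 𝒳 ℳ)) (oX o))
  rw [cutOdds, if_pos ho, propensity, probGivenX, ← h1, add_sub_cancel_left]

variable [StandardBorelSpace ℳ] [Nonempty ℳ]

theorem isEIF_tauObs_true_true {c : ℝ} (hc : 0 < c) (hpos : GroupPositivity c Q)
    (hΔ : MemLp oΔ 2 (Q : Measure (Obs 𝒳 ℳ))) : IsEIF (tauObs true true) Q (phi11 Q) := by
  have hind : Measurable ((oG ⁻¹' {true}).indicator oΔ : Obs 𝒳 ℳ → ℝ) :=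
    measurable_oΔ.indicator (measurableSet_oG true)
  refine isEIF_of_ratio
    (N := fun Q => ∫ o in oG ⁻¹' {true}, oΔ o ∂(Q : Measure (Obs 𝒳 ℳ)))
    (γ := (oG ⁻¹' {true}).indicator oΔ) hc hpos hΔ
    (fun Q' c' hc' hpos' hΔ' => tauObs_true_true hc' hpos' hΔ')
    (hΔ.indicator (measurableSet_oG true)) (integral_indicator (measurableSet_oG true))
    (fun P s hPs => ?_) (Eventually.of_forall fun o => ?_)
  · obtain ⟨R, hR⟩ := hPs.exists_hellingerModulus
    obtain ⟨c', C, hc', hev⟩ := hPs.eventually_memLp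
    have hd := hR.hasDerivAt_integral hPs.dqm.1 hind (C := C) (hev.mono fun t ht => by
      refine ⟨ht.2.1.indicator (measurableSet_oG true), le_trans ?_ ht.2.2⟩
      refine integral_mono (ht.2.1.indicator (measurableSet_oG true)).integrable_sq
        ht.2.1.integrable_sq fun o => ?_
      by_cases h : o ∈ oG ⁻¹' {true}
      · simp only [Set.indicator_of_mem h, le_refl]
      · simp only [Set.indicator_of_notMem h, zero_pow two_ne_zero]
        exact sq_nonneg _)
    rw [hPs.through] at hd
    simpa only [integral_indicator (measurableSet_oG true)] using hd
  · by_cases h : oG o = true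
    · simp [phi11, gR, h, div_eq_inv_mul]
    · simp [phi11, gR, h]

/-- The regression derivative with sigma-algebra σ(X), the odds given X serving as weight. -/
theorem isEIF_tauObs_false_false {c : ℝ} (hc : 0 < c) (hpos : GroupPositivity c Q)
    (hΔ : MemLp oΔ 2 (Q : Measure (Obs 𝒳 ℳ))) : IsEIF (tauObs false false) Q (phi00 Q) := by
  have hreg := isDonorRegression_nu hc hpos hΔ le_rfl
  have hrm : Measurable[MeasurableSpace.comap oX inferInstance] fun o : Obs 𝒳 ℳ =>
      cutOdds (Q : Measure (Obs 𝒳 ℳ)) oG oX c (oX o) :=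
    (measurable_cutOdds c).comp (comap_measurable oX)
  have hrb : ∀ o : Obs 𝒳 ℳ, |cutOdds (Q : Measure (Obs 𝒳 ℳ)) oG oX c (oX o)| ≤ 1 / c := fun o =>
    abs_cutOdds_le hc _
  have hle := (measurable_oX (𝒳 := 𝒳) (ℳ := ℳ)).comap_le
  refine isEIF_of_ratio
    (N := fun Q => ∫ o in (oG ⁻¹' {false})ᶜ, nu Q false false (oX o) ∂(Q : Measure (Obs 𝒳 ℳ)))
    (γ := regressionGradient (oG ⁻¹' {false}) oΔ (fun o => nu Q false false (oX o))
      (fun o => cutOdds (Q : Measure (Obs 𝒳 ℳ)) oG oX c (oX o))) hc hpos hΔ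
    (fun Q' c' hc' hpos' hΔ' => tauObs_false_false Q')
    (hreg.memLp_regressionGradient (measurableSet_oG false) (hrm.mono hle le_rfl) hrb)
    (hreg.integral_regressionGradient hle (measurableSet_oG false) hrm hrb)
    (fun P s hPs => ?_) ?_
  · obtain ⟨R, hR⟩ := hPs.exists_hellingerModulus
    obtain ⟨c', C, hc', hev⟩ := hPs.eventually_memLp
    obtain rfl := hPs.through
    exact hR.hasDerivAt_setIntegral_compl_regression hPs.dqm.1 hle (measurableSet_oG false)
      measurable_oΔ (n := fun t o => nu (P t) false false (oX o))
      (fun t => (measurable_nu (P t) false false).comp (comap_measurable oX)) hc'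
      (hev.mono fun t ht => isDonorRegression_nu hc' ht.1 ht.2.1 ht.2.2) hrm
      (by positivity : 0 < 1 / c) hrb (by
        rintro _ ⟨B, hB, rfl⟩
        rw [compl_preimage_oG_false]
        exact (setIntegral_cutOdds measurable_oX measurable_oG hc hpos.2.1 hB).symm)
  · filter_upwards [propensity_odds_eq hpos] with o ho
    by_cases h : oG o = true
    · simp [phi00, gR, h, regressionGradient, div_eq_inv_mul]
    · simp [phi00, gR, h, regressionGradient, ho, mul_assoc]

/-- The same derivative with sigma-algebra σ(M,X); only the form of the weight calls for the
mediator densities. -/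
theorem isEIF_tauObs_false_true {c : ℝ} (hc : 0 < c) (hpos : GroupPositivity c Q)
    (hΔ : MemLp oΔ 2 (Q : Measure (Obs 𝒳 ℳ))) {ℓ : Measure ℳ} [SigmaFinite ℓ]
    {f : Bool → 𝒳 → ℳ → ℝ≥0} (hf : ∀ g, IsMediatorDensity ℓ (group Q g) (f g)) :
    IsEIF (tauObs false true) Q (phi01 Q f) := by
  have hreg := isDonorRegression_delta hc hpos hΔ le_rfl
  have hrm : Measurable[MeasurableSpace.comap oMX inferInstance] fun o : Obs 𝒳 ℳ =>
      cutOdds (Q : Measure (Obs 𝒳 ℳ)) oG oMX c (oMX o) :=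
    (measurable_cutOdds c).comp (comap_measurable oMX)
  have hrb : ∀ o : Obs 𝒳 ℳ, |cutOdds (Q : Measure (Obs 𝒳 ℳ)) oG oMX c (oMX o)| ≤ 1 / c := fun o =>
    abs_cutOdds_le hc _
  have hle := (measurable_oMX (𝒳 := 𝒳) (ℳ := ℳ)).comap_le
  refine isEIF_of_ratio
    (N := fun Q => ∫ o in (oG ⁻¹' {false})ᶜ, delta Q false (oM o) (oX o)
      ∂(Q : Measure (Obs 𝒳 ℳ)))
    (γ := regressionGradient (oG ⁻¹' {false}) oΔ (fun o => delta Q false (oM o) (oX o))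
      (fun o => cutOdds (Q : Measure (Obs 𝒳 ℳ)) oG oMX c (oMX o))) hc hpos hΔ
    (fun Q' c' hc' hpos' hΔ' => tauObs_false_true hc' hpos' hΔ')
    (hreg.memLp_regressionGradient (measurableSet_oG false) (hrm.mono hle le_rfl) hrb)
    (hreg.integral_regressionGradient hle (measurableSet_oG false) hrm hrb)
    (fun P s hPs => ?_) ?_
  · obtain ⟨R, hR⟩ := hPs.exists_hellingerModulus
    obtain ⟨c', C, hc', hev⟩ := hPs.eventually_memLp
    obtain rfl := hPs.through
    exact hR.hasDerivAt_setIntegral_compl_regression hPs.dqm.1 hle (measurableSet_oG false)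
      measurable_oΔ (n := fun t o => delta (P t) false (oM o) (oX o))
      (fun t => (measurable_delta (P t) false).comp (comap_measurable oMX)) hc'
      (hev.mono fun t ht => isDonorRegression_delta hc' ht.1 ht.2.1 ht.2.2) hrm
      (by positivity : 0 < 1 / c) hrb (by
        rintro _ ⟨B, hB, rfl⟩
        rw [compl_preimage_oG_false]
        exact (setIntegral_cutOdds measurable_oMX measurable_oG hc hpos.2.2 hB).symm)
  -- Bayes' identity holds only on G = 0, which suffices because the weighted residual carries the
  -- factor 1 - G.
  · have hbayes := cutOdds_mul_density_ratio hc hpos hf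
    rw [ae_restrict_iff' (measurableSet_oG false)] at hbayes
    filter_upwards [propensity_odds_eq hpos, hbayes] with o ho hb
    by_cases h : oG o = true
    · simp [phi01, gR, h, regressionGradient, div_eq_inv_mul]
    · have hb' := hb (by simpa using h)
      simp [phi01, gR, h, regressionGradient, ho, ← hb', mul_assoc]

end Efficiency

end MedDiD

namespace MedDiD

/-! ### Conditional laws and absolute continuity -/

section Kernels

variable {α α' β γ : Type*} [MeasurableSpace α] [MeasurableSpace α'] [MeasurableSpace β]
  [MeasurableSpace γ]

theorem condDistrib_eq_of_map_eq [StandardBorelSpace γ] [Nonempty γ] {μ : Measure α}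
    {μ' : Measure α'} [IsFiniteMeasure μ] [IsFiniteMeasure μ'] {X : α → β} {Y : α → γ} {X' : α' → β}
    {Y' : α' → γ} (h : μ.map (fun a => (X a, Y a)) = μ'.map fun a => (X' a, Y' a)) :
    condDistrib Y X μ = condDistrib Y' X' μ' := by
  have aux : ∀ (ρ ρ' : Measure (β × γ)) [IsFiniteMeasure ρ] [IsFiniteMeasure ρ'], ρ = ρ' →
      ρ.condKernel = ρ'.condKernel := by
    rintro ρ ρ' _ _ rfl
    rfl
  rw [condDistrib, condDistrib]
  exact aux _ _ h

/-- If `ρ` is absolutely continuous with respect to some `ν ⊗ κ`, then also with respect to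
`ρ₁ ⊗ κ`, where `ρ₁` is its own first marginal. -/
theorem absolutelyContinuous_fst_compProd {ρ : Measure (β × γ)} [IsFiniteMeasure ρ] {ν : Measure β}
    [SFinite ν] {κ : Kernel β γ} [IsSFiniteKernel κ] (h : ρ ≪ ν ⊗ₘ κ) : ρ ≪ ρ.fst ⊗ₘ κ := by
  refine Measure.AbsolutelyContinuous.mk fun N hN hN0 => ?_
  rw [Measure.compProd_apply hN, lintegral_eq_zero_iff
    (Kernel.measurable_kernel_prodMk_left hN)] at hN0
  -- E collects the points with non-null slice of N. The cylinder over E is ρ-null because E is null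
  -- for the first marginal; the rest of N has only null slices, hence is null for ν ⊗ κ and so for
  -- ρ.
  set E : Set β := {x | κ x (Prod.mk x ⁻¹' N) ≠ 0} with hE
  have hEm : MeasurableSet E :=
    (Kernel.measurable_kernel_prodMk_left hN (measurableSet_singleton 0)).compl
  have hE0 : ρ (Prod.fst ⁻¹' E) = 0 := by
    rw [← Measure.fst_apply hEm]
    exact hN0
  have hN' : ρ (N \ Prod.fst ⁻¹' E) = 0 := by
    refine h ?_
    rw [Measure.compProd_apply (hN.diff (measurable_fst hEm))]
    refine (lintegral_congr fun x => ?_).trans lintegral_zero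
    by_cases hx : x ∈ E
    · have : Prod.mk x ⁻¹' (N \ Prod.fst ⁻¹' E) = ∅ := by
        ext m; simp [hx]
      rw [this, measure_empty]
    · have : κ x (Prod.mk x ⁻¹' N) = 0 := by simpa [hE] using hx
      exact measure_mono_null (fun m hm => hm.1) this
  refine measure_mono_null (fun p hp => ?_) (measure_union_null hN' hE0)
  by_cases hpE : p ∈ Prod.fst ⁻¹' E
  · exact Or.inr hpE
  · exact Or.inl ⟨hp, hpE⟩

end Kernels

section Overlap

variable {𝒳 ℳ β : Type*} [MeasurableSpace 𝒳] [MeasurableSpace ℳ] [MeasurableSpace β]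
  {Q : ProbabilityMeasure (Obs 𝒳 ℳ)}

/-- By overlap, an event in Z that is null among the untreated is null altogether. -/
theorem map_group_absolutelyContinuous {Z : Obs 𝒳 ℳ → β} (hZ : Measurable Z) {c : ℝ} (hc : 0 < c)
    (hpos : GroupPositivity c Q)
    (h : ∀ B : Set (Obs 𝒳 ℳ), MeasurableSet[MeasurableSpace.comap Z inferInstance] B →
      c * (Q : Measure (Obs 𝒳 ℳ)).real B ≤ (Q : Measure (Obs 𝒳 ℳ)).real (B ∩ oG ⁻¹' {false})) :
    (group Q true).map Z ≪ (group Q false).map Z := by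
  refine Measure.AbsolutelyContinuous.mk fun B hB hB0 => ?_
  rw [Measure.map_apply hZ hB] at hB0 ⊢
  refine cond_absolutelyContinuous ?_
  have h1 : (Q : Measure (Obs 𝒳 ℳ)) (Z ⁻¹' B ∩ oG ⁻¹' {false}) = 0 := by
    rw [← Measure.restrict_apply (hZ hB), restrict_eq_smul_cond (hpos.group_false_ne_zero hc)]
    change _ * (group Q false) (Z ⁻¹' B) = 0
    rw [hB0, mul_zero]
  have h2 := h _ ⟨B, hB, rfl⟩
  rw [Measure.real, Measure.real, h1, ENNReal.toReal_zero] at h2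
  rw [← measureReal_eq_zero_iff]
  refine le_antisymm ?_ measureReal_nonneg
  by_contra! hlt
  have := mul_pos hc hlt
  rw [Measure.real] at this
  linarith

end Overlap

/-! ### Identification of the causal effects -/

namespace Design

variable {Ω 𝒳 ℳ : Type*} [MeasurableSpace Ω] [MeasurableSpace 𝒳] [MeasurableSpace ℳ]
  {Pr : Measure Ω} {D : Design Ω 𝒳 ℳ}

theorem given_eq (g : Bool) : D.given Pr g
    = (Pr (D.G ⁻¹' {g}))⁻¹ • Pr.restrict (D.G ⁻¹' {g}) := rfl

theorem ae_given_of_ae {p : Ω → Prop} (h : ∀ᵐ ω ∂Pr, p ω) (g : Bool) : ∀ᵐ ω ∂(D.given Pr g), p ω :=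
  cond_absolutelyContinuous.ae_le h

theorem measurableSet_G (D : Design Ω 𝒳 ℳ) (g : Bool) : MeasurableSet (D.G ⁻¹' {g}) :=
  D.measurable_G (measurableSet_singleton g)

theorem ae_given_G (g : Bool) : ∀ᵐ ω ∂(D.given Pr g), D.G ω = g := by
  rw [given_eq]
  exact Measure.ae_smul_measure (ae_restrict_mem (D.measurableSet_G g)) _

theorem Consistency.ae_given (h : D.Consistency Pr) (g : Bool) : ∀ᵐ ω ∂(D.given Pr g),
    D.pM g ω = D.M ω ∧ D.pY0 g ω = D.Y0 ω ∧ D.nested g g ω = D.Y1 ω := by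
  filter_upwards [ae_given_G g, ae_given_of_ae h g] with ω h1 h2
  rwa [h1] at h2

theorem ae_nested_true_true (h1 : D.NoAnticipation Pr) (h5 : D.Consistency Pr) :
    (fun ω => D.nested true true ω - D.pY0 false ω) =ᵐ[D.given Pr true] fun ω => oΔ (D.obs ω) := by
  filter_upwards [h5.ae_given true, ae_given_of_ae h1 true] with ω e1 e2
  rw [← e2, e1.2.1, e1.2.2]
  rfl

theorem integrable_nested_true_true (h1 : D.NoAnticipation Pr)
    (hΔ : MemLp (fun ω => D.Y1 ω - D.Y0 ω) 2 Pr) (h0 : Pr (D.G ⁻¹' {true}) ≠ 0)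
    (h5 : D.Consistency Pr) :
    Integrable (fun ω => D.nested true true ω - D.pY0 false ω) (D.given Pr true) :=
  ((memLp_cond_of_memLp h0 hΔ).integrable one_le_two).congr (ae_nested_true_true h1 h5).symm

variable [IsProbabilityMeasure Pr]

theorem group_law (g : Bool) : group (D.law Pr) g = (D.given Pr g).map D.obs := by
  have hS := measurableSet_oG (𝒳 := 𝒳) (ℳ := ℳ) g
  change ((Pr.map D.obs) (oG ⁻¹' {g}))⁻¹ • (Pr.map D.obs).restrict (oG ⁻¹' {g})
    = ((Pr (D.G ⁻¹' {g}))⁻¹ • Pr.restrict (D.G ⁻¹' {g})).map D.obs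
  rw [Measure.map_apply D.measurable_obs hS, Measure.restrict_map D.measurable_obs hS,
    Measure.map_smul]
  rfl

theorem integral_group_law {f : Obs 𝒳 ℳ → ℝ} (hf : Measurable f) (g : Bool) :
    ∫ o, f o ∂(group (D.law Pr) g) = ∫ ω, f (D.obs ω) ∂(D.given Pr g) := by
  rw [group_law, integral_map D.measurable_obs.aemeasurable hf.aestronglyMeasurable]

/-- Within the untreated group the potential outcome trend is the observed regression. -/
theorem trend_false_false_eq_delta (h : D.Consistency Pr) (v : ℳ × 𝒳) :
    D.trend Pr false false v = delta (D.law Pr) false v.1 v.2 := by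
  have : condDistrib (fun ω => D.nested false false ω - D.pY0 false ω)
      (fun ω => (D.pM false ω, D.X ω)) (D.given Pr false)
      = condDistrib oΔ oMX (group (D.law Pr) false) := by
    refine condDistrib_eq_of_map_eq ?_
    rw [group_law, Measure.map_map (measurable_oMX.prodMk measurable_oΔ) D.measurable_obs]
    refine Measure.map_congr ?_
    filter_upwards [h.ae_given false] with ω hω
    rw [hω.1, hω.2.1, hω.2.2]
    rfl
  rw [trend, this, delta]

theorem trend_ae_eq_condExp {a g : Bool}
    (h : Integrable (fun ω => D.nested false a ω - D.pY0 false ω) (D.given Pr g)) :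
    (fun ω => D.trend Pr a g (D.pM a ω, D.X ω)) =ᵐ[D.given Pr g]
      (D.given Pr g)[fun ω => D.nested false a ω - D.pY0 false ω|
        MeasurableSpace.comap (fun ω => (D.pM a ω, D.X ω)) inferInstance] :=
  (condExp_ae_eq_integral_condDistrib' ((D.measurable_pM a).prodMk D.measurable_X) h).symm

theorem integral_trend {a g : Bool}
    (h : Integrable (fun ω => D.nested false a ω - D.pY0 false ω) (D.given Pr g)) :
    ∫ ω, D.trend Pr a g (D.pM a ω, D.X ω) ∂(D.given Pr g)
      = ∫ ω, (D.nested false a ω - D.pY0 false ω) ∂(D.given Pr g) := by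
  rw [integral_congr_ae (trend_ae_eq_condExp h),
    integral_condExp ((D.measurable_pM a).prodMk D.measurable_X).comap_le]

theorem map_given_oX (g : Bool) :
    (D.given Pr g).map D.X = (group (D.law Pr) g).map oX := by
  rw [group_law, Measure.map_map measurable_oX D.measurable_obs]
  rfl

theorem map_given_XM (g : Bool) : (D.given Pr g).map (fun ω => (D.X ω, D.M ω))
    = (group (D.law Pr) g).map fun o => (oX o, oM o) := by
  rw [group_law, Measure.map_map (measurable_oX.prodMk measurable_oM) D.measurable_obs]
  rfl

/-- Formulating the identity for the law of (M(0), X) allows it to be evaluated at (M(1), X), once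
absolute continuity is available. -/
theorem trend_ae_eq_of_parallelTrends (h2 : D.ParallelTrends Pr) (h5 : D.Consistency Pr) :
    ∀ᵐ v ∂((D.given Pr true).map fun ω => (D.pM false ω, D.X ω)),
      D.trend Pr false true v = delta (D.law Pr) false v.1 v.2 := by
  have hm : Measurable (D.trend Pr false true) :=
    (StronglyMeasurable.integral_condDistrib
      (X := fun ω => (D.pM false ω, D.X ω)) (Y := fun ω => D.nested false false ω - D.pY0 false ω)
      (μ := D.given Pr true) (f := fun p : (ℳ × 𝒳) × ℝ => p.2)
      measurable_snd.stronglyMeasurable).measurable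
  rw [ae_map_iff ((D.measurable_pM false).prodMk D.measurable_X).aemeasurable
    (measurableSet_eq_fun hm (measurable_delta _ _))]
  filter_upwards [h2] with ω hω
  rw [hω, trend_false_false_eq_delta h5]

variable [StandardBorelSpace ℳ] [Nonempty ℳ]

/-- Under conditional independence of `G` and `M(a)` given `X`, the conditional law of `M(a)` given
`X` is the same in every group. -/
theorem CondIndepMediator.map_given {a : Bool} (h : D.CondIndepMediator Pr a) (g : Bool) :
    (D.given Pr g).map (fun ω => (D.X ω, D.pM a ω))
      = (D.given Pr g).map D.X ⊗ₘ condDistrib (D.pM a) D.X Pr := by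
  have hXM : Measurable fun ω => (D.X ω, D.pM a ω) := D.measurable_X.prodMk (D.measurable_pM a)
  have hGm := D.measurableSet_G g
  rw [given_eq, Measure.map_smul, Measure.map_smul, Measure.compProd_smul_left]
  congr 1
  refine Measure.ext_prod fun {C B} hC hB => ?_
  have hS : MeasurableSet (D.X ⁻¹' C) := D.measurable_X hC
  have hMB : MeasurableSet (D.pM a ⁻¹' B) := D.measurable_pM a hB
  have hle := D.measurable_X.comap_le
  have hκm : Measurable fun x => condDistrib (D.pM a) D.X Pr x B := Kernel.measurable_coe _ hB
  set q : Ω → ℝ := fun ω => (condDistrib (D.pM a) D.X Pr (D.X ω)).real B with hq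
  have hqm : Measurable[MeasurableSpace.comap D.X inferInstance] q :=
    hκm.ennreal_toReal.comp (comap_measurable D.X)
  have hq1 : ∀ ω, ‖q ω‖ ≤ 1 := fun ω => by
    rw [Real.norm_eq_abs, abs_of_nonneg measureReal_nonneg]
    exact measureReal_le_one
  have hqe : q =ᵐ[Pr] Pr⟦D.pM a ⁻¹' B | MeasurableSpace.comap D.X inferInstance⟧ :=
    condDistrib_ae_eq_condExp D.measurable_X (D.measurable_pM a) hB
  have i1 : Integrable ((D.G ⁻¹' {g}).indicator fun _ => (1 : ℝ)) Pr :=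
    (integrable_const _).indicator hGm
  have i2 : Integrable ((D.G ⁻¹' {g} ∩ D.pM a ⁻¹' B).indicator fun _ => (1 : ℝ)) Pr :=
    (integrable_const _).indicator (hGm.inter hMB)
  have i3 : Integrable (fun ω => q ω * (D.G ⁻¹' {g}).indicator (fun _ => (1 : ℝ)) ω) Pr :=
    i1.bdd_mul (c := 1) (hqm.mono hle le_rfl).aestronglyMeasurable (Eventually.of_forall hq1)
  -- Given X, conditional independence factors the probability of {G = g, M(a) ∈ B}; pulling out the
  -- X-measurable q puts the indicator of G = g back.
  have e1 : Pr.real (D.X ⁻¹' C ∩ (D.G ⁻¹' {g} ∩ D.pM a ⁻¹' B))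
      = ∫ ω in D.X ⁻¹' C ∩ D.G ⁻¹' {g}, q ω ∂Pr := by
    have s1 : Pr.real (D.X ⁻¹' C ∩ (D.G ⁻¹' {g} ∩ D.pM a ⁻¹' B))
        = ∫ ω in D.X ⁻¹' C, (D.G ⁻¹' {g} ∩ D.pM a ⁻¹' B).indicator (fun _ => (1 : ℝ)) ω ∂Pr := by
      rw [setIntegral_indicator (hGm.inter hMB)]
      simp
    have s2 : ∫ ω in D.X ⁻¹' C ∩ D.G ⁻¹' {g}, q ω ∂Pr
        = ∫ ω in D.X ⁻¹' C, q ω * (D.G ⁻¹' {g}).indicator (fun _ => (1 : ℝ)) ω ∂Pr := by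
      rw [← setIntegral_indicator hGm]
      refine integral_congr_ae (Eventually.of_forall fun ω => ?_)
      by_cases hω : ω ∈ D.G ⁻¹' {g}
      · simp only [Set.indicator_of_mem hω, mul_one]
      · simp only [Set.indicator_of_notMem hω, mul_zero]
    rw [s1, s2, ← setIntegral_condExp hle i2 ⟨C, hC, rfl⟩, ← setIntegral_condExp hle i3
      ⟨C, hC, rfl⟩]
    refine integral_congr_ae (ae_restrict_of_ae ?_)
    filter_upwards [h {g} B hB, hqe,
      condExp_mul_of_stronglyMeasurable_left hqm.stronglyMeasurable i3 i1] with ω h1 h2 h3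
    refine h1.trans (Eq.trans ?_ h3.symm)
    rw [Pi.mul_apply, h2, mul_comm]
  have hqi : Integrable q (Pr.restrict (D.X ⁻¹' C ∩ D.G ⁻¹' {g})) :=
    Integrable.of_bound (hqm.mono hle le_rfl).aestronglyMeasurable 1 (Eventually.of_forall hq1)
  rw [Measure.compProd_apply_prod hC hB, Measure.map_apply hXM (hC.prod hB),
    Measure.restrict_apply (hXM (hC.prod hB)), setLIntegral_map hC hκm D.measurable_X,
    Measure.restrict_restrict hS]
  have e2 := congrArg ENNReal.ofReal e1
  rw [ofReal_measureReal, ofReal_integral_eq_lintegral_ofReal hqi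
    (Eventually.of_forall fun ω => measureReal_nonneg)] at e2
  have hpt : ∀ ω, ENNReal.ofReal (q ω) = condDistrib (D.pM a) D.X Pr (D.X ω) B := fun ω =>
    ofReal_measureReal
  simp only [hpt] at e2
  rw [← e2]
  congr 1
  ext ω
  simp only [Set.mem_inter_iff, Set.mem_preimage, Set.mem_prod]
  tauto

section Identification

variable {c : ℝ}

/-- The law of `(X, M(0))` in the treated group, from the law of the observed data. -/
theorem map_given_true_XM_false (hc : 0 < c) (hpos : GroupPositivity c (D.law Pr))
    (hci : D.CondIndepMediator Pr false) (h5 : D.Consistency Pr) :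
    (D.given Pr true).map (fun ω => (D.X ω, D.pM false ω))
      = (D.given Pr true).map D.X ⊗ₘ condDistrib oM oX (group (D.law Pr) false) := by
  rw [hci.map_given true]
  refine Measure.compProd_congr ?_
  have hac : (D.given Pr true).map D.X ≪ (group (D.law Pr) false).map oX := by
    rw [map_given_oX]
    exact map_group_absolutelyContinuous measurable_oX hc hpos hpos.overlap_oX
  -- Among the untreated M(0) = M, so the two kernels agree almost everywhere for the law of X given
  -- G = 0; overlap carries this over to the treated.
  refine hac.ae_le (condDistrib_ae_eq_of_measure_eq_compProd oX measurable_oM.aemeasurable ?_).symm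
  rw [← map_given_XM, ← map_given_oX, ← hci.map_given false]
  refine Measure.map_congr ?_
  filter_upwards [h5.ae_given false] with ω hω
  rw [hω.1]

/-- In the treated group the law of `(M(1), X)` is dominated by that of `(M(0), X)`. -/
theorem map_given_true_absolutelyContinuous (hc : 0 < c) (hpos : GroupPositivity c (D.law Pr))
    (hci : D.CondIndepMediator Pr false) (h5 : D.Consistency Pr) :
    (D.given Pr true).map (fun ω => (D.pM true ω, D.X ω))
      ≪ (D.given Pr true).map fun ω => (D.pM false ω, D.X ω) := by
  have hXM : ∀ a, Measurable fun ω => (D.X ω, D.pM a ω) := fun a =>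
    D.measurable_X.prodMk (D.measurable_pM a)
  have key : (D.given Pr true).map (fun ω => (D.X ω, D.pM true ω))
      ≪ (D.given Pr true).map fun ω => (D.X ω, D.pM false ω) := by
    have h1 : (D.given Pr true).map (fun ω => (D.X ω, D.pM true ω))
        = ((group (D.law Pr) true).map oMX).map Prod.swap := by
      rw [Measure.map_map measurable_swap measurable_oMX, group_law,
        Measure.map_map (measurable_swap.comp measurable_oMX) D.measurable_obs]
      refine Measure.map_congr ?_
      filter_upwards [h5.ae_given true] with ω hω
      rw [hω.1]
      rfl
    have h0 : (D.given Pr false).map (fun ω => (D.X ω, D.pM false ω))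
        = ((group (D.law Pr) false).map oMX).map Prod.swap := by
      rw [Measure.map_map measurable_swap measurable_oMX, group_law,
        Measure.map_map (measurable_swap.comp measurable_oMX) D.measurable_obs]
      refine Measure.map_congr ?_
      filter_upwards [h5.ae_given false] with ω hω
      rw [hω.1]
      rfl
    -- Overlap given (M,X) compares the observed pairs, M(1) among the treated with M(0) among the
    -- untreated. The latter law disintegrates through the kernel of M(0) given X, common to both
    -- groups, so only the marginal of X has to be exchanged.
    have h2 : (D.given Pr true).map (fun ω => (D.X ω, D.pM true ω))
        ≪ (D.given Pr false).map D.X ⊗ₘ condDistrib (D.pM false) D.X Pr := by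
      rw [← hci.map_given false, h0, h1]
      exact (map_group_absolutelyContinuous measurable_oMX hc hpos hpos.overlap_oMX).map
        measurable_swap
    have h3 := absolutelyContinuous_fst_compProd h2
    rwa [Measure.fst_map_prodMk (D.measurable_pM true), ← hci.map_given true] at h3
  have h4 : ∀ a, (D.given Pr true).map (fun ω => (D.pM a ω, D.X ω))
      = ((D.given Pr true).map (fun ω => (D.X ω, D.pM a ω))).map Prod.swap := fun a => by
    rw [Measure.map_map measurable_swap (hXM a)]
    rfl
  rw [h4, h4]
  exact key.map measurable_swap

theorem integral_nested_false_false
    (hint : Integrable (fun ω => D.nested false false ω - D.pY0 false ω) (D.given Pr true))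
    (hc : 0 < c) (hpos : GroupPositivity c (D.law Pr))
    (h2 : D.ParallelTrends Pr) (hci : D.CondIndepMediator Pr false) (h5 : D.Consistency Pr) :
    ∫ ω, (D.nested false false ω - D.pY0 false ω) ∂(D.given Pr true)
      = tauObs false false (D.law Pr) := by
  have hXM : Measurable fun ω => (D.X ω, D.pM false ω) :=
    D.measurable_X.prodMk (D.measurable_pM false)
  have hδm : Measurable fun p : 𝒳 × ℳ => delta (D.law Pr) false p.2 p.1 :=
    (measurable_delta _ _).comp measurable_swap
  have hae : (fun ω => D.trend Pr false true (D.pM false ω, D.X ω)) =ᵐ[D.given Pr true]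
      fun ω => delta (D.law Pr) false (D.pM false ω) (D.X ω) :=
    ae_of_ae_map ((D.measurable_pM false).prodMk D.measurable_X).aemeasurable
      (trend_ae_eq_of_parallelTrends h2 h5)
  -- Integrability of δ(0, M(0), X) among the treated is inherited from the potential outcome
  -- change, whose conditional expectation it is.
  have hi : Integrable (fun ω => delta (D.law Pr) false (D.pM false ω) (D.X ω))
      (D.given Pr true) :=
    (integrable_condExp.congr (trend_ae_eq_condExp hint).symm).congr hae
  have hi' : Integrable (fun p : 𝒳 × ℳ => delta (D.law Pr) false p.2 p.1)
      ((D.given Pr true).map fun ω => (D.X ω, D.pM false ω)) :=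
    (integrable_map_measure hδm.aestronglyMeasurable hXM.aemeasurable).2 hi
  rw [← integral_trend hint, integral_congr_ae hae,
    ← integral_map (f := fun p : 𝒳 × ℳ => delta (D.law Pr) false p.2 p.1) hXM.aemeasurable
      hδm.aestronglyMeasurable]
  rw [map_given_true_XM_false hc hpos hci h5] at hi' ⊢
  rw [Measure.integral_compProd hi', tauObs,
    integral_group_law (f := fun o => nu (D.law Pr) false false (oX o))
      ((measurable_nu _ _ _).comp measurable_oX)]
  exact integral_map (f := nu (D.law Pr) false false) D.measurable_X.aemeasurable
    (measurable_nu _ _ _).aestronglyMeasurable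

/-- Sequential ignorability replaces the regression on M(1) by the one on M(0), evaluated at M(1);
domination lets parallel trends apply there, and M(1) = M among the treated. -/
theorem integral_nested_false_true
    (hint : Integrable (fun ω => D.nested false true ω - D.pY0 false ω) (D.given Pr true))
    (hΔ : MemLp oΔ 2 (D.law Pr : Measure (Obs 𝒳 ℳ)))
    (hc : 0 < c) (hpos : GroupPositivity c (D.law Pr))
    (h2 : D.ParallelTrends Pr) (h3 : D.SequentialIgnorability Pr) (h5 : D.Consistency Pr) :
    ∫ ω, (D.nested false true ω - D.pY0 false ω) ∂(D.given Pr true)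
      = tauObs false true (D.law Pr) := by
  have hae : ∀ᵐ ω ∂(D.given Pr true), D.trend Pr false true (D.pM true ω, D.X ω)
      = delta (D.law Pr) false (D.pM true ω) (D.X ω) :=
    ae_of_ae_map ((D.measurable_pM true).prodMk D.measurable_X).aemeasurable
      ((map_given_true_absolutelyContinuous hc hpos (h3.1 false) h5).ae_le
        (trend_ae_eq_of_parallelTrends h2 h5))
  rw [← integral_trend hint, tauObs_false_true_eq_integral hc hpos hΔ,
    integral_group_law (f := fun o => delta (D.law Pr) false (oM o) (oX o))
      ((measurable_delta _ _).comp measurable_oMX)]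
  refine integral_congr_ae ?_
  filter_upwards [h3.2, hae, h5.ae_given true] with ω e1 e2 e3
  rw [e1, e2, e3.1]
  rfl

theorem integral_nested_true_true (hΔ : MemLp oΔ 2 (D.law Pr : Measure (Obs 𝒳 ℳ)))
    (hc : 0 < c) (hpos : GroupPositivity c (D.law Pr)) (h1 : D.NoAnticipation Pr)
    (h5 : D.Consistency Pr) :
    ∫ ω, (D.nested true true ω - D.pY0 false ω) ∂(D.given Pr true)
      = tauObs true true (D.law Pr) := by
  rw [tauObs_true_true hc hpos hΔ, probTreated, ← integral_group_eq,
    integral_group_law measurable_oΔ]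
  exact integral_congr_ae (ae_nested_true_true h1 h5)

end Identification

end Design

end MedDiD

/-! ### The main theorem -/

open MedDiD in
theorem theorem2 {Ω 𝒳 ℳ : Type*} [MeasurableSpace Ω] [MeasurableSpace 𝒳] [MeasurableSpace ℳ]
    [StandardBorelSpace ℳ] [Nonempty ℳ]
    (Pr : Measure Ω) [IsProbabilityMeasure Pr] (D : Design Ω 𝒳 ℳ)
    -- the mediator densities `f(m | g, x)` and `f(m | x)` with respect to `ℓ`
    (ℓ : Measure ℳ) [SigmaFinite ℓ] (f : Bool → 𝒳 → ℳ → ℝ≥0) (fMarg : 𝒳 → ℳ → ℝ≥0)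
    (hf : ∀ g, IsMediatorDensity ℓ (group (D.law Pr) g) (f g))
    (hfMarg : IsMediatorDensity ℓ (D.law Pr : Measure (Obs 𝒳 ℳ)) fMarg)
    -- moment conditions
    (hΔ : MemLp (fun ω => D.Y1 ω - D.Y0 ω) 2 Pr)
    (hint : ∀ g, Integrable (fun ω => D.nested false g ω - D.pY0 false ω) (D.given Pr true))
    -- the causal assumptions
    (h1 : D.NoAnticipation Pr) (h2 : D.ParallelTrends Pr) (h3 : D.SequentialIgnorability Pr)
    (h4 : D.Positivity Pr f fMarg) (h5 : D.Consistency Pr) :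
    IsEIF (tauObs true true) (D.law Pr) (phi11 (D.law Pr)) ∧
    IsEIF (tauObs false false) (D.law Pr) (phi00 (D.law Pr)) ∧
    IsEIF (tauObs false true) (D.law Pr) (phi01 (D.law Pr) f) ∧
    -- the natural indirect effect
    (D.tauIE Pr = tauObs false true (D.law Pr) - tauObs false false (D.law Pr) ∧
      IsEIF (fun Q => tauObs false true Q - tauObs false false Q) (D.law Pr)
        (fun o => phi01 (D.law Pr) f o - phi00 (D.law Pr) o)) ∧
    -- the natural direct effect
    (D.tauDE Pr = tauObs true true (D.law Pr) - tauObs false true (D.law Pr) ∧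
      IsEIF (fun Q => tauObs true true Q - tauObs false true Q) (D.law Pr)
        (fun o => phi11 (D.law Pr) o - phi01 (D.law Pr) f o)) ∧
    -- the total effect
    (D.tauTotal Pr = tauObs true true (D.law Pr) - tauObs false false (D.law Pr) ∧
      IsEIF (fun Q => tauObs true true Q - tauObs false false Q) (D.law Pr)
        (fun o => phi11 (D.law Pr) o - phi00 (D.law Pr) o)) := by
  obtain ⟨c, hc, hpos, -⟩ := h4
  have hΔ' : MemLp oΔ 2 (D.law Pr : Measure (Obs 𝒳 ℳ)) :=
    (memLp_map_measure_iff measurable_oΔ.aestronglyMeasurable D.measurable_obs.aemeasurable).2 hΔ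
  have hG1 : Pr (D.G ⁻¹' {true}) ≠ 0 := by
    have := hpos.group_true_ne_zero hc
    change (Pr.map D.obs) _ ≠ 0 at this
    rwa [Measure.map_apply D.measurable_obs (measurableSet_oG true)] at this
  have i11 := Design.integrable_nested_true_true h1 hΔ hG1 h5
  have e11 := Design.integral_nested_true_true hΔ' hc hpos h1 h5
  have e00 := Design.integral_nested_false_false (hint false) hc hpos h2 (h3.1 false) h5
  have e01 := Design.integral_nested_false_true (hint true) hΔ' hc hpos h2 h3 h5
  have E11 := isEIF_tauObs_true_true hc hpos hΔ'
  have E00 := isEIF_tauObs_false_false hc hpos hΔ'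
  have E01 := isEIF_tauObs_false_true hc hpos hΔ' hf
  refine ⟨E11, E00, E01, ⟨?_, E01.sub E00⟩, ⟨?_, E11.sub E01⟩, ⟨?_, E11.sub E00⟩⟩
  -- Every identified mean subtracts the same Y_0(0), so it cancels in each contrast.
  · rw [← e01, ← e00, ← integral_sub (hint true) (hint false)]
    simp only [sub_sub_sub_cancel_right]
    rfl
  · rw [← e11, ← e01, ← integral_sub i11 (hint true)]
    simp only [sub_sub_sub_cancel_right]
    rfl
  · rw [← e11, ← e00, ← integral_sub i11 (hint false)]
    simp only [sub_sub_sub_cancel_right]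
    rfl
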